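/- Let $q>0$ be real. For real $x$ put $[x]=(q^x-q^{-x})/(q-q^{-1})$ if $q\neq 1$ and $[x]=x$ if $q=1$ (the case of SU(2)); $[n]!=[n][n-1]\cdots[1]$, $[0]!=1$, and $1/[n]!=0$ for integers $n<0$. All sums below run over the (finitely many) values of the summation variable in $\frac12\mathbb Z_{\ge0}$ (for $x$, $j$) or $\mathbb Z_{\ge0}$ (for $u$, $z$) for which every factorial occurring in a denominator has a non-negative integer argument. Put $$\nabla[abc]=\left(\frac{[a+b-c]!\,[a-b+c]!\,[a+b+c+1]!}{[b+c-a]!}\right)^{1/2}.$$ Let $V_j$ ($j\in\frac12\mathbb Z_{\ge0}$) be the spin-$j$ irreducible representation of $u_q(2)$, with orthonormal basis $|j\,m\rangle$, $J_0|jm\rangle=m|jm\rangle$, $J_\pm|jm\rangle=([j\mp m][j\pm m+1])^{1/2}|j,m\pm1\rangle$. On $V_{j_1}\otimes V_{j_2}$ let $u_q(2)$ act by $\Delta J_0=J_0\otimes1+1\otimes J_0$, $\Delta J_\pm=J_\pm\otimes q^{J_0}+q^{-J_0}\otimes J_\pm$. If $j_1,j_2,j$ satisfy the triangle conditions, there is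 exactly one isometric intertwining operator $V_j\to V_{j_1}\otimes V_{j_2}$ whose matrix element with $m_1=j_1$, $m_2=j-j_1$, $m=j$ is positive. Its matrix elements are the Clebsch–Gordan coefficients $\left[\begin{smallmatrix}j_1&j_2&j\\m_1&m_2&m\end{smallmatrix}\right]_q$; a coefficient is $0$ when its labels violate the triangle conditions or some $m$ is not a weight of its spin. Let $\left\{\begin{smallmatrix}a&b&e\\d&c&f\end{smallmatrix}\right\}_q$ be the $q$-$6j$ coefficient, given by the $q$-Racah formula $$\Delta[abe]\Delta[acf]\Delta[dbf]\Delta[dce]\sum_z\frac{(-1)^z[z+1]!}{[z-a-b-e]![z-a-c-f]![z-d-b-f]![z-d-c-e]![a+b+c+d-z]![a+d+e+f-z]![b+c+e+f-z]!},$$ with $\Delta[abc]=\left([a+b-c]![a-b+c]![b+c-a]!/[a+b+c+1]!\right)^{1/2}$. Let $j_1,m_1,j_2,m_2,j,m$ be spins and weights with the triangle conditions and $m=m_1+m_2$, and put $a=\frac12(j_2+m_2)$, $b=\frac12(j_2-m_2)$, $m'=m_1+a=m+b$. (i) Recoupling relation: $$\left[\begin{matrix}a&b&j_2\\a&-b&m_2\end{matrix}\right]_q\left[\begin{matrix}j_1&j_2&j\\m_1&m_2&m\end{matrix}\right]_q=\sum_x(-1)^{j_1+j_2+j}([2x+1][2j_2+1])^{1/2}\left\{\begin{matrix}a&b&j_2\\j&j_1&x\end{matrix}\right\}_q\left[\begin{matrix}j_1&a&x\\m_1&a&m'\end{matrix}\right]_q\left[\begin{matrix}x&b&j\\m'&-b&m\end{matrix}\right]_q$$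 where $x$ runs over the spins allowed by the triangle conditions. (ii) Very-well-poised expression: $$\left[\begin{matrix}j_1&j_2&j\\m_1&m_2&m\end{matrix}\right]_q=\nabla[j_2j_1j]\left(\frac{[2j+1][j_2+m_2]![j_2-m_2]![j_1-m_1]![j-m]!}{[j_1+m_1]![j+m]!}\right)^{1/2}q^{\frac12\{j_2(j_2+1)-j_1(j_1+1)-j(j+1)\}-m_1j_2-\frac14(j_2+m_2)(j_2+m_2+2)}$$ $$\times\sum_x\frac{(-1)^{j_1+a-x}q^{x(x+1)}[2x+1][x+m']!}{\nabla^2[a,j_1,x]\,\nabla^2[b,j,x]\,[x-m']!}.$$ (iii) Regge symmetries. Put $p_1=b-j-1$, $p_2=-m'-1$, $p_3=a-j_1-1$, $p_4=b+j$, $p_5=a+j_1$. For each of the 12 combinations of a permutation of $(p_1,p_2,p_3)$ and a permutation of $(p_4,p_5)$, the permuted parameters $\bar p_i$ belong to admissible spin and weight labels $(\bar j_1,\bar m_1,\bar j_2,\bar m_2,\bar j,\bar m)$, and the normalized coefficient $$q^{(m_2-m_1)/3}[2j+1]^{-1/2}\left[\begin{matrix}j_1&j_2&j\\m_1&m_2&m\end{matrix}\right]_q$$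 is invariant under this change of labels up to the sign $(-1)^{\bar p_5-p_5}$ (which is $1$ if $p_4,p_5$ are not interchanged). (iv) Transformation formula. Let $p_1,\dots,p_5$ be all integers or all half-odd integers, with $p_1+p_2\le-2$, $p_1+p_3\le-2$, $p_2+p_3\le-2$. Then $$\sum_{j}\frac{(-1)^{p_2+j+1}q^{j(j+1)}[2j+1][j-p_1-1]![j-p_2-1]![j-p_3-1]!}{[p_1+j+1]![p_2+j+1]![p_3+j+1]![p_4-j]![p_4+j+1]![p_5-j]![p_5+j+1]!}$$ $$=\frac{q^{-(p_4+1)(p_5+1)-p_2(p_4+p_5+1)}[-p_1-p_3-2]!}{[p_1+p_4+1]![p_2+p_5+1]![p_3+p_4+1]!}\sum_u\frac{(-1)^uq^{u(p_2+p_5+1)}[p_4-p_3-1-u]![p_4-p_1-1-u]!}{[u]![-p_1-p_3-2-u]![p_2+p_4+1-u]![p_4+p_5+1-u]!}.$$ -/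

import Mathlib

open scoped Kronecker

noncomputable section

namespace QuantumSU2

/-- The `q`-number `[x]` for `q > 0`; for `q = 1` it is `x`. -/
def qnum (q x : ℝ) : ℝ :=
  if q = 1 then x else (q ^ x - q ^ (-x)) / (q - q⁻¹)

open Classical in
/-- The `q`-factorial `[x]!` of a natural number `x`, extended by `0` to all other real `x`.
With `0⁻¹ = 0` this gives the convention that `1 / [x]!` vanishes for negative integers `x`. -/
def qfact (q x : ℝ) : ℝ :=
  if (∃ k : ℕ, x = k) then ∏ k ∈ Finset.range ⌊x⌋₊, qnum q ((k : ℝ) + 1) else 0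

/-- The sign `(-1)^x` of an integer `x` (given as a real number). -/
def sgn (x : ℝ) : ℝ := (-1) ^ ⌊x⌋

/-- The sum over all non-negative integers and half-integers. -/
def halfSum (f : ℝ → ℝ) : ℝ := ∑ᶠ n : ℕ, f ((n : ℝ) / 2)

/-- The asymmetric triangle coefficient `∇[abc]`. -/
def nabla (q a b c : ℝ) : ℝ :=
  √(qfact q (a + b - c) * qfact q (a - b + c) * qfact q (a + b + c + 1) / qfact q (b + c - a))

/-- The symmetric triangle coefficient `Δ[abc]`; it vanishes unless `a, b, c` satisfy the
triangle conditions. -/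
def triangle (q a b c : ℝ) : ℝ :=
  √(qfact q (a + b - c) * qfact q (a - b + c) * qfact q (b + c - a) / qfact q (a + b + c + 1))

/-- The `q`-`6j` coefficient with rows `a b e` and `d c f`, by the `q`-Racah formula. -/
def sixJ (q a b e d c f : ℝ) : ℝ :=
  triangle q a b e * triangle q a c f * triangle q d b f * triangle q d c e *
    ∑ᶠ z : ℕ, sgn z * qfact q (z + 1) /
      (qfact q (z - a - b - e) * qfact q (z - a - c - f) * qfact q (z - d - b - f) *
        qfact q (z - d - c - e) * qfact q (a + b + c + d - z) * qfact q (a + d + e + f - z) *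
        qfact q (b + c + e + f - z))

/-! The irreducible representation of spin `n / 2` of `u_q(2)`, with the basis `|j m⟩`,
`j = n / 2`, `m = k - n / 2`, indexed by `k : Fin (n + 1)`. -/

/-- The weight `m` of the `k`-th basis vector. -/
def weight (n : ℕ) (k : Fin (n + 1)) : ℝ := (k : ℝ) - (n : ℝ) / 2

/-- The generator `J₀`. -/
def J0 (n : ℕ) : Matrix (Fin (n + 1)) (Fin (n + 1)) ℝ := Matrix.diagonal (weight n)

/-- The operator `q ^ (s J₀)`. -/
def qJ0 (q s : ℝ) (n : ℕ) : Matrix (Fin (n + 1)) (Fin (n + 1)) ℝ :=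
  Matrix.diagonal fun k => q ^ (s * weight n k)

/-- The raising generator: `J₊ |j m⟩ = ([j - m][j + m + 1])^{1/2} |j, m + 1⟩`. -/
def Jp (q : ℝ) (n : ℕ) : Matrix (Fin (n + 1)) (Fin (n + 1)) ℝ :=
  Matrix.of fun i k =>
    if (i : ℕ) = (k : ℕ) + 1 then
      √(qnum q ((n : ℝ) / 2 - weight n k) * qnum q ((n : ℝ) / 2 + weight n k + 1))
    else 0

/-- The lowering generator: `J₋ |j m⟩ = ([j + m][j - m + 1])^{1/2} |j, m - 1⟩`. -/
def Jm (q : ℝ) (n : ℕ) : Matrix (Fin (n + 1)) (Fin (n + 1)) ℝ :=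
  Matrix.of fun i k =>
    if (i : ℕ) + 1 = (k : ℕ) then
      √(qnum q ((n : ℝ) / 2 + weight n k) * qnum q ((n : ℝ) / 2 - weight n k + 1))
    else 0

/-- `C` is the matrix of Clebsch–Gordan coefficients for the coupling of the spins `n₁ / 2` and
`n₂ / 2` to the spin `n / 2`: it is the isometric intertwining operator into the tensor product,
where `u_q(2)` acts through the coproduct `Δ J₀ = J₀ ⊗ 1 + 1 ⊗ J₀`,
`Δ J± = J± ⊗ q^{J₀} + q^{-J₀} ⊗ J±`, normalized by the Condon–Shortley condition that the entry with
`m₁ = j₁`, `m = j` (hence `m₂ = j - j₁`) is positive. -/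
structure IsClebschGordan (q : ℝ) (n₁ n₂ n : ℕ)
    (C : Matrix (Fin (n₁ + 1) × Fin (n₂ + 1)) (Fin (n + 1)) ℝ) : Prop where
  zero : (J0 n₁ ⊗ₖ (1 : Matrix (Fin (n₂ + 1)) (Fin (n₂ + 1)) ℝ) +
    (1 : Matrix (Fin (n₁ + 1)) (Fin (n₁ + 1)) ℝ) ⊗ₖ J0 n₂) * C = C * J0 n
  raise : (Jp q n₁ ⊗ₖ qJ0 q 1 n₂ + qJ0 q (-1) n₁ ⊗ₖ Jp q n₂) * C = C * Jp q n
  lower : (Jm q n₁ ⊗ₖ qJ0 q 1 n₂ + qJ0 q (-1) n₁ ⊗ₖ Jm q n₂) * C = C * Jm q n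
  isometry : C.transpose * C = 1
  pos : ∀ k₂ : Fin (n₂ + 1), n₁ + 2 * (k₂ : ℕ) = n₂ + n → 0 < C (Fin.last n₁, k₂) (Fin.last n)

open Classical in
/-- The matrix of Clebsch–Gordan coefficients; `0` if the spins cannot be coupled. -/
def cgMatrix (q : ℝ) (n₁ n₂ n : ℕ) : Matrix (Fin (n₁ + 1) × Fin (n₂ + 1)) (Fin (n + 1)) ℝ :=
  if h : ∃ C, IsClebschGordan q n₁ n₂ n C then h.choose else 0

/-- `x` is a non-negative integer. -/
def IsNat (x : ℝ) : Prop := ∃ k : ℕ, x = k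

/-- `j` is a spin and `m` is one of its weights `-j, -j + 1, …, j`. -/
def IsState (j m : ℝ) : Prop := IsNat (j + m) ∧ IsNat (j - m)

open Classical in
/-- The Clebsch–Gordan coefficient `[j₁ j₂ j; m₁ m₂ m]_q`, equal to `0` outside the range of the
spin and weight labels. -/
def CG (q j₁ m₁ j₂ m₂ j m : ℝ) : ℝ :=
  if IsState j₁ m₁ ∧ IsState j₂ m₂ ∧ IsState j m then
    cgMatrix q ⌊2 * j₁⌋₊ ⌊2 * j₂⌋₊ ⌊2 * j⌋₊
      (Fin.ofNat _ ⌊j₁ + m₁⌋₊, Fin.ofNat _ ⌊j₂ + m₂⌋₊) (Fin.ofNat _ ⌊j + m⌋₊)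
  else 0

/-- The labels of a Clebsch–Gordan coefficient. -/
@[ext]
structure Labels where
  j₁ : ℝ
  m₁ : ℝ
  j₂ : ℝ
  m₂ : ℝ
  j : ℝ
  m : ℝ

/-- The usual conditions on the labels: each `m` is a weight of its spin, the spins satisfy the
triangle conditions, and `m = m₁ + m₂`. -/
structure Labels.Admissible (L : Labels) : Prop where
  state₁ : IsState L.j₁ L.m₁
  state₂ : IsState L.j₂ L.m₂
  state : IsState L.j L.m
  tri : IsNat (L.j₁ + L.j₂ - L.j)
  tri₁ : IsNat (L.j₁ - L.j₂ + L.j)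
  tri₂ : IsNat (L.j₂ - L.j₁ + L.j)
  weight_add : L.m = L.m₁ + L.m₂

/-- The coefficient with the labels `L`. -/
def Labels.cg (L : Labels) (q : ℝ) : ℝ := CG q L.j₁ L.m₁ L.j₂ L.m₂ L.j L.m

/-- `(j₂ + m₂) / 2` -/
def Labels.a (L : Labels) : ℝ := (L.j₂ + L.m₂) / 2

/-- `(j₂ - m₂) / 2` -/
def Labels.b (L : Labels) : ℝ := (L.j₂ - L.m₂) / 2

/-- `m' = m₁ + (j₂ + m₂) / 2` -/
def Labels.m' (L : Labels) : ℝ := L.m₁ + (L.j₂ + L.m₂) / 2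

/-- The parameters `p₁, p₂, p₃`. -/
def Labels.lowerParam (L : Labels) : Fin 3 → ℝ :=
  ![L.b - L.j - 1, -L.m' - 1, L.a - L.j₁ - 1]

/-- The parameters `p₄, p₅`. -/
def Labels.upperParam (L : Labels) : Fin 2 → ℝ := ![L.b + L.j, L.a + L.j₁]

/-- The Clebsch–Gordan coefficient in the normalization of a `q`-`3j` symbol (without its sign). -/
def Labels.reduced (L : Labels) (q : ℝ) : ℝ :=
  q ^ ((L.m₂ - L.m₁) / 3) * L.cg q / √(qnum q (2 * L.j + 1))

end QuantumSU2

end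

namespace QuantumSU2

variable {q : ℝ}

/-! ### `q`-numbers and `q`-factorials -/

/-! The transformation formula (iv) is the analytic core. Both sides satisfy the same recursion X(p₄
- 1) - X(p₂ - 1) = [p₄ - p₂][p₂ + p₄ + 1] X in the parameters p₂ and p₄. For the very-well-poised
sum this holds term by term (`poisedTerm_recursion`); for the ₃φ₂ sum the difference of the summands
telescopes (`hypSum_contiguous`). Each recursion lowers n = p₂ + p₄ + 1 by one. At n = 0 both sides
are a single term, so induction on n proves equality (`halfSum_poisedTerm`). Everything reduces to
the addition law `qnum_add` and to `qnum_mul_sub_mul`.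

For (ii), the coefficients are not computed from their definition. A ₃φ₂ candidate `cgPhi` is
written down and shown to be the required intertwiner. A second telescoping sum gives the action of
the lowering operator (`cgPhi_lowering`). On the highest weight the series has one term, so
annihilation by the raising operator is a two-term cancellation (`cgPhi_raising`) and the norm is a
q-Vandermonde sum. The relation J₊J₋ - J₋J₊ = [2J₀], together with J₊ being the transpose of J₋,
then yields the raising relations, all norms, and annihilation of the lowest vector, with no further
series identity.

The intertwiner is unique because a highest weight vector is determined by its coordinates with m₁ =
j₁. Only one of these is nonzero, its size is fixed by the norm and its sign by positivity, and
lowering gives the remaining columns. Hence the coefficients equal `cgPhi`, and (iv) turns `cgPhi`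
into the very-well-poised sum.

Parts (i) and (iii) are consequences of (ii). If m₂ = ±j₂, the sum in (ii) collapses to one term,
and the stretched 6j coefficient has only one nonzero z-term; so (i) is (ii) read term by term, all
factors being monomials in factorials and powers of q. For (iii), the expression in (ii), written in
p₁, …, p₅ and normalized, is symmetric in (p₁, p₂, p₃) and in (p₄, p₅), apart from the sign (-1)^(p₅
- x) in the summand. -/

lemma qnum_of_ne_one (hq : q ≠ 1) (x : ℝ) : qnum q x = (q ^ x - q ^ (-x)) / (q - q⁻¹) :=
  if_neg hq

lemma qnum_of_one (x : ℝ) : qnum 1 x = x := if_pos rfl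

lemma sub_inv_ne_zero_of_ne_one (hq : 0 < q) (h1 : q ≠ 1) : q - q⁻¹ ≠ 0 := by
  intro h
  have h2 : q * q = 1 := by
    have := congrArg (q * ·) h
    simp only [mul_sub, mul_inv_cancel₀ hq.ne', mul_zero] at this
    linarith
  have h3 : (q - 1) * (q + 1) = 0 := by linear_combination h2
  rcases mul_eq_zero.mp h3 with h | h
  · exact h1 (by linarith)
  · linarith

@[simp] lemma qnum_zero : qnum q 0 = 0 := by simp [qnum]

lemma qnum_neg (x : ℝ) : qnum q (-x) = -qnum q x := by
  unfold qnum
  split_ifs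
  · rfl
  · rw [neg_neg]; ring

lemma qnum_one (hq : 0 < q) : qnum q 1 = 1 := by
  by_cases h : q = 1
  · rw [h, qnum_of_one]
  · rw [qnum_of_ne_one h, Real.rpow_neg hq.le, Real.rpow_one,
      div_self (sub_inv_ne_zero_of_ne_one hq h)]

lemma qnum_pos (hq : 0 < q) {x : ℝ} (hx : 0 < x) : 0 < qnum q x := by
  rcases lt_trichotomy q 1 with h | h | h
  · rw [qnum_of_ne_one h.ne]
    apply div_pos_of_neg_of_neg
    · have := Real.rpow_lt_rpow_of_exponent_gt hq h (by linarith : -x < x)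
      linarith
    · have := (one_lt_inv₀ hq).2 h
      linarith
  · rw [h, qnum_of_one]; exact hx
  · rw [qnum_of_ne_one h.ne']
    apply div_pos
    · have := Real.rpow_lt_rpow_of_exponent_lt h (by linarith : -x < x)
      linarith
    · have := inv_lt_one_of_one_lt₀ h
      linarith

lemma qnum_ne_zero (hq : 0 < q) {x : ℝ} (hx : x ≠ 0) : qnum q x ≠ 0 := by
  rcases lt_or_gt_of_ne hx with h | h
  · have := qnum_pos hq (neg_pos.2 h)
    rw [qnum_neg] at this
    intro h0
    rw [h0] at this
    simp at this
  · exact (qnum_pos hq h).ne'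

lemma qnum_nonneg (hq : 0 < q) {x : ℝ} (hx : 0 ≤ x) : 0 ≤ qnum q x := by
  rcases hx.eq_or_lt with h | h
  · rw [← h, qnum_zero]
  · exact (qnum_pos hq h).le

/-- This addition law has the shape of the coproduct: it is what makes J₊J₋ - J₋J₊ = [2J₀] survive
in a tensor product. -/
lemma qnum_add (hq : 0 < q) (x y : ℝ) :
    qnum q (x + y) = q ^ y * qnum q x + q ^ (-x) * qnum q y := by
  by_cases h : q = 1
  · subst h; simp [qnum_of_one]
  · simp only [qnum_of_ne_one h, neg_add, Real.rpow_add hq, Real.rpow_neg hq.le]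
    have := (Real.rpow_pos_of_pos hq x).ne'
    have := (Real.rpow_pos_of_pos hq y).ne'
    have := sub_inv_ne_zero_of_ne_one hq h
    rw [mul_div_assoc', mul_div_assoc', ← add_div]
    congr 1
    field_simp
    ring

lemma rpow_mul_qnum_add (hq : 0 < q) (x y : ℝ) :
    q ^ (x + y) * qnum q x + qnum q y = q ^ x * qnum q (x + y) := by
  rw [qnum_add hq, Real.rpow_add hq, Real.rpow_neg hq.le]
  have := (Real.rpow_pos_of_pos hq x).ne'
  field_simp

/-- With x + y fixed, [x][y] differs only by the term in q^(x-y) + q^(y-x), so a difference of two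
such products factors. The recursions and commutators below rest on this identity. -/
lemma qnum_mul_sub_mul (hq : 0 < q) {x y z w : ℝ} (h : x + y = z + w) :
    qnum q x * qnum q y - qnum q z * qnum q w = qnum q (x - z) * qnum q (w - x) := by
  obtain rfl : y = z + w - x := by linarith
  by_cases h : q = 1
  · subst h; simp only [qnum_of_one]; ring
  · simp only [qnum_of_ne_one h, neg_sub, Real.rpow_add hq, Real.rpow_sub hq,
      Real.rpow_neg hq.le]
    have := (Real.rpow_pos_of_pos hq x).ne'
    have := (Real.rpow_pos_of_pos hq z).ne'
    have := (Real.rpow_pos_of_pos hq w).ne'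
    have := sub_inv_ne_zero_of_ne_one hq h
    simp only [div_mul_div_comm]
    rw [← sub_div]
    congr 1
    field_simp
    ring

lemma qfact_of_not_isNat {x : ℝ} (hx : ¬ IsNat x) : qfact q x = 0 := if_neg hx

lemma qfact_natCast (k : ℕ) :
    qfact q k = ∏ i ∈ Finset.range k, qnum q ((i : ℝ) + 1) := by
  rw [qfact, if_pos ⟨k, rfl⟩, Nat.floor_natCast]

@[simp] lemma qfact_zero : qfact q 0 = 1 := by
  have := qfact_natCast (q := q) 0
  simpa using this

lemma IsNat.nonneg {x : ℝ} (h : IsNat x) : 0 ≤ x := by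
  obtain ⟨k, rfl⟩ := h; positivity

lemma IsNat.add {x y : ℝ} (hx : IsNat x) (hy : IsNat y) : IsNat (x + y) := by
  obtain ⟨k, rfl⟩ := hx
  obtain ⟨l, rfl⟩ := hy
  exact ⟨k + l, by push_cast; ring⟩

lemma isNat_natCast (k : ℕ) : IsNat (k : ℝ) := ⟨k, rfl⟩

lemma isNat_of_int {x : ℝ} (hx : ∃ k : ℤ, x = k) (h : 0 ≤ x) : IsNat x := by
  obtain ⟨k, rfl⟩ := hx
  lift k to ℕ using by exact_mod_cast h
  exact ⟨k, by simp⟩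

lemma IsNat.int {x : ℝ} (h : IsNat x) : ∃ k : ℤ, x = k := by
  obtain ⟨k, rfl⟩ := h
  exact ⟨k, by simp⟩

lemma qfact_of_neg {x : ℝ} (hx : x < 0) : qfact q x = 0 :=
  qfact_of_not_isNat fun h => absurd h.nonneg (not_le.2 hx)

/-- Away from x = 0, x is a natural number exactly when x - 1 is, so the value 0 outside the
naturals respects the recursion. Only x = 0 fails, since [0][-1]! = 0 while [0]! = 1. -/
lemma qfact_eq_mul {x : ℝ} (hx : x ≠ 0) : qfact q x = qnum q x * qfact q (x - 1) := by
  by_cases h : IsNat x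
  · obtain ⟨k, rfl⟩ := h
    obtain ⟨k, rfl⟩ := Nat.exists_eq_succ_of_ne_zero (by exact_mod_cast hx : k ≠ 0)
    have : ((k.succ : ℕ) : ℝ) - 1 = k := by push_cast; ring
    rw [this, qfact_natCast, qfact_natCast, Finset.prod_range_succ]
    push_cast
    ring
  · rw [qfact_of_not_isNat h, qfact_of_not_isNat, mul_zero]
    rintro ⟨k, hk⟩
    exact h ⟨k + 1, by push_cast; linarith⟩

lemma qfact_pos (hq : 0 < q) {x : ℝ} (h : IsNat x) : 0 < qfact q x := by
  obtain ⟨k, rfl⟩ := h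
  rw [qfact_natCast]
  exact Finset.prod_pos fun i _ => qnum_pos hq (by positivity)

lemma qfact_nonneg (hq : 0 < q) (x : ℝ) : 0 ≤ qfact q x := by
  by_cases h : IsNat x
  · exact (qfact_pos hq h).le
  · rw [qfact_of_not_isNat h]

/-- For reciprocals the recursion has no exception: at x = 0 both sides vanish, since `0⁻¹ = 0`. For
this reason denominators can be shifted below without case distinctions, while numerators cannot. -/
lemma inv_qfact_sub_one (hq : 0 < q) (x : ℝ) :
    (qfact q (x - 1))⁻¹ = qnum q x * (qfact q x)⁻¹ := by
  by_cases h : x = 0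
  · subst h
    rw [qfact_of_neg (by norm_num)]
    simp
  · rw [qfact_eq_mul h, mul_inv, ← mul_assoc, mul_inv_cancel₀ (qnum_ne_zero hq h), one_mul]

/-! ### Signs -/

lemma sgn_intCast (k : ℤ) : sgn k = (-1) ^ k := by simp [sgn]

lemma sgn_add_one (x : ℝ) : sgn (x + 1) = -sgn x := by
  rw [sgn, sgn, Int.floor_add_one, zpow_add_one₀ (by norm_num)]
  ring

lemma sgn_sub_one (x : ℝ) : sgn (x - 1) = -sgn x := by
  have := sgn_add_one (x - 1)
  rw [sub_add_cancel] at this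
  linarith

@[simp] lemma sgn_zero : sgn 0 = 1 := by simp [sgn]

lemma sgn_mul_self (x : ℝ) : sgn x * sgn x = 1 := by
  rw [sgn, ← mul_zpow]
  simp

lemma sgn_add (x : ℝ) {y : ℝ} (hy : ∃ k : ℤ, y = k) : sgn (x + y) = sgn x * sgn y := by
  obtain ⟨k, rfl⟩ := hy
  rw [sgn_intCast, sgn, sgn, Int.floor_add_intCast, zpow_add₀ (by norm_num)]

lemma sgn_neg {y : ℝ} (hy : ∃ k : ℤ, y = k) : sgn (-y) = sgn y := by
  have := sgn_add (-y) hy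
  rw [neg_add_cancel, sgn_zero] at this
  have h2 := sgn_mul_self y
  have h3 : (sgn (-y) - sgn y) * sgn y = 0 := by linear_combination -this - h2
  rcases mul_eq_zero.mp h3 with h | h
  · linarith
  · rw [h] at h2; norm_num at h2

/-! ### Finite sums -/

lemma finite_support_of_le {f : ℕ → ℝ} (M : ℝ) (h : ∀ n, f n ≠ 0 → (n : ℝ) ≤ M) :
    (Function.support f).Finite :=
  (Set.finite_Iic ⌊M⌋₊).subset fun n hn => Nat.le_floor (h n hn)

lemma halfSum_eq_single {f : ℝ → ℝ} (N : ℕ) (h : ∀ n : ℕ, n ≠ N → f ((n : ℝ) / 2) = 0) :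
    halfSum f = f ((N : ℝ) / 2) :=
  finsum_eq_single _ N h

lemma halfSum_eq_zero {f : ℝ → ℝ} (h : ∀ n : ℕ, f ((n : ℝ) / 2) = 0) : halfSum f = 0 :=
  finsum_eq_zero_of_forall_eq_zero h

lemma halfSum_congr {f g : ℝ → ℝ} (h : ∀ n : ℕ, f ((n : ℝ) / 2) = g ((n : ℝ) / 2)) :
    halfSum f = halfSum g :=
  finsum_congr h

lemma mul_halfSum {f : ℝ → ℝ} (c : ℝ) : c * halfSum f = halfSum fun x => c * f x := by
  by_cases hc : c = 0
  · subst hc; simp [halfSum]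
  · exact mul_finsum_of_ne_zero _ hc
where
  mul_finsum_of_ne_zero (f : ℕ → ℝ) {c : ℝ} (hc : c ≠ 0) : c * ∑ᶠ i, f i = ∑ᶠ i, c * f i := by
    have := smul_finsum c f
    simpa using this

/-! ### The terminating `₃φ₂` sum -/

/-- The summand of a terminating `₃φ₂` series, in terms of `q`-factorials. -/
noncomputable def hypTerm (q c A B n D E : ℝ) (u : ℕ) : ℝ :=
  (-1) ^ u * q ^ ((u : ℝ) * c) * qfact q (A - u) * qfact q (B - u) /
    (qfact q u * qfact q (n - u) * qfact q (D - u) * qfact q (E - u))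

/-- A terminating `₃φ₂` series, in terms of `q`-factorials. -/
noncomputable def hypSum (q c A B n D E : ℝ) : ℝ := ∑ᶠ u : ℕ, hypTerm q c A B n D E u

section hyp

variable {c A B n D E : ℝ}

lemma hypTerm_eq_zero {u : ℕ} (h : ¬ IsNat (D - u)) : hypTerm q c A B n D E u = 0 := by
  simp [hypTerm, qfact_of_not_isNat h]

lemma hypTerm_eq_zero_of_lt {u : ℕ} (h : D < u) : hypTerm q c A B n D E u = 0 :=
  hypTerm_eq_zero fun h' => by have := h'.nonneg; linarith

lemma hypSum_eq_sum_range {N : ℕ} (hN : D < N) :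
    hypSum q c A B n D E = ∑ u ∈ Finset.range N, hypTerm q c A B n D E u := by
  apply finsum_eq_sum_of_support_subset
  intro u hu
  by_contra h
  apply hu
  apply hypTerm_eq_zero_of_lt
  have : N ≤ u := by simpa using h
  have : (N : ℝ) ≤ u := by exact_mod_cast this
  linarith

lemma hypSum_of_neg (hD : D < 0) : hypSum q c A B n D E = 0 := by
  rw [hypSum_eq_sum_range (N := 0) (by simpa using hD)]
  simp

lemma hypSum_zero : hypSum q c A B n 0 E = qfact q A * qfact q B / (qfact q n * qfact q E) := by
  rw [hypSum_eq_sum_range (N := 1) (by norm_num)]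
  simp [hypTerm]

lemma hypTerm_sub_one_sub_one (hq : 0 < q) (u : ℕ) :
    hypTerm q c A B n (D - 1) (E - 1) u =
      qnum q (D - u) * qnum q (E - u) * hypTerm q c A B n D E u := by
  simp only [hypTerm, div_eq_mul_inv, mul_inv]
  rw [show D - 1 - u = D - u - 1 by ring, show E - 1 - u = E - u - 1 by ring,
    inv_qfact_sub_one hq, inv_qfact_sub_one hq]
  ring

lemma hypTerm_sub_one (hq : 0 < q) (u : ℕ) :
    hypTerm q c A B n (D - 1) E u = qnum q (D - u) * hypTerm q c A B n D E u := by
  simp only [hypTerm, div_eq_mul_inv, mul_inv]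
  rw [show D - 1 - u = D - u - 1 by ring, inv_qfact_sub_one hq]
  ring

lemma hypTerm_exponent_sub_one (hq : 0 < q) (u : ℕ) :
    hypTerm q (c - 1) A B n D E u = q ^ (-(u : ℝ)) * hypTerm q c A B n D E u := by
  simp only [hypTerm]
  rw [show (u : ℝ) * (c - 1) = -(u : ℝ) + u * c by ring, Real.rpow_add hq]
  ring

/-- The term ratio of the series. The right-hand side keeps A - 1 and B - 1 instead of dividing by
[A - u][B - u], so it holds for every u. -/
lemma hypTerm_succ (hq : 0 < q) (u : ℕ) :
    qnum q ((u : ℝ) + 1) * hypTerm q c A B n D E (u + 1) =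
      -q ^ c * (qnum q (n - u) * qnum q (D - u) * qnum q (E - u)) *
        hypTerm q c (A - 1) (B - 1) n D E u := by
  simp only [hypTerm, div_eq_mul_inv, mul_inv]
  push_cast
  have h : (qfact q ((u : ℝ) + 1))⁻¹ = (qnum q ((u : ℝ) + 1))⁻¹ * (qfact q u)⁻¹ := by
    rw [qfact_eq_mul (by positivity), mul_inv, add_sub_cancel_right]
  rw [show D - ((u : ℝ) + 1) = D - u - 1 by ring, show E - ((u : ℝ) + 1) = E - u - 1 by ring,
    show n - ((u : ℝ) + 1) = n - u - 1 by ring, show A - ((u : ℝ) + 1) = A - 1 - u by ring,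
    show B - ((u : ℝ) + 1) = B - 1 - u by ring, inv_qfact_sub_one hq, inv_qfact_sub_one hq,
    inv_qfact_sub_one hq, h, show ((u : ℝ) + 1) * c = c + u * c by ring, Real.rpow_add hq,
    pow_succ]
  have := (qnum_pos hq (by positivity : 0 < (u : ℝ) + 1)).ne'
  field_simp

/-- A numerator factorial may be unfolded only where its argument is nonzero; u < D ≤ A ensures that
A - u > 0. -/
lemma hypTerm_numerator (u : ℕ) (hu : (u : ℝ) < D) (hA : D ≤ A) :
    hypTerm q c A B n D E u = qnum q (A - u) * hypTerm q c (A - 1) B n D E u := by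
  simp only [hypTerm]
  rw [qfact_eq_mul (by linarith : A - u ≠ 0), show A - u - 1 = A - 1 - u by ring]
  ring

lemma hypTerm_numerator_right (u : ℕ) (hu : (u : ℝ) < D) (hB : D ≤ B) :
    hypTerm q c A B n D E u = qnum q (B - u) * hypTerm q c A (B - 1) n D E u := by
  simp only [hypTerm]
  rw [qfact_eq_mul (by linarith : B - u ≠ 0), show B - u - 1 = B - 1 - u by ring]
  ring

/-- A sum of differences that vanish at both ends. -/
lemma sum_range_eq_zero_of_telescope {f H : ℕ → ℝ} {N : ℕ} (h : ∀ u, f u = H (u + 1) - H u)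
    (h0 : H 0 = 0) (hN : H N = 0) : ∑ u ∈ Finset.range N, f u = 0 := by
  simp only [h, Finset.sum_range_sub, h0, hN, sub_zero]

/-- The contiguous relation behind the transformation formula. -/
lemma hypSum_contiguous (hq : 0 < q) {p₁ p₂ p₃ p₄ p₅ : ℝ}
    (h12 : p₁ + p₂ ≤ -2) (h23 : p₂ + p₃ ≤ -2) :
    q ^ (p₂ + p₅ + 1) * (qnum q (p₁ + p₄ + 1) * qnum q (p₃ + p₄ + 1)) *
        hypSum q (p₂ + p₅ + 1) (p₄ - p₃ - 1 - 1) (p₄ - p₁ - 1 - 1) (-p₁ - p₃ - 2)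
          (p₂ + p₄ + 1 - 1) (p₄ + p₅ + 1 - 1) -
      q ^ (p₄ + p₅ + 1) * qnum q (p₂ + p₅ + 1) *
        hypSum q (p₂ + p₅ + 1 - 1) (p₄ - p₃ - 1) (p₄ - p₁ - 1) (-p₁ - p₃ - 2)
          (p₂ + p₄ + 1 - 1) (p₄ + p₅ + 1) -
      qnum q (p₄ - p₂) * qnum q (p₂ + p₄ + 1) *
        hypSum q (p₂ + p₅ + 1) (p₄ - p₃ - 1) (p₄ - p₁ - 1) (-p₁ - p₃ - 2)
          (p₂ + p₄ + 1) (p₄ + p₅ + 1) = 0 := by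
  obtain ⟨N, hN⟩ := exists_nat_gt (p₂ + p₄ + 1)
  rw [hypSum_eq_sum_range (N := N) (by linarith), hypSum_eq_sum_range (N := N) (by linarith),
    hypSum_eq_sum_range hN]
  simp only [Finset.mul_sum, ← Finset.sum_sub_distrib]
  -- The telescoping certificate: H(0) = 0 through [0] = 0, and H(N) = 0 because N lies beyond the
  -- support of the terms.
  apply sum_range_eq_zero_of_telescope (H := fun u : ℕ => qnum q (2 * p₄ + 1 - u) * qnum q u *
    hypTerm q (p₂ + p₅ + 1) (p₄ - p₃ - 1) (p₄ - p₁ - 1) (-p₁ - p₃ - 2)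
      (p₂ + p₄ + 1) (p₄ + p₅ + 1) u)
  · intro u
    rw [hypTerm_sub_one_sub_one hq, hypTerm_exponent_sub_one hq, hypTerm_sub_one hq]
    have hs := hypTerm_succ (c := p₂ + p₅ + 1) (A := p₄ - p₃ - 1) (B := p₄ - p₁ - 1)
      (n := -p₁ - p₃ - 2) (D := p₂ + p₄ + 1) (E := p₄ + p₅ + 1) hq u
    push_cast
    rw [mul_assoc (qnum q (2 * p₄ + 1 - (u + 1))), hs]
    by_cases hD : IsNat (p₂ + p₄ + 1 - u)
    swap
    · simp only [hypTerm_eq_zero hD]; ring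
    have e1 := qnum_mul_sub_mul hq (x := p₂ + p₄ + 1) (y := p₄ - p₂) (z := u)
      (w := 2 * p₄ + 1 - u) (by ring)
    rw [show 2 * p₄ + 1 - (u : ℝ) - (p₂ + p₄ + 1) = p₄ - p₂ - u by ring] at e1
    -- At the last index u = D the numerator factorials may have argument 0 and cannot be unfolded.
    -- There [D - u] = 0 removes all terms that would need it, and `e1` alone suffices.
    rcases hD.nonneg.eq_or_lt with h0 | h0
    · rw [← h0] at e1 ⊢
      simp only [qnum_zero, zero_mul, mul_zero] at e1 ⊢
      linear_combination (-e1) * hypTerm q (p₂ + p₅ + 1) (p₄ - p₃ - 1) (p₄ - p₁ - 1)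
        (-p₁ - p₃ - 2) (p₂ + p₄ + 1) (p₄ + p₅ + 1) u
    · have hw : hypTerm q (p₂ + p₅ + 1) (p₄ - p₃ - 1) (p₄ - p₁ - 1) (-p₁ - p₃ - 2)
            (p₂ + p₄ + 1) (p₄ + p₅ + 1) u =
          qnum q (p₄ - p₃ - 1 - u) * (qnum q (p₄ - p₁ - 1 - u) *
            hypTerm q (p₂ + p₅ + 1) (p₄ - p₃ - 1 - 1) (p₄ - p₁ - 1 - 1) (-p₁ - p₃ - 2)
              (p₂ + p₄ + 1) (p₄ + p₅ + 1) u) := by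
        rw [hypTerm_numerator u (by linarith) (by linarith),
          hypTerm_numerator_right u (by linarith) (by linarith)]
      rw [hw]
      generalize hypTerm q (p₂ + p₅ + 1) (p₄ - p₃ - 1 - 1) (p₄ - p₁ - 1 - 1) (-p₁ - p₃ - 2)
              (p₂ + p₄ + 1) (p₄ + p₅ + 1) u = v
      have e2 := rpow_mul_qnum_add hq (p₂ + p₅ + 1) (p₄ - p₂ - u)
      rw [show p₂ + p₅ + 1 + (p₄ - p₂ - u) = (p₄ + p₅ + 1) + (-u) by ring, Real.rpow_add hq,
        ← sub_eq_add_neg _ (u : ℝ)] at e2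
      have e3 := qnum_mul_sub_mul hq (x := p₄ - p₃ - 1 - u) (y := p₄ - p₁ - 1 - u)
        (z := 2 * p₄ - u) (w := -p₁ - p₃ - 2 - u) (by ring)
      rw [show p₄ - p₃ - 1 - (u : ℝ) - (2 * p₄ - u) = -(p₃ + p₄ + 1) by ring,
        show -p₁ - p₃ - 2 - (u : ℝ) - (p₄ - p₃ - 1 - u) = -(p₁ + p₄ + 1) by ring,
        qnum_neg, qnum_neg] at e3
      rw [show 2 * p₄ + 1 - ((u : ℝ) + 1) = 2 * p₄ - u by ring]
      linear_combination (-(qnum q (p₄ - p₃ - 1 - u) * qnum q (p₄ - p₁ - 1 - u) * v)) * e1 -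
        qnum q (p₂ + p₄ + 1 - u) * qnum q (p₄ - p₃ - 1 - u) * qnum q (p₄ - p₁ - 1 - u) * v * e2 -
        v * qnum q (p₂ + p₄ + 1 - u) * qnum q (p₄ + p₅ + 1 - u) * q ^ (p₂ + p₅ + 1) * e3
  · simp
  · simp [hypTerm_eq_zero_of_lt hN]

end hyp

/-! ### The transformation formula -/

/-- The summand of the very-well-poised series. -/
noncomputable def poisedTerm (q p₁ p₂ p₃ p₄ p₅ j : ℝ) : ℝ :=
  sgn (p₂ + j + 1) * q ^ (j * (j + 1)) * qnum q (2 * j + 1) *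
      qfact q (j - p₁ - 1) * qfact q (j - p₂ - 1) * qfact q (j - p₃ - 1) /
    (qfact q (p₁ + j + 1) * qfact q (p₂ + j + 1) * qfact q (p₃ + j + 1) *
      qfact q (p₄ - j) * qfact q (p₄ + j + 1) * qfact q (p₅ - j) * qfact q (p₅ + j + 1))

/-- The right-hand side of the transformation formula. -/
noncomputable def phiSide (q p₁ p₂ p₃ p₄ p₅ : ℝ) : ℝ :=
  q ^ (-(p₄ + 1) * (p₅ + 1) - p₂ * (p₄ + p₅ + 1)) * qfact q (-p₁ - p₃ - 2) /
      (qfact q (p₁ + p₄ + 1) * qfact q (p₂ + p₅ + 1) * qfact q (p₃ + p₄ + 1)) *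
    hypSum q (p₂ + p₅ + 1) (p₄ - p₃ - 1) (p₄ - p₁ - 1) (-p₁ - p₃ - 2) (p₂ + p₄ + 1) (p₄ + p₅ + 1)

section transformation

variable {p₁ p₂ p₃ p₄ p₅ : ℝ}

lemma poisedTerm_eq_zero {j : ℝ}
    (h : ¬ (IsNat (p₁ + j + 1) ∧ IsNat (p₂ + j + 1) ∧ IsNat (p₃ + j + 1) ∧ IsNat (p₄ - j) ∧
      IsNat (p₅ - j))) : poisedTerm q p₁ p₂ p₃ p₄ p₅ j = 0 := by
  simp only [not_and_or] at h
  rcases h with h | h | h | h | h <;> simp [poisedTerm, qfact_of_not_isNat h]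

lemma poisedTerm_support_finite :
    (Function.support fun n : ℕ => poisedTerm q p₁ p₂ p₃ p₄ p₅ ((n : ℝ) / 2)).Finite := by
  apply finite_support_of_le (2 * p₄)
  intro n hn
  by_contra h
  apply hn
  apply poisedTerm_eq_zero
  rintro ⟨-, -, -, h', -⟩
  have := h'.nonneg
  linarith

/-- The shifts of p₄ and p₂ multiply the summand by [p₄ - j][p₄ + j + 1] and by -[j - p₂][p₂ + j +
1]. These combine to [p₄ - p₂][p₂ + p₄ + 1], which is independent of j. On the support, p₁ + j + 1 ≥
0 and p₁ + p₂ ≤ -2 give j > p₂, so [j - p₂]! can be unfolded. -/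
lemma poisedTerm_recursion (hq : 0 < q) (h12 : p₁ + p₂ ≤ -2) (j : ℝ) :
    poisedTerm q p₁ p₂ p₃ (p₄ - 1) p₅ j - poisedTerm q p₁ (p₂ - 1) p₃ p₄ p₅ j =
      qnum q (p₄ - p₂) * qnum q (p₂ + p₄ + 1) * poisedTerm q p₁ p₂ p₃ p₄ p₅ j := by
  by_cases h1 : IsNat (p₁ + j + 1)
  swap
  · rw [poisedTerm_eq_zero (by tauto), poisedTerm_eq_zero (by tauto),
      poisedTerm_eq_zero (by tauto)]
    ring
  have := h1.nonneg
  have e := qnum_mul_sub_mul hq (x := p₄ - p₂) (y := p₂ + p₄ + 1) (z := p₄ - j)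
    (w := p₄ + j + 1) (by ring)
  rw [show p₄ - p₂ - (p₄ - j) = j - p₂ by ring,
    show p₄ + j + 1 - (p₄ - p₂) = p₂ + j + 1 by ring] at e
  simp only [poisedTerm, div_eq_mul_inv, mul_inv]
  rw [show p₄ - 1 - j = p₄ - j - 1 by ring, show p₄ - 1 + j + 1 = p₄ + j + 1 - 1 by ring,
    show p₂ - 1 + j + 1 = p₂ + j + 1 - 1 by ring, show j - (p₂ - 1) - 1 = j - p₂ by ring,
    inv_qfact_sub_one hq, inv_qfact_sub_one hq, inv_qfact_sub_one hq, sgn_sub_one,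
    qfact_eq_mul (by linarith : j - p₂ ≠ 0)]
  generalize (qfact q (p₁ + j + 1))⁻¹ = x1
  generalize (qfact q (p₂ + j + 1))⁻¹ = x2
  generalize (qfact q (p₃ + j + 1))⁻¹ = x3
  generalize (qfact q (p₄ - j))⁻¹ = x4
  generalize (qfact q (p₄ + j + 1))⁻¹ = x5
  generalize (qfact q (p₅ - j))⁻¹ * (qfact q (p₅ + j + 1))⁻¹ = x6
  linear_combination (-(sgn (p₂ + j + 1) * q ^ (j * (j + 1)) * qnum q (2 * j + 1) *
      qfact q (j - p₁ - 1) * qfact q (j - p₂ - 1) * qfact q (j - p₃ - 1) * x1 * x2 * x3 * x4 *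
      x5 * (qfact q (p₅ - j))⁻¹ * (qfact q (p₅ + j + 1))⁻¹)) * e

lemma halfSum_poisedTerm_recursion (hq : 0 < q) (h12 : p₁ + p₂ ≤ -2) :
    halfSum (poisedTerm q p₁ p₂ p₃ (p₄ - 1) p₅) - halfSum (poisedTerm q p₁ (p₂ - 1) p₃ p₄ p₅) =
      qnum q (p₄ - p₂) * qnum q (p₂ + p₄ + 1) * halfSum (poisedTerm q p₁ p₂ p₃ p₄ p₅) := by
  rw [mul_halfSum]
  simp only [← poisedTerm_recursion hq h12]
  exact (finsum_sub_distrib poisedTerm_support_finite poisedTerm_support_finite).symm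

/-- This is `hypSum_contiguous` multiplied by the common prefactor; the shifted prefactors
contribute the q-numbers and the powers of q in that relation. -/
lemma phiSide_recursion (hq : 0 < q) (h12 : p₁ + p₂ ≤ -2) (h23 : p₂ + p₃ ≤ -2) :
    phiSide q p₁ p₂ p₃ (p₄ - 1) p₅ - phiSide q p₁ (p₂ - 1) p₃ p₄ p₅ =
      qnum q (p₄ - p₂) * qnum q (p₂ + p₄ + 1) * phiSide q p₁ p₂ p₃ p₄ p₅ := by
  have h := hypSum_contiguous hq h12 h23 (p₄ := p₄) (p₅ := p₅)
  simp only [phiSide, div_eq_mul_inv, mul_inv]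
  rw [show p₂ - 1 + p₅ + 1 = p₂ + p₅ + 1 - 1 by ring,
    show p₁ + (p₄ - 1) + 1 = p₁ + p₄ + 1 - 1 by ring,
    show p₃ + (p₄ - 1) + 1 = p₃ + p₄ + 1 - 1 by ring,
    show p₂ + (p₄ - 1) + 1 = p₂ + p₄ + 1 - 1 by ring,
    show p₂ - 1 + p₄ + 1 = p₂ + p₄ + 1 - 1 by ring,
    show p₄ - 1 + p₅ + 1 = p₄ + p₅ + 1 - 1 by ring,
    show p₄ - 1 - p₃ - 1 = p₄ - p₃ - 1 - 1 by ring,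
    show p₄ - 1 - p₁ - 1 = p₄ - p₁ - 1 - 1 by ring,
    show -(p₄ - 1 + 1) * (p₅ + 1) - p₂ * (p₄ + p₅ + 1 - 1) =
      (-(p₄ + 1) * (p₅ + 1) - p₂ * (p₄ + p₅ + 1)) + (p₂ + p₅ + 1) by ring,
    show -(p₄ + 1) * (p₅ + 1) - (p₂ - 1) * (p₄ + p₅ + 1) =
      (-(p₄ + 1) * (p₅ + 1) - p₂ * (p₄ + p₅ + 1)) + (p₄ + p₅ + 1) by ring,
    Real.rpow_add hq _ (p₂ + p₅ + 1), Real.rpow_add hq _ (p₄ + p₅ + 1),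
    inv_qfact_sub_one hq, inv_qfact_sub_one hq, inv_qfact_sub_one hq]
  generalize (qfact q (p₁ + p₄ + 1))⁻¹ = x1 at *
  generalize (qfact q (p₂ + p₅ + 1))⁻¹ = x2 at *
  generalize (qfact q (p₃ + p₄ + 1))⁻¹ = x3 at *
  linear_combination (q ^ (-(p₄ + 1) * (p₅ + 1) - p₂ * (p₄ + p₅ + 1)) *
    qfact q (-p₁ - p₃ - 2) * x1 * x2 * x3) * h

/-- When p₂ = -p₄ - 1, the factors 1/[p₂ + j + 1]! and 1/[p₄ - j]! force j = p₄, and the ₃φ₂ sum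
retains only u = 0. For p₄ < 0 there is no such spin, and the right side vanishes through 1/[p₁ + p₄
+ 1]!. -/
lemma halfSum_poisedTerm_eq_phiSide_of_eq_zero (hq : 0 < q) (hp : ∃ k : ℤ, 2 * p₄ = k)
    (h1 : p₁ ≤ p₄ - 1) (h13 : IsNat (-p₁ - p₃ - 2)) (h0 : p₂ + p₄ + 1 = 0) :
    halfSum (poisedTerm q p₁ p₂ p₃ p₄ p₅) = phiSide q p₁ p₂ p₃ p₄ p₅ := by
  rcases lt_or_ge p₄ 0 with h4 | h4
  · rw [halfSum_eq_zero, phiSide, qfact_of_neg (by linarith : p₁ + p₄ + 1 < 0)]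
    · simp
    · intro n
      apply poisedTerm_eq_zero
      rintro ⟨-, -, -, h', -⟩
      have := h'.nonneg
      have : (0 : ℝ) ≤ n := by positivity
      linarith
  · obtain ⟨N, hN⟩ := isNat_of_int hp (by linarith)
    obtain rfl : p₂ = -p₄ - 1 := by linarith
    have hN' : (N : ℝ) / 2 = p₄ := by linarith
    rw [halfSum_eq_single N]
    · rw [hN', poisedTerm, phiSide, show -p₄ - 1 + p₄ + 1 = 0 by ring, hypSum_zero,
        show p₄ - (-p₄ - 1) - 1 = 2 * p₄ by ring, show p₄ + p₄ + 1 = 2 * p₄ + 1 by ring,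
        sub_self, sgn_zero, qfact_zero, qfact_eq_mul (by linarith : 2 * p₄ + 1 ≠ 0),
        show 2 * p₄ + 1 - 1 = 2 * p₄ by ring, show -p₄ - 1 + p₅ + 1 = p₅ - p₄ by ring,
        show -(p₄ + 1) * (p₅ + 1) - (-p₄ - 1) * (p₄ + p₅ + 1) = p₄ * (p₄ + 1) by ring,
        add_comm p₄ p₅]
      have a1 := (qfact_pos hq h13).ne'
      have a2 := (qnum_pos hq (by linarith : 0 < 2 * p₄ + 1)).ne'
      have a3 := (qfact_pos hq (x := 2 * p₄) ⟨N, hN⟩).ne'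
      generalize qnum q (2 * p₄ + 1) = y1 at *
      generalize qfact q (2 * p₄) = y2 at *
      simp only [div_eq_mul_inv, mul_inv]
      field_simp
    · intro n hn
      apply poisedTerm_eq_zero
      rintro ⟨-, h', -, h'', -⟩
      apply hn
      have := h'.nonneg
      have := h''.nonneg
      have : (n : ℝ) = N := by linarith
      exact_mod_cast this

/-- A nonzero term needs p₄ ≥ j and pᵢ + j + 1 ≥ 0, hence pᵢ + p₄ + 1 ≥ 0. This is the range in
which the recursion can be solved. -/
lemma halfSum_poisedTerm_eq_zero (h : ¬ (0 ≤ p₁ + p₄ + 1 ∧ 0 ≤ p₂ + p₄ + 1 ∧ 0 ≤ p₃ + p₄ + 1)) :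
    halfSum (poisedTerm q p₁ p₂ p₃ p₄ p₅) = 0 := by
  apply halfSum_eq_zero
  intro n
  apply poisedTerm_eq_zero
  rintro ⟨h1, h2, h3, h4, -⟩
  have := h1.nonneg
  have := h2.nonneg
  have := h3.nonneg
  have := h4.nonneg
  exact h ⟨by linarith, by linarith, by linarith⟩

lemma phiSide_eq_zero (h : ¬ (0 ≤ p₁ + p₄ + 1 ∧ 0 ≤ p₂ + p₄ + 1 ∧ 0 ≤ p₃ + p₄ + 1)) :
    phiSide q p₁ p₂ p₃ p₄ p₅ = 0 := by
  simp only [not_and_or, not_le] at h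
  rcases h with h | h | h
  · simp [phiSide, qfact_of_neg h]
  · simp [phiSide, hypSum_of_neg h]
  · simp [phiSide, qfact_of_neg h]

lemma halfSum_poisedTerm_of_natCast (hq : 0 < q) (h13 : IsNat (-p₁ - p₃ - 2)) (n : ℕ) :
    ∀ p₂ p₄ : ℝ, (∃ k : ℤ, 2 * p₄ = k) → p₁ + p₂ ≤ -2 → p₂ + p₃ ≤ -2 → p₂ + p₄ + 1 = n →
      halfSum (poisedTerm q p₁ p₂ p₃ p₄ p₅) = phiSide q p₁ p₂ p₃ p₄ p₅ := by
  induction n with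
  | zero =>
    intro p₂ p₄ hp h12 h23 h0
    rw [Nat.cast_zero] at h0
    exact halfSum_poisedTerm_eq_phiSide_of_eq_zero hq hp (by linarith) h13 h0
  | succ n ih =>
    intro p₂ p₄ hp h12 h23 h0
    push_cast at h0
    by_cases h : 0 ≤ p₁ + p₄ + 1 ∧ 0 ≤ p₂ + p₄ + 1 ∧ 0 ≤ p₃ + p₄ + 1
    swap
    · rw [halfSum_poisedTerm_eq_zero h, phiSide_eq_zero h]
    -- p₄ ≥ -p₁ - 1 ≥ p₂ + 1, so the coefficient of X in the recursion is nonzero and X is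
    -- determined by two values with the smaller n.
    have a1 := (qnum_pos hq (by linarith : 0 < p₄ - p₂)).ne'
    have a2 := (qnum_pos hq (by rw [h0]; positivity : 0 < p₂ + p₄ + 1)).ne'
    have e1 := halfSum_poisedTerm_recursion hq h12 (p₃ := p₃) (p₄ := p₄) (p₅ := p₅)
    have e2 := phiSide_recursion hq h12 h23 (p₄ := p₄) (p₅ := p₅)
    obtain ⟨k, hk⟩ := hp
    rw [ih p₂ (p₄ - 1) ⟨k - 2, by push_cast; linarith⟩ h12 h23 (by linarith),
      ih (p₂ - 1) p₄ ⟨k, hk⟩ (by linarith) (by linarith) (by linarith), e2] at e1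
    exact (mul_left_cancel₀ (mul_ne_zero a1 a2) e1).symm

/-- The transformation formula between a very-well-poised series and a `₃φ₂` series. -/
theorem halfSum_poisedTerm (hq : 0 < q) (h13 : IsNat (-p₁ - p₃ - 2))
    (hp : ∃ k : ℤ, 2 * p₄ = k) (h24 : ∃ k : ℤ, p₂ + p₄ + 1 = k)
    (h12 : p₁ + p₂ ≤ -2) (h23 : p₂ + p₃ ≤ -2) :
    halfSum (poisedTerm q p₁ p₂ p₃ p₄ p₅) = phiSide q p₁ p₂ p₃ p₄ p₅ := by
  rcases lt_or_ge (p₂ + p₄ + 1) 0 with h | h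
  · have h' : ¬ (0 ≤ p₁ + p₄ + 1 ∧ 0 ≤ p₂ + p₄ + 1 ∧ 0 ≤ p₃ + p₄ + 1) := fun h' => by
      linarith [h'.2.1]
    rw [halfSum_poisedTerm_eq_zero h', phiSide_eq_zero h']
  · obtain ⟨n, hn⟩ := isNat_of_int h24 h
    exact halfSum_poisedTerm_of_natCast hq h13 n p₂ p₄ hp h12 h23 hn

end transformation

/-! ### The Clebsch–Gordan coefficients as `₃φ₂` series -/

/-- The factor of the Clebsch–Gordan coefficients that depends on the spins only. -/
noncomputable def cgConst (q j₁ j₂ j : ℝ) : ℝ := nabla q j₂ j₁ j * √(qnum q (2 * j + 1))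

/-- The square root factor of the Clebsch–Gordan coefficients that depends on the weights. -/
noncomputable def cgNorm (q j₁ m₁ j₂ m₂ j : ℝ) : ℝ :=
  √(qfact q (j₂ + m₂) * qfact q (j₂ - m₂) * qfact q (j₁ - m₁) * qfact q (j - (m₁ + m₂)) /
    (qfact q (j₁ + m₁) * qfact q (j + (m₁ + m₂))))

/-- The rational factor of the Clebsch–Gordan coefficients. -/
noncomputable def cgSum (q j₁ m₁ j₂ m₂ j : ℝ) : ℝ :=
  sgn (j₁ - m₁) *
      q ^ (m₁ * (j₁ + j + 1) + m₂ * j₁ + (j₂ * (j₂ + 1) - (j₁ + j) * (j₁ + j + 1)) / 2) *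
      (qfact q (j₁ + j - j₂) /
        (qfact q (j₂ - m₂) * qfact q (j₁ - m₁) * qfact q (j₂ - j₁ + j))) *
    hypSum q (j₁ - m₁) (j₁ + j - m₂) (2 * j) (j₁ + j - j₂) (j - (m₁ + m₂)) (j₁ + j₂ + j + 1)

/-- The Clebsch–Gordan coefficients as a `₃φ₂` series. -/
noncomputable def cgPhi (q j₁ m₁ j₂ m₂ j : ℝ) : ℝ :=
  cgConst q j₁ j₂ j * cgNorm q j₁ m₁ j₂ m₂ j * cgSum q j₁ m₁ j₂ m₂ j

/-- The Clebsch–Gordan coefficients as a very-well-poised series. -/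
noncomputable def cgPoised (q j₁ m₁ j₂ m₂ j m : ℝ) : ℝ :=
  nabla q j₂ j₁ j *
    √(qnum q (2 * j + 1) * qfact q (j₂ + m₂) * qfact q (j₂ - m₂) *
        qfact q (j₁ - m₁) * qfact q (j - m) /
      (qfact q (j₁ + m₁) * qfact q (j + m))) *
    q ^ ((j₂ * (j₂ + 1) - j₁ * (j₁ + 1) - j * (j + 1)) / 2 - m₁ * j₂ -
      (j₂ + m₂) * (j₂ + m₂ + 2) / 4) *
    halfSum fun x =>
      sgn (j₁ + (j₂ + m₂) / 2 - x) * q ^ (x * (x + 1)) * qnum q (2 * x + 1) *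
          qfact q (x + (m₁ + (j₂ + m₂) / 2)) /
        (nabla q ((j₂ + m₂) / 2) j₁ x ^ 2 * nabla q ((j₂ - m₂) / 2) j x ^ 2 *
          qfact q (x - (m₁ + (j₂ + m₂) / 2)))

lemma nabla_sq (hq : 0 < q) (a b c : ℝ) :
    nabla q a b c ^ 2 = qfact q (a + b - c) * qfact q (a - b + c) * qfact q (a + b + c + 1) /
      qfact q (b + c - a) := by
  rw [nabla, Real.sq_sqrt]
  have := qfact_nonneg (q := q) hq
  exact div_nonneg (mul_nonneg (mul_nonneg (this _) (this _)) (this _)) (this _)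

/-- Each 1/∇² moves the one factorial below its fraction bar into a numerator, which gives the three
numerators of the poised series. The identity survives zero factorials because `inv_inv` holds at 0.
-/
lemma poisedSummand_eq (hq : 0 < q) (j₁ m₁ j₂ m₂ j x : ℝ) (h : ∃ k : ℤ, j₁ - m₁ = k) :
    sgn (j₁ + (j₂ + m₂) / 2 - x) * q ^ (x * (x + 1)) * qnum q (2 * x + 1) *
          qfact q (x + (m₁ + (j₂ + m₂) / 2)) /
        (nabla q ((j₂ + m₂) / 2) j₁ x ^ 2 * nabla q ((j₂ - m₂) / 2) j x ^ 2 *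
          qfact q (x - (m₁ + (j₂ + m₂) / 2))) =
      sgn (j₁ - m₁) * poisedTerm q ((j₂ - m₂) / 2 - j - 1) (-(m₁ + (j₂ + m₂) / 2) - 1)
        ((j₂ + m₂) / 2 - j₁ - 1) ((j₂ - m₂) / 2 + j) ((j₂ + m₂) / 2 + j₁) x := by
  rw [nabla_sq hq, nabla_sq hq, poisedTerm]
  by_cases hx : IsNat (x - (m₁ + (j₂ + m₂) / 2))
  swap
  · rw [show -(m₁ + (j₂ + m₂) / 2) - 1 + x + 1 = x - (m₁ + (j₂ + m₂) / 2) by ring,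
      qfact_of_not_isNat hx]
    simp
  have hs : sgn (j₁ + (j₂ + m₂) / 2 - x) =
      sgn (j₁ - m₁) * sgn (-(m₁ + (j₂ + m₂) / 2) - 1 + x + 1) := by
    rw [show -(m₁ + (j₂ + m₂) / 2) - 1 + x + 1 = x - (m₁ + (j₂ + m₂) / 2) by ring,
      ← sgn_neg hx.int, mul_comm, ← sgn_add _ h]
    congr 1; ring
  rw [hs]
  rw [show -(m₁ + (j₂ + m₂) / 2) - 1 + x + 1 = x - (m₁ + (j₂ + m₂) / 2) by ring,
    show x - ((j₂ - m₂) / 2 - j - 1) - 1 = j + x - (j₂ - m₂) / 2 by ring,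
    show x - (-(m₁ + (j₂ + m₂) / 2) - 1) - 1 = x + (m₁ + (j₂ + m₂) / 2) by ring,
    show x - ((j₂ + m₂) / 2 - j₁ - 1) - 1 = j₁ + x - (j₂ + m₂) / 2 by ring,
    show (j₂ - m₂) / 2 - j - 1 + x + 1 = (j₂ - m₂) / 2 - j + x by ring,
    show (j₂ + m₂) / 2 - j₁ - 1 + x + 1 = (j₂ + m₂) / 2 - j₁ + x by ring]
  simp only [div_eq_mul_inv, mul_inv, inv_inv]
  ring

/-- The very-well-poised series agrees with the `₃φ₂` series. -/
theorem cgPoised_eq_cgPhi (hq : 0 < q) {L : Labels} (hL : L.Admissible) :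
    cgPoised q L.j₁ L.m₁ L.j₂ L.m₂ L.j L.m = cgPhi q L.j₁ L.m₁ L.j₂ L.m₂ L.j := by
  obtain ⟨⟨a1, a2⟩, ⟨b1, b2⟩, ⟨c1, c2⟩, t, t1, t2, hm⟩ := hL
  obtain ⟨j₁, m₁, j₂, m₂, j, m⟩ := L
  dsimp only at *
  subst hm
  rw [cgPoised]
  simp only [poisedSummand_eq hq j₁ m₁ j₂ m₂ j _ a2.int]
  rw [← mul_halfSum (f := poisedTerm _ _ _ _ _ _), halfSum_poisedTerm hq, phiSide, cgPhi, cgConst, cgNorm, cgSum]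
  -- With p₁ = b - j - 1, p₂ = -m' - 1, p₃ = a - j₁ - 1, p₄ = b + j, p₅ = a + j₁, every argument on
  -- the ₃φ₂ side becomes a linear form in the spins and weights.
  · rw [show -(m₁ + (j₂ + m₂) / 2) - 1 + ((j₂ + m₂) / 2 + j₁) + 1 = j₁ - m₁ by ring,
      show (j₂ - m₂) / 2 + j - ((j₂ + m₂) / 2 - j₁ - 1) - 1 = j₁ + j - m₂ by ring,
      show (j₂ - m₂) / 2 + j - ((j₂ - m₂) / 2 - j - 1) - 1 = 2 * j by ring,
      show -((j₂ - m₂) / 2 - j - 1) - ((j₂ + m₂) / 2 - j₁ - 1) - 2 = j₁ + j - j₂ by ring,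
      show -(m₁ + (j₂ + m₂) / 2) - 1 + ((j₂ - m₂) / 2 + j) + 1 = j - (m₁ + m₂) by ring,
      show (j₂ - m₂) / 2 + j + ((j₂ + m₂) / 2 + j₁) + 1 = j₁ + j₂ + j + 1 by ring,
      show (j₂ - m₂) / 2 - j - 1 + ((j₂ - m₂) / 2 + j) + 1 = j₂ - m₂ by ring,
      show (j₂ + m₂) / 2 - j₁ - 1 + ((j₂ - m₂) / 2 + j) + 1 = j₂ - j₁ + j by ring,
      show m₁ * (j₁ + j + 1) + m₂ * j₁ + (j₂ * (j₂ + 1) - (j₁ + j) * (j₁ + j + 1)) / 2 =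
        ((j₂ * (j₂ + 1) - j₁ * (j₁ + 1) - j * (j + 1)) / 2 - m₁ * j₂ -
          (j₂ + m₂) * (j₂ + m₂ + 2) / 4) +
        (-((j₂ - m₂) / 2 + j + 1) * ((j₂ + m₂) / 2 + j₁ + 1) -
          (-(m₁ + (j₂ + m₂) / 2) - 1) * (j₁ + j₂ + j + 1)) by ring,
      Real.rpow_add hq]
    have hj : 0 ≤ qnum q (2 * j + 1) :=
      qnum_nonneg hq (by have := c1.nonneg; have := c2.nonneg; linarith)
    rw [show ∀ x y z w t : ℝ, qnum q (2 * j + 1) * x * y * z * w / t =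
      qnum q (2 * j + 1) * (x * y * z * w / t) by intros; ring, Real.sqrt_mul hj]
    ring
  · rw [show -((j₂ - m₂) / 2 - j - 1) - ((j₂ + m₂) / 2 - j₁ - 1) - 2 = j₁ - j₂ + j by ring]
    exact t1
  · obtain ⟨k, hk⟩ := b2
    obtain ⟨l, hl⟩ := c1
    obtain ⟨r, hr⟩ := c2
    exact ⟨k + l + r, by push_cast; linarith⟩
  · obtain ⟨k, hk⟩ := c2
    exact ⟨k, by push_cast; linarith⟩
  · have := c1.nonneg
    linarith
  · have := a1.nonneg
    linarith

/-! ### The lowering relation -/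

section lowering

variable {j₁ m₁ j₂ m₂ j : ℝ}

/-- Another telescoping three-term relation, with certificate -[2j + 1 - u][u] times the summand.
The bounds on j₁ + m₁ and j + m place the numerator arguments above D = j - m. -/
lemma hypSum_lowering (hq : 0 < q) (h1 : 0 ≤ j₁ + m₁) (h : 0 ≤ j + (m₁ + m₂)) :
    qnum q (j + (m₁ + m₂) + 1) * qnum q (j - (m₁ + m₂)) *
        hypSum q (j₁ - m₁) (j₁ + j - m₂) (2 * j) (j₁ + j - j₂) (j - (m₁ + m₂)) (j₁ + j₂ + j + 1) +
      q ^ (j₁ + j + m₂ + 1) * qnum q (j₁ - m₁) *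
        hypSum q (j₁ - m₁ - 1) (j₁ + j - m₂) (2 * j) (j₁ + j - j₂) (j - (m₁ + m₂) - 1)
          (j₁ + j₂ + j + 1) -
      q ^ (j₁ - m₁) * qnum q (j₂ + m₂ + 1) * qnum q (j₂ - m₂) *
        hypSum q (j₁ - m₁) (j₁ + j - m₂ - 1) (2 * j) (j₁ + j - j₂) (j - (m₁ + m₂) - 1)
          (j₁ + j₂ + j + 1) = 0 := by
  obtain ⟨N, hN⟩ := exists_nat_gt (j - (m₁ + m₂))
  rw [hypSum_eq_sum_range hN, hypSum_eq_sum_range (N := N) (by linarith),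
    hypSum_eq_sum_range (N := N) (by linarith)]
  simp only [Finset.mul_sum, ← Finset.sum_sub_distrib, ← Finset.sum_add_distrib]
  apply sum_range_eq_zero_of_telescope (H := fun u : ℕ => -(qnum q (2 * j + 1 - u) * qnum q u *
    hypTerm q (j₁ - m₁) (j₁ + j - m₂) (2 * j) (j₁ + j - j₂) (j - (m₁ + m₂)) (j₁ + j₂ + j + 1) u))
  · intro u
    rw [hypTerm_exponent_sub_one hq, hypTerm_sub_one hq, hypTerm_sub_one hq]
    have hs := hypTerm_succ (c := j₁ - m₁) (A := j₁ + j - m₂) (B := 2 * j)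
      (n := j₁ + j - j₂) (D := j - (m₁ + m₂)) (E := j₁ + j₂ + j + 1) hq u
    push_cast
    rw [mul_assoc (qnum q (2 * j + 1 - (u + 1))), hs]
    by_cases hD : IsNat (j - (m₁ + m₂) - u)
    swap
    · simp only [hypTerm_eq_zero hD]; ring
    have e1 := qnum_mul_sub_mul hq (x := j - (m₁ + m₂)) (y := j + (m₁ + m₂) + 1) (z := u)
      (w := 2 * j + 1 - u) (by ring)
    rw [show 2 * j + 1 - (u : ℝ) - (j - (m₁ + m₂)) = j + (m₁ + m₂) + 1 - u by ring] at e1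
    -- As before, the index u = D is separated because the numerator factorials cannot be unfolded
    -- there.
    rcases hD.nonneg.eq_or_lt with h0 | h0
    · rw [← h0] at e1 ⊢
      simp only [qnum_zero, zero_mul, mul_zero] at e1 ⊢
      linear_combination e1 * hypTerm q (j₁ - m₁) (j₁ + j - m₂) (2 * j) (j₁ + j - j₂)
        (j - (m₁ + m₂)) (j₁ + j₂ + j + 1) u
    · rw [hypTerm_numerator (A := j₁ + j - m₂) u (by linarith) (by linarith),
        hypTerm_numerator_right (B := 2 * j) u (by linarith) (by linarith)]
      generalize hypTerm q (j₁ - m₁) (j₁ + j - m₂ - 1) (2 * j - 1) (j₁ + j - j₂)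
        (j - (m₁ + m₂)) (j₁ + j₂ + j + 1) u = v
      have e2 := rpow_mul_qnum_add hq (j₁ - m₁) (j + (m₁ + m₂) + 1 - u)
      rw [show j₁ - m₁ + (j + (m₁ + m₂) + 1 - u) = (j₁ + j + m₂ + 1) + (-u) by ring,
        Real.rpow_add hq] at e2
      have e3 := qnum_mul_sub_mul hq (x := j₁ + j₂ + j + 1 - u) (y := j₁ + j - j₂ - u)
        (z := j₁ + j - m₂ - u) (w := j₁ + j + m₂ + 1 + -u) (by ring)
      rw [show j₁ + j₂ + j + 1 - u - (j₁ + j - m₂ - u) = j₂ + m₂ + 1 by ring,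
        show j₁ + j + m₂ + 1 + -u - (j₁ + j₂ + j + 1 - u) = -(j₂ - m₂) by ring,
        qnum_neg] at e3
      rw [show 2 * j + 1 - ((u : ℝ) + 1) = 2 * j - u by ring]
      linear_combination (qnum q (j₁ + j - m₂ - u) * qnum q (2 * j - u) * v) * e1 +
        qnum q (j - (m₁ + m₂) - u) * qnum q (j₁ + j - m₂ - u) * qnum q (2 * j - u) * v * e2 -
        v * qnum q (j - (m₁ + m₂) - u) * qnum q (2 * j - u) * q ^ (j₁ - m₁) * e3
  · simp
  · simp [hypTerm_eq_zero_of_lt hN]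

lemma cgSum_lowering (hq : 0 < q) (h1 : 0 ≤ j₁ + m₁) (h : 0 ≤ j + (m₁ + m₂)) :
    qnum q (j + (m₁ + m₂) + 1) * qnum q (j - (m₁ + m₂)) * cgSum q j₁ m₁ j₂ m₂ j =
      q ^ m₂ * cgSum q j₁ (m₁ + 1) j₂ m₂ j +
        q ^ (-m₁) * qnum q (j₂ + m₂ + 1) * cgSum q j₁ m₁ j₂ (m₂ + 1) j := by
  have hl := hypSum_lowering hq h1 h (j₂ := j₂)
  simp only [cgSum, div_eq_mul_inv, mul_inv]
  rw [show j₁ - (m₁ + 1) = j₁ - m₁ - 1 by ring, show j₂ - (m₂ + 1) = j₂ - m₂ - 1 by ring,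
    show j - (m₁ + 1 + m₂) = j - (m₁ + m₂) - 1 by ring,
    show j - (m₁ + (m₂ + 1)) = j - (m₁ + m₂) - 1 by ring,
    show j₁ + j - (m₂ + 1) = j₁ + j - m₂ - 1 by ring,
    inv_qfact_sub_one hq, inv_qfact_sub_one hq, sgn_sub_one,
    show (m₁ + 1) * (j₁ + j + 1) + m₂ * j₁ +
      (j₂ * (j₂ + 1) - (j₁ + j) * (j₁ + j + 1)) * 2⁻¹ =
      (m₁ * (j₁ + j + 1) + m₂ * j₁ + (j₂ * (j₂ + 1) - (j₁ + j) * (j₁ + j + 1)) * 2⁻¹) +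
        (j₁ + j + 1) by ring,
    show m₁ * (j₁ + j + 1) + (m₂ + 1) * j₁ +
      (j₂ * (j₂ + 1) - (j₁ + j) * (j₁ + j + 1)) * 2⁻¹ =
      (m₁ * (j₁ + j + 1) + m₂ * j₁ + (j₂ * (j₂ + 1) - (j₁ + j) * (j₁ + j + 1)) * 2⁻¹) +
        j₁ by ring,
    Real.rpow_add hq _ (j₁ + j + 1), Real.rpow_add hq _ j₁]
  rw [show j₁ + j + m₂ + 1 = (j₁ + j + 1) + m₂ by ring, sub_eq_add_neg j₁ m₁,
    Real.rpow_add hq (j₁ + j + 1), Real.rpow_add hq j₁] at hl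
  rw [sub_eq_add_neg j₁ m₁]
  generalize (qfact q (j₂ - m₂))⁻¹ = x1 at *
  generalize (qfact q (j₁ + -m₁))⁻¹ = x2 at *
  generalize (qfact q (j₂ - j₁ + j))⁻¹ = x3 at *
  generalize q ^ (m₁ * (j₁ + j + 1) + m₂ * j₁ +
    (j₂ * (j₂ + 1) - (j₁ + j) * (j₁ + j + 1)) * 2⁻¹) = y
  linear_combination (sgn (j₁ + -m₁) * y * qfact q (j₁ + j - j₂) * x1 * x2 * x3) * hl

end lowering

/-! ### Square root factors in the lowering relation -/

section

variable {j₁ m₁ j₂ m₂ j : ℝ}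

lemma mul_sqrt_eq_sqrt {a b : ℝ} (ha : 0 ≤ a) : a * √b = √(a ^ 2 * b) := by
  rw [Real.sqrt_mul (sq_nonneg a), Real.sqrt_sq ha]

lemma qfact_succ {x : ℝ} (hx : 0 ≤ x) : qfact q (x + 1) = qnum q (x + 1) * qfact q x := by
  rw [qfact_eq_mul (by linarith), add_sub_cancel_right]

/-- The square roots in the action of J₋ are absorbed by the ratio of two norm factors, so the
lowering relation reduces to the rational one, `cgSum_lowering`. At the edge m₁ = j₁ this ratio is
meaningless; there `cgPhi_lowering` uses the vanishing of `cgSum` instead. -/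
lemma cgNorm_add_one_left (hq : 0 < q) (h1 : IsState j₁ m₁) (h : IsNat (j + (m₁ + m₂)))
    (h' : IsNat (j - (m₁ + m₂) - 1)) (hm : 0 < j₁ - m₁) :
    √(qnum q (j + (m₁ + m₂) + 1) * qnum q (j - (m₁ + m₂))) *
      (√(qnum q (j₁ + m₁ + 1) * qnum q (j₁ - m₁)) * cgNorm q j₁ (m₁ + 1) j₂ m₂ j) =
      cgNorm q j₁ m₁ j₂ m₂ j := by
  have a1 := h1.1.nonneg
  have a2 := h.nonneg
  have a3 := h'.nonneg
  have p1 := qnum_pos hq (by linarith : 0 < j + (m₁ + m₂) + 1)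
  have p2 := qnum_pos hq (by linarith : 0 < j - (m₁ + m₂))
  have p3 := qnum_pos hq (by linarith : 0 < j₁ + m₁ + 1)
  have p4 := qnum_pos hq hm
  have r1 := (qfact_pos hq h1.1).ne'
  have r2 := (qfact_pos hq h).ne'
  rw [cgNorm, cgNorm, ← Real.sqrt_mul (by positivity), ← Real.sqrt_mul (by positivity)]
  congr 1
  rw [qfact_eq_mul (by linarith : j₁ - m₁ ≠ 0), qfact_eq_mul (by linarith : j - (m₁ + m₂) ≠ 0),
    show j₁ + (m₁ + 1) = j₁ + m₁ + 1 by ring, show j + (m₁ + 1 + m₂) = j + (m₁ + m₂) + 1 by ring,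
    show j₁ - (m₁ + 1) = j₁ - m₁ - 1 by ring, show j - (m₁ + 1 + m₂) = j - (m₁ + m₂) - 1 by ring,
    qfact_succ a1, qfact_succ a2]
  field_simp

lemma cgNorm_add_one_right (hq : 0 < q) (h1 : IsState j₁ m₁) (h2 : IsState j₂ m₂)
    (h : IsNat (j + (m₁ + m₂))) (h' : IsNat (j - (m₁ + m₂) - 1)) (hm : 0 < j₂ - m₂) :
    √(qnum q (j + (m₁ + m₂) + 1) * qnum q (j - (m₁ + m₂))) *
      (√(qnum q (j₂ + m₂ + 1) * qnum q (j₂ - m₂)) * cgNorm q j₁ m₁ j₂ (m₂ + 1) j) =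
      qnum q (j₂ + m₂ + 1) * cgNorm q j₁ m₁ j₂ m₂ j := by
  have a1 := h2.1.nonneg
  have a2 := h.nonneg
  have a3 := h'.nonneg
  have p1 := qnum_pos hq (by linarith : 0 < j + (m₁ + m₂) + 1)
  have p2 := qnum_pos hq (by linarith : 0 < j - (m₁ + m₂))
  have p3 := qnum_pos hq (by linarith : 0 < j₂ + m₂ + 1)
  have p4 := qnum_pos hq hm
  have r1 := (qfact_pos hq h1.1).ne'
  have r2 := (qfact_pos hq h).ne'
  rw [cgNorm, cgNorm, ← Real.sqrt_mul (by positivity), ← Real.sqrt_mul (by positivity),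
    mul_sqrt_eq_sqrt p3.le]
  congr 1
  rw [qfact_eq_mul (by linarith : j₂ - m₂ ≠ 0), qfact_eq_mul (by linarith : j - (m₁ + m₂) ≠ 0),
    show j₂ + (m₂ + 1) = j₂ + m₂ + 1 by ring, show j + (m₁ + (m₂ + 1)) = j + (m₁ + m₂) + 1 by ring,
    show j₂ - (m₂ + 1) = j₂ - m₂ - 1 by ring,
    show j - (m₁ + (m₂ + 1)) = j - (m₁ + m₂) - 1 by ring,
    qfact_succ a1, qfact_succ a2]
  field_simp

/-- The action of the lowering operator on the Clebsch–Gordan coefficients. -/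
lemma cgPhi_lowering (hq : 0 < q) (h1 : IsState j₁ m₁) (h2 : IsState j₂ m₂)
    (h : IsNat (j + (m₁ + m₂))) (h' : IsNat (j - (m₁ + m₂) - 1)) :
    √(qnum q (j + (m₁ + m₂) + 1) * qnum q (j - (m₁ + m₂))) * cgPhi q j₁ m₁ j₂ m₂ j =
      √(qnum q (j₁ + m₁ + 1) * qnum q (j₁ - m₁)) * q ^ m₂ * cgPhi q j₁ (m₁ + 1) j₂ m₂ j +
      q ^ (-m₁) * √(qnum q (j₂ + m₂ + 1) * qnum q (j₂ - m₂)) * cgPhi q j₁ m₁ j₂ (m₂ + 1) j := by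
  have a2 := h.nonneg
  have a3 := h'.nonneg
  have p1 := qnum_pos hq (by linarith : 0 < j + (m₁ + m₂) + 1)
  have p2 := qnum_pos hq (by linarith : 0 < j - (m₁ + m₂))
  have hs := cgSum_lowering hq h1.1.nonneg h.nonneg (j₂ := j₂)
  have hr : 0 < √(qnum q (j + (m₁ + m₂) + 1) * qnum q (j - (m₁ + m₂))) :=
    Real.sqrt_pos.2 (by positivity)
  have hr2 := Real.mul_self_sqrt (mul_pos p1 p2).le
  have e1 : √(qnum q (j + (m₁ + m₂) + 1) * qnum q (j - (m₁ + m₂))) *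
      (√(qnum q (j₁ + m₁ + 1) * qnum q (j₁ - m₁)) * cgNorm q j₁ (m₁ + 1) j₂ m₂ j) *
        cgSum q j₁ (m₁ + 1) j₂ m₂ j = cgNorm q j₁ m₁ j₂ m₂ j * cgSum q j₁ (m₁ + 1) j₂ m₂ j := by
    rcases h1.2.nonneg.eq_or_lt with h0 | h0
    · have : cgSum q j₁ (m₁ + 1) j₂ m₂ j = 0 := by
        rw [cgSum, qfact_of_neg (x := j₁ - (m₁ + 1)) (by linarith)]; simp
      rw [this]; simp
    · rw [cgNorm_add_one_left hq h1 h h' h0]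
  have e2 : √(qnum q (j + (m₁ + m₂) + 1) * qnum q (j - (m₁ + m₂))) *
      (√(qnum q (j₂ + m₂ + 1) * qnum q (j₂ - m₂)) * cgNorm q j₁ m₁ j₂ (m₂ + 1) j) *
        cgSum q j₁ m₁ j₂ (m₂ + 1) j =
      qnum q (j₂ + m₂ + 1) * cgNorm q j₁ m₁ j₂ m₂ j * cgSum q j₁ m₁ j₂ (m₂ + 1) j := by
    rcases h2.2.nonneg.eq_or_lt with h0 | h0
    · have : cgSum q j₁ m₁ j₂ (m₂ + 1) j = 0 := by
        rw [cgSum, qfact_of_neg (x := j₂ - (m₂ + 1)) (by linarith)]; simp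
      rw [this]; simp
    · rw [cgNorm_add_one_right hq h1 h2 h h' h0]
  apply mul_left_cancel₀ hr.ne'
  simp only [cgPhi]
  generalize √(qnum q (j + (m₁ + m₂) + 1) * qnum q (j - (m₁ + m₂))) = r at *
  linear_combination (cgConst q j₁ j₂ j * cgNorm q j₁ m₁ j₂ m₂ j) * hs +
    cgConst q j₁ j₂ j * cgNorm q j₁ m₁ j₂ m₂ j * cgSum q j₁ m₁ j₂ m₂ j * hr2 -
    cgConst q j₁ j₂ j * q ^ m₂ * e1 - cgConst q j₁ j₂ j * q ^ (-m₁) * e2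

/-! ### The highest weight vector -/

/-- For m = j the bound D = j - m of the ₃φ₂ sum is 0, so only the term u = 0 survives. -/
lemma cgSum_highest (hq : 0 < q) (h1 : IsNat (j₁ + j - j₂)) (hm : m₁ + m₂ = j) :
    cgSum q j₁ m₁ j₂ m₂ j = sgn (j₁ - m₁) *
      q ^ (m₁ * (j₁ + j + 1) + m₂ * j₁ + (j₂ * (j₂ + 1) - (j₁ + j) * (j₁ + j + 1)) / 2) *
      (qfact q (j₁ + m₁) * qfact q (2 * j) / (qfact q (j₂ - m₂) * qfact q (j₁ - m₁) *
        qfact q (j₂ - j₁ + j) * qfact q (j₁ + j₂ + j + 1))) := by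
  have r1 := (qfact_pos hq h1).ne'
  rw [cgSum, hm, sub_self, hypSum_zero, show j₁ + j - m₂ = j₁ + m₁ by rw [← hm]; ring]
  field_simp

lemma cgNorm_highest (hm : m₁ + m₂ = j) :
    cgNorm q j₁ m₁ j₂ m₂ j = √(qfact q (j₂ + m₂) * qfact q (j₂ - m₂) * qfact q (j₁ - m₁) /
      (qfact q (j₁ + m₁) * qfact q (2 * j))) := by
  rw [cgNorm, hm, sub_self, qfact_zero, mul_one, ← two_mul]

/-- The raising operator kills the highest weight vector. -/
lemma cgPhi_raising (hq : 0 < q) (h1 : IsState j₁ (m₁ - 1)) (h1' : IsState j₁ m₁)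
    (h2 : IsState j₂ (m₂ - 1)) (h2' : IsState j₂ m₂) (ht : IsNat (j₁ + j - j₂))
    (hm : m₁ + m₂ = j + 1) :
    √(qnum q (j₁ - m₁ + 1) * qnum q (j₁ + m₁)) * q ^ m₂ * cgPhi q j₁ (m₁ - 1) j₂ m₂ j +
      q ^ (-m₁) * √(qnum q (j₂ - m₂ + 1) * qnum q (j₂ + m₂)) * cgPhi q j₁ m₁ j₂ (m₂ - 1) j =
      0 := by
  have a1 := h1.1.nonneg
  have a2 := h1'.2.nonneg
  have a3 := h2.1.nonneg
  have a4 := h2'.2.nonneg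
  have p1 := qnum_pos hq (by linarith : 0 < j₁ - m₁ + 1)
  have p2 := qnum_pos hq (by linarith : 0 < j₁ + m₁)
  have p3 := qnum_pos hq (by linarith : 0 < j₂ - m₂ + 1)
  have p4 := qnum_pos hq (by linarith : 0 < j₂ + m₂)
  have r1 := (qfact_pos hq h1.1).ne'
  have r2 := (qfact_pos hq h1'.2).ne'
  have r3 := (qfact_pos hq h2.1).ne'
  have r4 := (qfact_pos hq h2'.2).ne'
  have s1 : qfact q (j₁ + m₁) = qnum q (j₁ + m₁) * qfact q (j₁ + (m₁ - 1)) := by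
    rw [qfact_eq_mul (by linarith : j₁ + m₁ ≠ 0), add_sub_assoc]
  have s2 : qfact q (j₁ - (m₁ - 1)) = qnum q (j₁ - m₁ + 1) * qfact q (j₁ - m₁) := by
    rw [← qfact_succ a2]; congr 1; ring
  have s3 : qfact q (j₂ + m₂) = qnum q (j₂ + m₂) * qfact q (j₂ + (m₂ - 1)) := by
    rw [qfact_eq_mul (by linarith : j₂ + m₂ ≠ 0), add_sub_assoc]
  have s4 : qfact q (j₂ - (m₂ - 1)) = qnum q (j₂ - m₂ + 1) * qfact q (j₂ - m₂) := by
    rw [← qfact_succ a4]; congr 1; ring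
  have e1 : √(qnum q (j₁ - m₁ + 1) * qnum q (j₁ + m₁)) * cgNorm q j₁ (m₁ - 1) j₂ m₂ j =
      qnum q (j₁ - m₁ + 1) * qnum q (j₁ + m₁) *
        √(qfact q (j₂ + m₂) * qfact q (j₂ - m₂) * qfact q (j₁ - m₁) /
          (qfact q (j₁ + m₁) * qfact q (2 * j))) := by
    rw [cgNorm_highest (by linarith), ← Real.sqrt_mul (by positivity),
      mul_sqrt_eq_sqrt (by positivity), s1, s2]
    congr 1
    field_simp
  have e2 : √(qnum q (j₂ - m₂ + 1) * qnum q (j₂ + m₂)) * cgNorm q j₁ m₁ j₂ (m₂ - 1) j =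
      qnum q (j₂ - m₂ + 1) *
        √(qfact q (j₂ + m₂) * qfact q (j₂ - m₂) * qfact q (j₁ - m₁) /
          (qfact q (j₁ + m₁) * qfact q (2 * j))) := by
    rw [cgNorm_highest (by linarith), ← Real.sqrt_mul (by positivity),
      mul_sqrt_eq_sqrt p3.le, s3, s4]
    congr 1
    ring
  have e3 : qnum q (j₁ - m₁ + 1) * qnum q (j₁ + m₁) * q ^ m₂ * cgSum q j₁ (m₁ - 1) j₂ m₂ j +
      q ^ (-m₁) * qnum q (j₂ - m₂ + 1) * cgSum q j₁ m₁ j₂ (m₂ - 1) j = 0 := by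
    rw [cgSum_highest hq ht (by linarith), cgSum_highest hq ht (by linarith), s1, s2, s4,
      show j₁ - (m₁ - 1) = j₁ - m₁ + 1 by ring, sgn_add_one]
    -- The exponents differ by m₁ + m₂ - j - 1 = 0. The two terms therefore have equal size, and the
    -- sign of j₁ - m₁ makes them cancel.
    have hexp : q ^ m₂ * q ^ ((m₁ - 1) * (j₁ + j + 1) + m₂ * j₁ +
        (j₂ * (j₂ + 1) - (j₁ + j) * (j₁ + j + 1)) / 2) =
        q ^ (-m₁) * q ^ (m₁ * (j₁ + j + 1) + (m₂ - 1) * j₁ +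
        (j₂ * (j₂ + 1) - (j₁ + j) * (j₁ + j + 1)) / 2) := by
      rw [← Real.rpow_add hq, ← Real.rpow_add hq]
      congr 1
      linear_combination hm
    generalize q ^ ((m₁ - 1) * (j₁ + j + 1) + m₂ * j₁ +
      (j₂ * (j₂ + 1) - (j₁ + j) * (j₁ + j + 1)) / 2) = y1 at *
    generalize q ^ (m₁ * (j₁ + j + 1) + (m₂ - 1) * j₁ +
      (j₂ * (j₂ + 1) - (j₁ + j) * (j₁ + j + 1)) / 2) = y2 at *
    have key : ∀ c : ℝ, c * (q ^ m₂ * y1 - q ^ (-m₁) * y2) = 0 := fun c => by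
      rw [hexp, sub_self, mul_zero]
    rw [← key (-(sgn (j₁ - m₁) * qnum q (j₁ + m₁) * qfact q (j₁ + (m₁ - 1)) * qfact q (2 * j) /
      (qfact q (j₂ - m₂) * qfact q (j₁ - m₁) * qfact q (j₂ - j₁ + j) *
        qfact q (j₁ + j₂ + j + 1))))]
    simp only [div_eq_mul_inv, mul_inv]
    field_simp
    ring
  simp only [cgPhi]
  linear_combination (cgConst q j₁ j₂ j * q ^ m₂ * cgSum q j₁ (m₁ - 1) j₂ m₂ j) * e1 +
    cgConst q j₁ j₂ j * q ^ (-m₁) * cgSum q j₁ m₁ j₂ (m₂ - 1) j * e2 +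
    cgConst q j₁ j₂ j * √(qfact q (j₂ + m₂) * qfact q (j₂ - m₂) * qfact q (j₁ - m₁) /
          (qfact q (j₁ + m₁) * qfact q (2 * j))) * e3

lemma cgConst_sq (hq : 0 < q) (hj : 0 ≤ j) :
    cgConst q j₁ j₂ j ^ 2 = qfact q (j₁ + j₂ - j) * qfact q (j₂ - j₁ + j) *
      qfact q (j₁ + j₂ + j + 1) / qfact q (j₁ + j - j₂) * qnum q (2 * j + 1) := by
  rw [cgConst, mul_pow, nabla_sq hq, Real.sq_sqrt (qnum_nonneg hq (by linarith)),
    add_comm j₂ j₁]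

/-- Squaring removes sign and roots. With i = j₁ - m₁, the last factor is the summand of the
q-Vandermonde sum, and the factors before it do not depend on i. -/
lemma cgPhi_highest_sq (hq : 0 < q) (h1 : IsState j₁ m₁) (h2 : IsState j₂ m₂)
    (t : IsNat (j₁ + j₂ - j)) (t1 : IsNat (j₁ + j - j₂)) (t2 : IsNat (j₂ - j₁ + j))
    (hm : m₁ + m₂ = j) :
    cgPhi q j₁ m₁ j₂ m₂ j ^ 2 =
      qfact q (j₁ + j₂ - j) * qfact q (2 * j + 1) /
        (qfact q (j₂ - j₁ + j) * qfact q (j₁ + j - j₂) * qfact q (j₁ + j₂ + j + 1)) *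
      q ^ ((j₁ + j₂ - j) * (j₂ - j₁ + j + 1)) * (q ^ (-(j₁ - m₁) * (2 * j + 2)) *
      (qfact q (j₁ + m₁) * qfact q (j₂ + m₂) / (qfact q (j₁ - m₁) * qfact q (j₂ - m₂)))) := by
  have hj : 0 ≤ j := by have := t1.nonneg; have := t2.nonneg; linarith
  have hJ : IsNat (j₁ + j₂ + j + 1) := by
    have : IsNat (1 : ℝ) := ⟨1, by simp⟩
    have := ((t.add t1).add t2).add this
    convert this using 1; ring
  have h2j : IsNat (2 * j) := by convert t1.add t2 using 1; ring
  have r1 := qfact_pos hq h1.1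
  have r2 := qfact_pos hq h1.2
  have r3 := qfact_pos hq h2.1
  have r4 := qfact_pos hq h2.2
  have r5 := qfact_pos hq t
  have r6 := qfact_pos hq t1
  have r7 := qfact_pos hq t2
  have r8 := qfact_pos hq hJ
  have r9 := qfact_pos hq h2j
  rw [cgPhi, mul_pow, mul_pow, cgConst_sq hq hj, cgNorm_highest hm, Real.sq_sqrt (by positivity),
    cgSum_highest hq t1 hm, mul_pow, mul_pow, qfact_succ (by linarith : 0 ≤ 2 * j), pow_two (sgn _),
    sgn_mul_self, ← Real.rpow_natCast (q ^ _) 2, ← Real.rpow_mul hq.le]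
  have hexp : q ^ ((m₁ * (j₁ + j + 1) + m₂ * j₁ +
        (j₂ * (j₂ + 1) - (j₁ + j) * (j₁ + j + 1)) / 2) * (2 : ℕ)) =
      q ^ ((j₁ + j₂ - j) * (j₂ - j₁ + j + 1)) * q ^ (-(j₁ - m₁) * (2 * j + 2)) := by
    rw [← Real.rpow_add hq]
    congr 1
    push_cast
    linear_combination 2 * j₁ * hm
  rw [hexp]
  field_simp

lemma cgPhi_highest_pos (hq : 0 < q) (t : IsNat (j₁ + j₂ - j)) (t1 : IsNat (j₁ + j - j₂))
    (t2 : IsNat (j₂ - j₁ + j)) : 0 < cgPhi q j₁ j₁ j₂ (j - j₁) j := by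
  have h2j : IsNat (2 * j) := by convert t1.add t2 using 1; ring
  have h2j₁ : IsNat (j₁ + j₁) := by convert t1.add t using 1; ring
  have hj : 0 ≤ j := by have := t1.nonneg; have := t2.nonneg; linarith
  have hJ : IsNat (j₁ + j₂ + j + 1) := by
    have : IsNat (1 : ℝ) := ⟨1, by simp⟩
    have := ((t.add t1).add t2).add this
    convert this using 1; ring
  have r3 := qfact_pos hq (x := j₂ + (j - j₁)) (by convert t2 using 1; ring)
  have r4 := qfact_pos hq (x := j₂ - (j - j₁)) (by convert t using 1; ring)
  have r5 := qfact_pos hq t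
  have r6 := qfact_pos hq t1
  have r7 := qfact_pos hq t2
  have r8 := qfact_pos hq hJ
  have r9 := qfact_pos hq h2j
  have r10 := qfact_pos hq h2j₁
  have r11 := qnum_pos hq (by linarith : 0 < 2 * j + 1)
  rw [cgPhi, cgConst, nabla, cgNorm_highest (by ring), cgSum_highest hq t1 (by ring), sub_self,
    qfact_zero, sgn_zero, show j₁ + j - j₂ = j₁ + j - j₂ by ring,
    show j₂ + j₁ - j = j₁ + j₂ - j by ring, show j₂ + j₁ + j + 1 = j₁ + j₂ + j + 1 by ring]
  have : 0 < q ^ (j₁ * (j₁ + j + 1) + (j - j₁) * j₁ +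
    (j₂ * (j₂ + 1) - (j₁ + j) * (j₁ + j + 1)) / 2) := Real.rpow_pos_of_pos hq _
  positivity

end

/-- A form of the `q`-Vandermonde sum. -/
lemma sum_qVandermonde (hq : 0 < q) (g : ℕ) : ∀ {x y : ℝ}, IsNat x → IsNat y →
    ∑ i ∈ Finset.range (g + 1), q ^ (-(i : ℝ) * (x + y + 2)) *
      (qfact q (y + g - i) * qfact q (x + i) / (qfact q i * qfact q ((g : ℝ) - i))) =
    q ^ (-(g : ℝ) * (x + 1)) * (qfact q x * qfact q y * qfact q (x + y + g + 1) /
      (qfact q g * qfact q (x + y + 1))) := by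
  have h1 : IsNat (1 : ℝ) := ⟨1, by simp⟩
  induction g with
  | zero =>
    intro x y hx hy
    have h := (qfact_pos hq ((hx.add hy).add h1)).ne'
    simp only [zero_add, Finset.sum_range_one, Nat.cast_zero, neg_zero, zero_mul,
      Real.rpow_zero, add_zero, sub_zero, qfact_zero]
    field_simp
  | succ g ih =>
    intro x y hx hy
    have hg := (qnum_pos hq (by positivity : 0 < (g : ℝ) + 1)).ne'
    have e1 := ih (hx.add h1) hy
    have e2 := ih hx (hy.add h1)
    apply mul_left_cancel₀ hg
    rw [Finset.mul_sum]
    -- Multiplication by [g + 1] = q^(g+1-i)[i] + q^(-i)[g + 1 - i] splits the sum: after a shift of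
    -- i the first part is the sum for (x + 1, y), and the second is the one for (x, y + 1), both
    -- with g.
    have hsplit : ∀ i ∈ Finset.range (g + 1 + 1),
        qnum q ((g : ℝ) + 1) * (q ^ (-(i : ℝ) * (x + y + 2)) *
          (qfact q (y + (g + 1 : ℕ) - i) * qfact q (x + i) /
            (qfact q i * qfact q (((g + 1 : ℕ) : ℝ) - i)))) =
        q ^ ((g : ℝ) + 1 - i) * qnum q i * (q ^ (-(i : ℝ) * (x + y + 2)) *
          (qfact q (y + (g + 1 : ℕ) - i) * qfact q (x + i) /
            (qfact q i * qfact q (((g + 1 : ℕ) : ℝ) - i)))) +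
        q ^ (-(i : ℝ)) * qnum q ((g : ℝ) + 1 - i) * (q ^ (-(i : ℝ) * (x + y + 2)) *
          (qfact q (y + (g + 1 : ℕ) - i) * qfact q (x + i) /
            (qfact q i * qfact q (((g + 1 : ℕ) : ℝ) - i)))) := by
      intro i _
      have := qnum_add hq i ((g : ℝ) + 1 - i)
      rw [add_sub_cancel] at this
      rw [this]
      ring
    rw [Finset.sum_congr rfl hsplit, Finset.sum_add_distrib, Finset.sum_range_succ',
      Finset.sum_range_succ _ (g + 1)]
    push_cast
    simp only [qnum_zero, sub_self, mul_zero, zero_mul, add_zero]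
    have f1 : ∀ k ∈ Finset.range (g + 1),
        q ^ ((g : ℝ) + 1 - (k + 1)) * qnum q ((k : ℝ) + 1) *
          (q ^ (-((k : ℝ) + 1) * (x + y + 2)) *
          (qfact q (y + (g + 1) - (k + 1)) * qfact q (x + (k + 1)) /
            (qfact q ((k : ℝ) + 1) * qfact q ((g : ℝ) + 1 - (k + 1))))) =
        q ^ ((g : ℝ) - (x + y + 2)) * (q ^ (-(k : ℝ) * (x + 1 + y + 2)) *
          (qfact q (y + g - k) * qfact q (x + 1 + k) / (qfact q k * qfact q ((g : ℝ) - k)))) := by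
      intro k _
      rw [qfact_succ (by positivity : (0 : ℝ) ≤ k), show y + (g + 1) - ((k : ℝ) + 1) = y + g - k by ring,
        show x + ((k : ℝ) + 1) = x + 1 + k by ring, show (g : ℝ) + 1 - (k + 1) = g - k by ring]
      have hexp : q ^ ((g : ℝ) - k) * q ^ (-((k : ℝ) + 1) * (x + y + 2)) =
          q ^ ((g : ℝ) - (x + y + 2)) * q ^ (-(k : ℝ) * (x + 1 + y + 2)) := by
        rw [← Real.rpow_add hq, ← Real.rpow_add hq]
        congr 1
        ring
      have hk := (qnum_pos hq (by positivity : 0 < (k : ℝ) + 1)).ne'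
      rw [← mul_assoc (q ^ ((g : ℝ) - (x + y + 2))), ← hexp]
      field_simp
    have f2 : ∀ k ∈ Finset.range (g + 1),
        q ^ (-(k : ℝ)) * qnum q ((g : ℝ) + 1 - k) * (q ^ (-(k : ℝ) * (x + y + 2)) *
          (qfact q (y + (g + 1) - k) * qfact q (x + k) /
            (qfact q k * qfact q ((g : ℝ) + 1 - k)))) =
        q ^ (-(k : ℝ) * (x + (y + 1) + 2)) *
          (qfact q (y + 1 + g - k) * qfact q (x + k) / (qfact q k * qfact q ((g : ℝ) - k))) := by
      intro k hk
      have hk' : (k : ℝ) < g + 1 := by exact_mod_cast Finset.mem_range.1 hk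
      have hk2 := (qnum_pos hq (by linarith : 0 < (g : ℝ) + 1 - k)).ne'
      rw [qfact_eq_mul (by linarith : (g : ℝ) + 1 - k ≠ 0), show (g : ℝ) + 1 - k - 1 = g - k by ring,
        show y + (g + 1) - (k : ℝ) = y + 1 + g - k by ring,
        show -(k : ℝ) * (x + (y + 1) + 2) = -k + -k * (x + y + 2) by ring, Real.rpow_add hq]
      field_simp
    rw [Finset.sum_congr rfl f1, Finset.sum_congr rfl f2, ← Finset.mul_sum, e1, e2]
    -- The two closed forms recombine by the addition law for [x + y + 2].
    have hb := qnum_add hq (y + 1) (x + 1)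
    rw [show y + 1 + (x + 1) = x + y + 1 + 1 by ring] at hb
    rw [qfact_succ (by positivity : (0 : ℝ) ≤ g), qfact_succ hx.nonneg, qfact_succ hy.nonneg,
      show x + 1 + y + g + 1 = x + y + g + 2 by ring,
      show x + (y + 1) + g + 1 = x + y + g + 2 by ring,
      show x + y + (g + 1) + 1 = x + y + g + 2 by ring,
      show x + 1 + y + 1 = x + y + 1 + 1 by ring, show x + (y + 1) + 1 = x + y + 1 + 1 by ring,
      qfact_succ ((hx.add hy).add h1).nonneg]
    have n1 := (qnum_pos hq (by have := ((hx.add hy).add h1).nonneg; linarith :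
      0 < x + y + 1 + 1)).ne'
    have n2 := (qfact_pos hq ((hx.add hy).add h1)).ne'
    have n3 := (qfact_pos hq (isNat_natCast g)).ne'
    have x1 : q ^ (-((g : ℝ) + 1) * (x + 1)) = q ^ (-(g : ℝ) * (x + 1)) * q ^ (-(x + 1)) := by
      rw [← Real.rpow_add hq]; congr 1; ring
    have x2 : q ^ ((g : ℝ) - (x + y + 2)) * q ^ (-(g : ℝ) * (x + 1 + 1)) =
        q ^ (-(g : ℝ) * (x + 1)) * q ^ (-(x + 1)) * q ^ (-(y + 1)) := by
      rw [← Real.rpow_add hq, ← Real.rpow_add hq, ← Real.rpow_add hq]; congr 1; ring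
    have x3 : q ^ (-(x + 1)) * q ^ (x + 1) = 1 := by
      rw [← Real.rpow_add hq, neg_add_cancel, Real.rpow_zero]
    rw [x1, ← mul_assoc (q ^ ((g : ℝ) - (x + y + 2))), x2]
    field_simp
    rw [hb]
    linear_combination (-(qfact q x * qfact q y * qfact q (x + y + g + 2) * qnum q (y + 1))) * x3

/-! ### The generators in one irreducible representation -/

/-- The extension of a vector by zero. -/
noncomputable def extendZero {n : ℕ} (g : Fin (n + 1) → ℝ) (k : ℕ) : ℝ :=
  if h : k < n + 1 then g ⟨k, h⟩ else 0

lemma sum_ite_val_eq {n : ℕ} (g : Fin (n + 1) → ℝ) (a : Fin (n + 1) → ℝ) (k : ℕ) :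
    ∑ i : Fin (n + 1), (if (i : ℕ) = k then a i else 0) * g i =
      extendZero (fun i => a i * g i) k := by
  unfold extendZero
  split_ifs with h
  · rw [Finset.sum_eq_single ⟨k, h⟩]
    · simp
    · intro b _ hb
      rw [if_neg, zero_mul]
      intro h'
      exact hb (Fin.ext h')
    · simp
  · apply Finset.sum_eq_zero
    intro i _
    rw [if_neg, zero_mul]
    intro h'
    exact h (h' ▸ i.2)

lemma weight_add_one {n : ℕ} {i k : Fin (n + 1)} (h : (i : ℕ) = k + 1) :
    weight n i = weight n k + 1 := by
  rw [weight, weight, h]; push_cast; ring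

lemma isState_weight (n : ℕ) (k : Fin (n + 1)) : IsState ((n : ℝ) / 2) (weight n k) :=
  ⟨⟨k, by rw [weight]; ring⟩, ⟨n - k, by
    rw [weight, Nat.cast_sub (Nat.lt_succ_iff.1 k.2)]; ring⟩⟩

lemma Jm_mul_sum {n : ℕ} (k : Fin (n + 1)) (g : Fin (n + 1) → ℝ) :
    ∑ i, Jm q n k i * g i =
      √(qnum q ((n : ℝ) / 2 + weight n k + 1) * qnum q ((n : ℝ) / 2 - weight n k)) *
        extendZero g (k + 1) := by
  have : ∀ i, Jm q n k i * g i = (if (i : ℕ) = k + 1 then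
      √(qnum q ((n : ℝ) / 2 + weight n k + 1) * qnum q ((n : ℝ) / 2 - weight n k)) else 0) *
        g i := by
    intro i
    rw [Jm, Matrix.of_apply]
    by_cases h : (i : ℕ) = k + 1
    · rw [if_pos h, if_pos h.symm, weight_add_one h]
      congr 4 <;> ring
    · rw [if_neg h, if_neg fun h' => h h'.symm]
  simp only [this]
  rw [sum_ite_val_eq]
  unfold extendZero
  split_ifs <;> simp

/-- At k = 0 the truncated `k - 1` names the wrong coordinate, which is harmless because the root
contains [j + m] = 0. -/
lemma Jp_mul_sum {n : ℕ} (k : Fin (n + 1)) (g : Fin (n + 1) → ℝ) :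
    ∑ i, Jp q n k i * g i =
      √(qnum q ((n : ℝ) / 2 - weight n k + 1) * qnum q ((n : ℝ) / 2 + weight n k)) *
        extendZero g (k - 1) := by
  rcases Nat.eq_zero_or_pos (k : ℕ) with h0 | h0
  · have hk : (n : ℝ) / 2 + weight n k = 0 := by rw [weight, h0]; simp
    rw [hk, qnum_zero, mul_zero, Real.sqrt_zero, zero_mul]
    apply Finset.sum_eq_zero
    intro i _
    rw [Jp, Matrix.of_apply, if_neg (by omega), zero_mul]
  have : ∀ i, Jp q n k i * g i = (if (i : ℕ) = k - 1 then
      √(qnum q ((n : ℝ) / 2 - weight n k + 1) * qnum q ((n : ℝ) / 2 + weight n k)) else 0) *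
        g i := by
    intro i
    rw [Jp, Matrix.of_apply]
    by_cases h : (k : ℕ) = i + 1
    · rw [if_pos h, if_pos (by omega), weight_add_one h]
      congr 4 <;> ring
    · rw [if_neg h, if_neg (by omega)]
  simp only [this]
  rw [sum_ite_val_eq]
  unfold extendZero
  split_ifs <;> simp

lemma transpose_Jp (q : ℝ) (n : ℕ) : (Jp q n).transpose = Jm q n := by
  ext i k
  rw [Matrix.transpose_apply, Jp, Jm, Matrix.of_apply, Matrix.of_apply]
  by_cases h : (k : ℕ) = i + 1
  · rw [if_pos h, if_pos h.symm, weight_add_one h]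
    rw [mul_comm]
    congr 3 <;> ring
  · rw [if_neg h, if_neg fun h' => h h'.symm]

lemma transpose_Jm (q : ℝ) (n : ℕ) : (Jm q n).transpose = Jp q n := by
  rw [← transpose_Jp, Matrix.transpose_transpose]

lemma Jp_apply_eq_zero {n : ℕ} {i k : Fin (n + 1)} (h : weight n i ≠ weight n k + 1) :
    Jp q n i k = 0 := by
  rw [Jp, Matrix.of_apply, if_neg fun h' => h (weight_add_one h')]

lemma Jm_apply_eq_zero {n : ℕ} {i k : Fin (n + 1)} (h : weight n k ≠ weight n i + 1) :
    Jm q n i k = 0 := by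
  rw [Jm, Matrix.of_apply, if_neg fun h' => h (weight_add_one h'.symm)]

lemma qJ0_mul_Jp (hq : 0 < q) (s : ℝ) (n : ℕ) :
    qJ0 q s n * Jp q n = q ^ s • (Jp q n * qJ0 q s n) := by
  ext i k
  rw [Matrix.smul_apply, qJ0, Matrix.diagonal_mul, Matrix.mul_diagonal, smul_eq_mul]
  by_cases h : weight n i = weight n k + 1
  · rw [h, mul_add, mul_one, Real.rpow_add hq]; ring
  · rw [Jp_apply_eq_zero h]; ring

lemma Jm_mul_qJ0 (hq : 0 < q) (s : ℝ) (n : ℕ) :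
    Jm q n * qJ0 q s n = q ^ s • (qJ0 q s n * Jm q n) := by
  ext i k
  rw [Matrix.smul_apply, qJ0, Matrix.diagonal_mul, Matrix.mul_diagonal, smul_eq_mul]
  by_cases h : weight n k = weight n i + 1
  · rw [h, mul_add, mul_one, Real.rpow_add hq]; ring
  · rw [Jm_apply_eq_zero h]; ring

lemma Jp_mul_Jm (hq : 0 < q) (n : ℕ) : Jp q n * Jm q n = Matrix.diagonal fun k =>
    qnum q ((n : ℝ) / 2 + weight n k) * qnum q ((n : ℝ) / 2 - weight n k + 1) := by
  ext i k
  rw [Matrix.mul_apply, Jp_mul_sum]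
  have hs := isState_weight n i
  have p1 := hs.1.nonneg
  have p2 := hs.2.nonneg
  rcases Nat.eq_zero_or_pos (i : ℕ) with h0 | h0
  · have hk : (n : ℝ) / 2 + weight n i = 0 := by rw [weight, h0]; simp
    rw [hk, qnum_zero, mul_zero, Real.sqrt_zero, zero_mul]
    by_cases h : i = k
    · subst h
      rw [Matrix.diagonal_apply_eq, hk, qnum_zero, zero_mul]
    · rw [Matrix.diagonal_apply_ne _ h]
  · have hlt : (i : ℕ) - 1 < n + 1 := by omega
    rw [extendZero, dif_pos hlt, Jm, Matrix.of_apply]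
    by_cases h : i = k
    · subst h
      rw [if_pos (by simp; omega), Matrix.diagonal_apply_eq, mul_comm (qnum q _),
        Real.mul_self_sqrt]
      have := qnum_nonneg hq p1
      have := qnum_nonneg hq (by linarith : 0 ≤ (n : ℝ) / 2 - weight n i + 1)
      positivity
    · rw [if_neg, Matrix.diagonal_apply_ne _ h, mul_zero]
      intro h'
      apply h
      ext
      simp at h'
      omega

lemma Jm_mul_Jp (hq : 0 < q) (n : ℕ) : Jm q n * Jp q n = Matrix.diagonal fun k =>
    qnum q ((n : ℝ) / 2 - weight n k) * qnum q ((n : ℝ) / 2 + weight n k + 1) := by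
  ext i k
  rw [Matrix.mul_apply, Jm_mul_sum]
  have hs := isState_weight n i
  have p1 := hs.1.nonneg
  have p2 := hs.2.nonneg
  by_cases h0 : (i : ℕ) + 1 < n + 1
  · rw [extendZero, dif_pos h0, Jp, Matrix.of_apply]
    by_cases h : i = k
    · subst h
      rw [if_pos rfl, Matrix.diagonal_apply_eq, mul_comm (qnum q ((n : ℝ) / 2 + weight n i + 1)),
        Real.mul_self_sqrt]
      have := qnum_nonneg hq p2
      have := qnum_nonneg hq (by linarith : 0 ≤ (n : ℝ) / 2 + weight n i + 1)
      positivity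
    · rw [if_neg, Matrix.diagonal_apply_ne _ h, mul_zero]
      intro h'
      apply h
      ext
      simp at h'
      omega
  · have hk : (n : ℝ) / 2 - weight n i = 0 := by
      have : (i : ℕ) = n := by omega
      rw [weight, this]; ring
    rw [hk, qnum_zero, mul_zero, Real.sqrt_zero, zero_mul]
    by_cases h : i = k
    · subst h
      rw [Matrix.diagonal_apply_eq, hk, qnum_zero, zero_mul]
    · rw [Matrix.diagonal_apply_ne _ h]

/-- The difference [j + m][j - m + 1] - [j - m][j + m + 1] factors as [2m][1]. -/
lemma Jp_mul_Jm_sub (hq : 0 < q) (n : ℕ) :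
    Jp q n * Jm q n - Jm q n * Jp q n = Matrix.diagonal fun k => qnum q (2 * weight n k) := by
  rw [Jp_mul_Jm hq, Jm_mul_Jp hq, Matrix.diagonal_sub]
  congr 1
  ext k
  rw [qnum_mul_sub_mul hq (by ring), show (n : ℝ) / 2 + weight n k - ((n : ℝ) / 2 - weight n k) =
    2 * weight n k by ring, show (n : ℝ) / 2 + weight n k + 1 - ((n : ℝ) / 2 + weight n k) = 1 by
    ring, qnum_one hq, mul_one]

/-! ### The generators in a tensor product -/

/-- The coproduct of `J₊`. -/
noncomputable def coprodJp (q : ℝ) (n₁ n₂ : ℕ) :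
    Matrix (Fin (n₁ + 1) × Fin (n₂ + 1)) (Fin (n₁ + 1) × Fin (n₂ + 1)) ℝ :=
  Jp q n₁ ⊗ₖ qJ0 q 1 n₂ + qJ0 q (-1) n₁ ⊗ₖ Jp q n₂

/-- The coproduct of `J₋`. -/
noncomputable def coprodJm (q : ℝ) (n₁ n₂ : ℕ) :
    Matrix (Fin (n₁ + 1) × Fin (n₂ + 1)) (Fin (n₁ + 1) × Fin (n₂ + 1)) ℝ :=
  Jm q n₁ ⊗ₖ qJ0 q 1 n₂ + qJ0 q (-1) n₁ ⊗ₖ Jm q n₂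

/-- The total weight of a basis vector of the tensor product. -/
noncomputable def weight₂ {n₁ n₂ : ℕ} (x : Fin (n₁ + 1) × Fin (n₂ + 1)) : ℝ :=
  weight n₁ x.1 + weight n₂ x.2

lemma coprod_J0 (n₁ n₂ : ℕ) :
    J0 n₁ ⊗ₖ (1 : Matrix (Fin (n₂ + 1)) (Fin (n₂ + 1)) ℝ) +
      (1 : Matrix (Fin (n₁ + 1)) (Fin (n₁ + 1)) ℝ) ⊗ₖ J0 n₂ = Matrix.diagonal weight₂ := by
  rw [J0, J0, ← Matrix.diagonal_one, ← Matrix.diagonal_one, Matrix.diagonal_kronecker_diagonal,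
    Matrix.diagonal_kronecker_diagonal, Matrix.diagonal_add]
  congr 1
  ext x
  simp [weight₂]

lemma transpose_qJ0 (q s : ℝ) (n : ℕ) : (qJ0 q s n).transpose = qJ0 q s n :=
  Matrix.diagonal_transpose _

lemma transpose_coprodJm (q : ℝ) (n₁ n₂ : ℕ) : (coprodJm q n₁ n₂).transpose = coprodJp q n₁ n₂ := by
  rw [coprodJm, coprodJp, Matrix.transpose_add, ← Matrix.kroneckerMap_transpose,
    ← Matrix.kroneckerMap_transpose, transpose_Jm, transpose_Jm, transpose_qJ0, transpose_qJ0]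

lemma kronecker_sub_left {l m n p : Type*} (A B : Matrix l m ℝ) (C : Matrix n p ℝ) :
    (A - B) ⊗ₖ C = A ⊗ₖ C - B ⊗ₖ C := by
  ext i j
  simp [Matrix.kroneckerMap_apply, sub_mul]

lemma kronecker_sub_right {l m n p : Type*} (A : Matrix l m ℝ) (B C : Matrix n p ℝ) :
    A ⊗ₖ (B - C) = A ⊗ₖ B - A ⊗ₖ C := by
  ext i j
  simp [Matrix.kroneckerMap_apply, mul_sub]

/-- The mixed terms agree in both orders, since moving q^(±J₀) past the ladder operators produces
the same factor q⁻¹. What remains is diagonal, and [2m₁]q^(2m₂) + q^(-2m₁)[2m₂] = [2(m₁ + m₂)]. -/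
lemma coprodJp_mul_coprodJm (hq : 0 < q) (n₁ n₂ : ℕ) :
    coprodJp q n₁ n₂ * coprodJm q n₁ n₂ = coprodJm q n₁ n₂ * coprodJp q n₁ n₂ +
      Matrix.diagonal fun x => qnum q (2 * weight₂ x) := by
  have h1 : qJ0 q 1 n₂ * Jm q n₂ = q ^ (-1 : ℝ) • (Jm q n₂ * qJ0 q 1 n₂) := by
    rw [Jm_mul_qJ0 hq, smul_smul, ← Real.rpow_add hq, neg_add_cancel, Real.rpow_zero, one_smul]
  have h2 : Jm q n₁ * qJ0 q (-1) n₁ = q ^ (-1 : ℝ) • (qJ0 q (-1) n₁ * Jm q n₁) :=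
    Jm_mul_qJ0 hq _ _
  have h3 : qJ0 q (-1) n₁ * Jp q n₁ = q ^ (-1 : ℝ) • (Jp q n₁ * qJ0 q (-1) n₁) :=
    qJ0_mul_Jp hq _ _
  have h4 : Jp q n₂ * qJ0 q 1 n₂ = q ^ (-1 : ℝ) • (qJ0 q 1 n₂ * Jp q n₂) := by
    rw [qJ0_mul_Jp hq, smul_smul, ← Real.rpow_add hq, neg_add_cancel, Real.rpow_zero, one_smul]
  have hd : (Jp q n₁ * Jm q n₁ - Jm q n₁ * Jp q n₁) ⊗ₖ (qJ0 q 1 n₂ * qJ0 q 1 n₂) +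
      (qJ0 q (-1) n₁ * qJ0 q (-1) n₁) ⊗ₖ (Jp q n₂ * Jm q n₂ - Jm q n₂ * Jp q n₂) =
      Matrix.diagonal fun x => qnum q (2 * weight₂ x) := by
    rw [Jp_mul_Jm_sub hq, Jp_mul_Jm_sub hq, qJ0, qJ0, Matrix.diagonal_mul_diagonal,
      Matrix.diagonal_mul_diagonal, Matrix.diagonal_kronecker_diagonal,
      Matrix.diagonal_kronecker_diagonal, Matrix.diagonal_add]
    congr 1
    ext x
    rw [weight₂, mul_add, qnum_add hq, ← Real.rpow_add hq, ← Real.rpow_add hq]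
    ring_nf
  rw [← hd, coprodJp, coprodJm, kronecker_sub_left, kronecker_sub_right]
  simp only [Matrix.add_mul, Matrix.mul_add, ← Matrix.mul_kronecker_mul]
  rw [h1, h2, h3, h4]
  simp only [Matrix.kronecker_smul, Matrix.smul_kronecker]
  abel

lemma kronecker_mulVec_apply {n₁ n₂ : ℕ} (A : Matrix (Fin (n₁ + 1)) (Fin (n₁ + 1)) ℝ)
    (B : Matrix (Fin (n₂ + 1)) (Fin (n₂ + 1)) ℝ)
    (v : Fin (n₁ + 1) × Fin (n₂ + 1) → ℝ) (k₁ : Fin (n₁ + 1)) (k₂ : Fin (n₂ + 1)) :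
    ((A ⊗ₖ B).mulVec v) (k₁, k₂) = ∑ i₁, A k₁ i₁ * ∑ i₂, B k₂ i₂ * v (i₁, i₂) := by
  rw [Matrix.mulVec, dotProduct, Fintype.sum_prod_type]
  simp only [Matrix.kroneckerMap_apply, Finset.mul_sum, mul_assoc]

lemma qJ0_mul_sum {n : ℕ} (s : ℝ) (k : Fin (n + 1)) (g : Fin (n + 1) → ℝ) :
    ∑ i, qJ0 q s n k i * g i = q ^ (s * weight n k) * g k := by
  rw [qJ0]
  exact Matrix.mulVec_diagonal (fun k => q ^ (s * weight n k)) g k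

lemma extendZero_mul {n : ℕ} (c : ℝ) (g : Fin (n + 1) → ℝ) (k : ℕ) :
    extendZero (fun i => c * g i) k = c * extendZero g k := by
  unfold extendZero; split_ifs <;> simp

lemma coprodJm_mulVec {n₁ n₂ : ℕ} (v : Fin (n₁ + 1) × Fin (n₂ + 1) → ℝ) (k₁ : Fin (n₁ + 1))
    (k₂ : Fin (n₂ + 1)) :
    (coprodJm q n₁ n₂).mulVec v (k₁, k₂) =
      √(qnum q ((n₁ : ℝ) / 2 + weight n₁ k₁ + 1) * qnum q ((n₁ : ℝ) / 2 - weight n₁ k₁)) *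
        q ^ weight n₂ k₂ * extendZero (fun i => v (i, k₂)) (k₁ + 1) +
      q ^ (-weight n₁ k₁) *
        √(qnum q ((n₂ : ℝ) / 2 + weight n₂ k₂ + 1) * qnum q ((n₂ : ℝ) / 2 - weight n₂ k₂)) *
        extendZero (fun i => v (k₁, i)) (k₂ + 1) := by
  rw [coprodJm, Matrix.add_mulVec, Pi.add_apply, kronecker_mulVec_apply, kronecker_mulVec_apply]
  simp only [qJ0_mul_sum, Jm_mul_sum, extendZero_mul, one_mul, neg_mul]
  ring

lemma coprodJp_mulVec {n₁ n₂ : ℕ} (v : Fin (n₁ + 1) × Fin (n₂ + 1) → ℝ) (k₁ : Fin (n₁ + 1))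
    (k₂ : Fin (n₂ + 1)) :
    (coprodJp q n₁ n₂).mulVec v (k₁, k₂) =
      √(qnum q ((n₁ : ℝ) / 2 - weight n₁ k₁ + 1) * qnum q ((n₁ : ℝ) / 2 + weight n₁ k₁)) *
        q ^ weight n₂ k₂ * extendZero (fun i => v (i, k₂)) (k₁ - 1) +
      q ^ (-weight n₁ k₁) *
        √(qnum q ((n₂ : ℝ) / 2 - weight n₂ k₂ + 1) * qnum q ((n₂ : ℝ) / 2 + weight n₂ k₂)) *
        extendZero (fun i => v (k₁, i)) (k₂ - 1) := by
  rw [coprodJp, Matrix.add_mulVec, Pi.add_apply, kronecker_mulVec_apply, kronecker_mulVec_apply]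
  simp only [qJ0_mul_sum, Jp_mul_sum, extendZero_mul, one_mul, neg_mul]
  ring

lemma sum_mul_Jm {n : ℕ} (k : Fin (n + 1)) (g : Fin (n + 1) → ℝ) :
    ∑ i, g i * Jm q n i k =
      √(qnum q ((n : ℝ) / 2 - weight n k + 1) * qnum q ((n : ℝ) / 2 + weight n k)) *
        extendZero g (k - 1) := by
  rw [← Jp_mul_sum, ← transpose_Jp]
  simp only [Matrix.transpose_apply, mul_comm]

lemma sum_mul_Jp {n : ℕ} (k : Fin (n + 1)) (g : Fin (n + 1) → ℝ) :
    ∑ i, g i * Jp q n i k =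
      √(qnum q ((n : ℝ) / 2 + weight n k + 1) * qnum q ((n : ℝ) / 2 - weight n k)) *
        extendZero g (k + 1) := by
  rw [← Jm_mul_sum, ← transpose_Jm]
  simp only [Matrix.transpose_apply, mul_comm]

/-! ### Ladder operators on the candidate weight vectors, and the norm of the highest one -/

/-- The vector of weight `m` with the coordinates `cgPhi`. -/
noncomputable def cgVec (q : ℝ) (n₁ n₂ n : ℕ) (m : ℝ) (x : Fin (n₁ + 1) × Fin (n₂ + 1)) : ℝ :=
  if weight₂ x = m then
    cgPhi q ((n₁ : ℝ) / 2) (weight n₁ x.1) ((n₂ : ℝ) / 2) (weight n₂ x.2) ((n : ℝ) / 2)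
  else 0

section

variable {n₁ n₂ n : ℕ} {m : ℝ}

lemma extendZero_eq_of_lt {n : ℕ} (g : Fin (n + 1) → ℝ) {k : ℕ} (h : k < n + 1) :
    extendZero g k = g ⟨k, h⟩ := dif_pos h

lemma cgVec_pred_left {k₁ : Fin (n₁ + 1)} (k₂ : Fin (n₂ + 1)) (h : 0 < (k₁ : ℕ)) :
    extendZero (fun i => cgVec q n₁ n₂ n m (i, k₂)) (k₁ - 1) =
      if weight₂ (k₁, k₂) = m + 1 then
        cgPhi q ((n₁ : ℝ) / 2) (weight n₁ k₁ - 1) ((n₂ : ℝ) / 2) (weight n₂ k₂) ((n : ℝ) / 2)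
      else 0 := by
  have hk : (k₁ : ℕ) - 1 < n₁ + 1 := by omega
  have hw : weight n₁ ⟨k₁ - 1, hk⟩ = weight n₁ k₁ - 1 := by
    rw [weight_add_one (i := k₁) (k := ⟨k₁ - 1, hk⟩) (by simp; omega)]; ring
  rw [extendZero_eq_of_lt _ hk, cgVec, weight₂, weight₂]
  dsimp only
  rw [hw]
  refine if_congr ?_ rfl rfl
  constructor <;> intro h <;> linarith

lemma cgVec_pred_right (k₁ : Fin (n₁ + 1)) {k₂ : Fin (n₂ + 1)} (h : 0 < (k₂ : ℕ)) :
    extendZero (fun i => cgVec q n₁ n₂ n m (k₁, i)) (k₂ - 1) =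
      if weight₂ (k₁, k₂) = m + 1 then
        cgPhi q ((n₁ : ℝ) / 2) (weight n₁ k₁) ((n₂ : ℝ) / 2) (weight n₂ k₂ - 1) ((n : ℝ) / 2)
      else 0 := by
  have hk : (k₂ : ℕ) - 1 < n₂ + 1 := by omega
  have hw : weight n₂ ⟨k₂ - 1, hk⟩ = weight n₂ k₂ - 1 := by
    rw [weight_add_one (i := k₂) (k := ⟨k₂ - 1, hk⟩) (by simp; omega)]; ring
  rw [extendZero_eq_of_lt _ hk, cgVec, weight₂, weight₂]
  dsimp only
  rw [hw]
  refine if_congr ?_ rfl rfl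
  constructor <;> intro h <;> linarith

lemma cgVec_succ_left {k₁ : Fin (n₁ + 1)} (k₂ : Fin (n₂ + 1)) (h : (k₁ : ℕ) + 1 < n₁ + 1) :
    extendZero (fun i => cgVec q n₁ n₂ n m (i, k₂)) (k₁ + 1) =
      if weight₂ (k₁, k₂) = m - 1 then
        cgPhi q ((n₁ : ℝ) / 2) (weight n₁ k₁ + 1) ((n₂ : ℝ) / 2) (weight n₂ k₂) ((n : ℝ) / 2)
      else 0 := by
  have hw : weight n₁ ⟨k₁ + 1, h⟩ = weight n₁ k₁ + 1 := weight_add_one rfl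
  rw [extendZero_eq_of_lt _ h, cgVec, weight₂, weight₂]
  dsimp only
  rw [hw]
  refine if_congr ?_ rfl rfl
  constructor <;> intro h <;> linarith

lemma cgVec_succ_right (k₁ : Fin (n₁ + 1)) {k₂ : Fin (n₂ + 1)} (h : (k₂ : ℕ) + 1 < n₂ + 1) :
    extendZero (fun i => cgVec q n₁ n₂ n m (k₁, i)) (k₂ + 1) =
      if weight₂ (k₁, k₂) = m - 1 then
        cgPhi q ((n₁ : ℝ) / 2) (weight n₁ k₁) ((n₂ : ℝ) / 2) (weight n₂ k₂ + 1) ((n : ℝ) / 2)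
      else 0 := by
  have hw : weight n₂ ⟨k₂ + 1, h⟩ = weight n₂ k₂ + 1 := weight_add_one rfl
  rw [extendZero_eq_of_lt _ h, cgVec, weight₂, weight₂]
  dsimp only
  rw [hw]
  refine if_congr ?_ rfl rfl
  constructor <;> intro h <;> linarith

lemma half_add_weight (k : Fin (n + 1)) : (n : ℝ) / 2 + weight n k = (k : ℕ) := by
  rw [weight]; ring

lemma half_sub_weight (k : Fin (n + 1)) : (n : ℝ) / 2 - weight n k = (n : ℝ) - (k : ℕ) := by
  rw [weight]; ring

/-- The triangle conditions on the spins `n₁ / 2`, `n₂ / 2`, `n / 2`. -/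
structure Coupled (n₁ n₂ n : ℕ) : Prop where
  tri : IsNat ((n₁ : ℝ) / 2 + (n₂ : ℝ) / 2 - (n : ℝ) / 2)
  tri₁ : IsNat ((n₁ : ℝ) / 2 + (n : ℝ) / 2 - (n₂ : ℝ) / 2)
  tri₂ : IsNat ((n₂ : ℝ) / 2 - (n₁ : ℝ) / 2 + (n : ℝ) / 2)

lemma isState_of_pos {k : Fin (n + 1)} (h : 0 < (k : ℕ)) :
    IsState ((n : ℝ) / 2) (weight n k - 1) := by
  refine ⟨⟨k - 1, ?_⟩, ?_⟩
  · rw [← add_sub_assoc, half_add_weight, Nat.cast_sub h, Nat.cast_one]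
  · have h1 : IsNat (1 : ℝ) := ⟨1, by simp⟩
    have := (isState_weight n k).2.add h1
    convert this using 1; ring

/-- Only coordinates of total weight j + 1 can be hit. There the triangle conditions force m₁ > -j₁
and m₂ > -j₂, so both predecessors exist and `cgPhi_raising` applies. -/
lemma coprodJp_mulVec_cgVec (hq : 0 < q) (hc : Coupled n₁ n₂ n) :
    (coprodJp q n₁ n₂).mulVec (cgVec q n₁ n₂ n ((n : ℝ) / 2)) = 0 := by
  ext ⟨k₁, k₂⟩
  rw [coprodJp_mulVec, Pi.zero_apply]
  by_cases hw : weight₂ (k₁, k₂) = (n : ℝ) / 2 + 1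
  · have hw' := hw
    rw [weight₂] at hw'
    dsimp only at hw'
    have b1 := (isState_weight n₁ k₁).2.nonneg
    have b2 := (isState_weight n₂ k₂).2.nonneg
    have c1 := hc.tri₁.nonneg
    have c2 := hc.tri₂.nonneg
    have p1 : 0 < (k₁ : ℕ) := by
      have := half_add_weight k₁
      have : (0 : ℝ) < (k₁ : ℕ) := by linarith
      exact_mod_cast this
    have p2 : 0 < (k₂ : ℕ) := by
      have := half_add_weight k₂
      have : (0 : ℝ) < (k₂ : ℕ) := by linarith
      exact_mod_cast this
    rw [cgVec_pred_left k₂ p1, cgVec_pred_right k₁ p2, if_pos hw, if_pos hw]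
    exact cgPhi_raising hq (isState_of_pos p1) (isState_weight n₁ k₁) (isState_of_pos p2)
      (isState_weight n₂ k₂) hc.tri₁ hw'
  · have e1 : √(qnum q ((n₁ : ℝ) / 2 - weight n₁ k₁ + 1) * qnum q ((n₁ : ℝ) / 2 + weight n₁ k₁)) *
        q ^ weight n₂ k₂ *
          extendZero (fun i => cgVec q n₁ n₂ n ((n : ℝ) / 2) (i, k₂)) (k₁ - 1) = 0 := by
      rcases Nat.eq_zero_or_pos (k₁ : ℕ) with h | h
      · simp [half_add_weight, h]
      · rw [cgVec_pred_left k₂ h, if_neg hw, mul_zero]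
    have e2 : q ^ (-weight n₁ k₁) *
        √(qnum q ((n₂ : ℝ) / 2 - weight n₂ k₂ + 1) * qnum q ((n₂ : ℝ) / 2 + weight n₂ k₂)) *
          extendZero (fun i => cgVec q n₁ n₂ n ((n : ℝ) / 2) (k₁, i)) (k₂ - 1) = 0 := by
      rcases Nat.eq_zero_or_pos (k₂ : ℕ) with h | h
      · simp [half_add_weight, h]
      · rw [cgVec_pred_right k₁ h, if_neg hw, mul_zero]
    rw [e1, e2, add_zero]

/-- The matrix form of `cgPhi_lowering`. A missing upper neighbour is harmless because its root
coefficient vanishes. The lowest weight m = -j is not covered; `coprodJm_mulVec_cgVec_lowest` treats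
it by a norm argument. -/
lemma coprodJm_mulVec_cgVec (hq : 0 < q) (hm : IsNat ((n : ℝ) / 2 + m - 1))
    (hm' : IsNat ((n : ℝ) / 2 - m)) :
    (coprodJm q n₁ n₂).mulVec (cgVec q n₁ n₂ n m) =
      √(qnum q ((n : ℝ) / 2 + m) * qnum q ((n : ℝ) / 2 - m + 1)) • cgVec q n₁ n₂ n (m - 1) := by
  ext ⟨k₁, k₂⟩
  rw [coprodJm_mulVec, Pi.smul_apply, smul_eq_mul]
  have out1 : ¬ ((k₁ : ℕ) + 1 < n₁ + 1) →
      √(qnum q ((n₁ : ℝ) / 2 + weight n₁ k₁ + 1) * qnum q ((n₁ : ℝ) / 2 - weight n₁ k₁)) = 0 := by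
    intro h
    have : (k₁ : ℕ) = n₁ := by omega
    simp [half_sub_weight, this]
  have out2 : ¬ ((k₂ : ℕ) + 1 < n₂ + 1) →
      √(qnum q ((n₂ : ℝ) / 2 + weight n₂ k₂ + 1) * qnum q ((n₂ : ℝ) / 2 - weight n₂ k₂)) = 0 := by
    intro h
    have : (k₂ : ℕ) = n₂ := by omega
    simp [half_sub_weight, this]
  by_cases hw : weight₂ (k₁, k₂) = m - 1
  · have hw' := hw
    rw [weight₂] at hw'
    dsimp only at hw'
    have e1 : √(qnum q ((n₁ : ℝ) / 2 + weight n₁ k₁ + 1) * qnum q ((n₁ : ℝ) / 2 - weight n₁ k₁)) *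
        q ^ weight n₂ k₂ * extendZero (fun i => cgVec q n₁ n₂ n m (i, k₂)) (k₁ + 1) =
        √(qnum q ((n₁ : ℝ) / 2 + weight n₁ k₁ + 1) * qnum q ((n₁ : ℝ) / 2 - weight n₁ k₁)) *
        q ^ weight n₂ k₂ *
        cgPhi q ((n₁ : ℝ) / 2) (weight n₁ k₁ + 1) ((n₂ : ℝ) / 2) (weight n₂ k₂) ((n : ℝ) / 2) := by
      by_cases h : (k₁ : ℕ) + 1 < n₁ + 1
      · rw [cgVec_succ_left k₂ h, if_pos hw]
      · rw [out1 h]; ring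
    have e2 : q ^ (-weight n₁ k₁) *
        √(qnum q ((n₂ : ℝ) / 2 + weight n₂ k₂ + 1) * qnum q ((n₂ : ℝ) / 2 - weight n₂ k₂)) *
        extendZero (fun i => cgVec q n₁ n₂ n m (k₁, i)) (k₂ + 1) =
        q ^ (-weight n₁ k₁) *
        √(qnum q ((n₂ : ℝ) / 2 + weight n₂ k₂ + 1) * qnum q ((n₂ : ℝ) / 2 - weight n₂ k₂)) *
        cgPhi q ((n₁ : ℝ) / 2) (weight n₁ k₁) ((n₂ : ℝ) / 2) (weight n₂ k₂ + 1) ((n : ℝ) / 2) := by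
      by_cases h : (k₂ : ℕ) + 1 < n₂ + 1
      · rw [cgVec_succ_right k₁ h, if_pos hw]
      · rw [out2 h]; ring
    rw [e1, e2, ← cgPhi_lowering hq (isState_weight n₁ k₁) (isState_weight n₂ k₂), cgVec,
      if_pos hw, hw']
    · rw [show (n : ℝ) / 2 + (m - 1) + 1 = n / 2 + m by ring,
        show (n : ℝ) / 2 - (m - 1) = n / 2 - m + 1 by ring]
    · rw [hw']
      convert hm using 1; ring
    · rw [hw']
      convert hm' using 1; ring
  · rw [cgVec, if_neg hw, mul_zero]
    have e1 : √(qnum q ((n₁ : ℝ) / 2 + weight n₁ k₁ + 1) * qnum q ((n₁ : ℝ) / 2 - weight n₁ k₁)) *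
        q ^ weight n₂ k₂ * extendZero (fun i => cgVec q n₁ n₂ n m (i, k₂)) (k₁ + 1) = 0 := by
      by_cases h : (k₁ : ℕ) + 1 < n₁ + 1
      · rw [cgVec_succ_left k₂ h, if_neg hw, mul_zero]
      · rw [out1 h]; ring
    have e2 : q ^ (-weight n₁ k₁) *
        √(qnum q ((n₂ : ℝ) / 2 + weight n₂ k₂ + 1) * qnum q ((n₂ : ℝ) / 2 - weight n₂ k₂)) *
        extendZero (fun i => cgVec q n₁ n₂ n m (k₁, i)) (k₂ + 1) = 0 := by
      by_cases h : (k₂ : ℕ) + 1 < n₂ + 1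
      · rw [cgVec_succ_right k₁ h, if_neg hw, mul_zero]
      · rw [out2 h]; ring
    rw [e1, e2, add_zero]

/-- The highest weight vector is normalized. -/
lemma cgVec_highest_norm (hq : 0 < q) (hc : Coupled n₁ n₂ n) :
    cgVec q n₁ n₂ n ((n : ℝ) / 2) ⬝ᵥ cgVec q n₁ n₂ n ((n : ℝ) / 2) = 1 := by
  obtain ⟨g, hg⟩ := hc.tri
  obtain ⟨y, hy⟩ := hc.tri₁
  obtain ⟨x, hx⟩ := hc.tri₂
  have hn₁ : n₁ = g + y := by
    have : (n₁ : ℝ) = g + y := by linarith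
    exact_mod_cast this
  have hn₂ : n₂ = g + x := by
    have : (n₂ : ℝ) = g + x := by linarith
    exact_mod_cast this
  have hn : n = x + y := by
    have : (n : ℝ) = x + y := by linarith
    exact_mod_cast this
  have key := sum_qVandermonde hq g (isNat_natCast x) (isNat_natCast y)
  -- The basis vectors of weight j are listed by i = j₁ - m₁, running from 0 to g = j₁ + j₂ - j.
  set e : ℕ → Fin (n₁ + 1) × Fin (n₂ + 1) := fun i =>
    (Fin.ofNat _ (n₁ - i), Fin.ofNat _ (x + i)) with he
  have he1 : ∀ i ∈ Finset.range (g + 1), ((e i).1 : ℕ) = n₁ - i := fun i hi => by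
    simp [he, Nat.mod_eq_of_lt (show n₁ - i < n₁ + 1 by omega)]
  have he2 : ∀ i ∈ Finset.range (g + 1), ((e i).2 : ℕ) = x + i := fun i hi => by
    have := Finset.mem_range.1 hi
    simp [he, Nat.mod_eq_of_lt (show x + i < n₂ + 1 by omega)]
  -- The factor in front is the reciprocal of the right-hand side of the q-Vandermonde sum.
  have hterm : ∀ i ∈ Finset.range (g + 1),
      qfact q g * qfact q ((x : ℝ) + y + 1) / (qfact q x * qfact q y * qfact q ((x : ℝ) + y + g + 1)) *
        q ^ ((g : ℝ) * (x + 1)) * (q ^ (-(i : ℝ) * (x + y + 2)) *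
      (qfact q ((y : ℝ) + g - i) * qfact q ((x : ℝ) + i) / (qfact q i * qfact q ((g : ℝ) - i)))) =
      cgVec q n₁ n₂ n ((n : ℝ) / 2) (e i) * cgVec q n₁ n₂ n ((n : ℝ) / 2) (e i) := by
    intro i hi
    have hi' : i ≤ g := Nat.lt_succ_iff.1 (Finset.mem_range.1 hi)
    have f1 : weight n₁ (e i).1 = (n₁ : ℝ) / 2 - i := by
      rw [weight, he1 i hi, Nat.cast_sub (by omega)]; ring
    have f2 : weight n₂ (e i).2 = (x : ℝ) + i - (n₂ : ℝ) / 2 := by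
      rw [weight, he2 i hi]; push_cast; ring
    have hw : weight n₁ (e i).1 + weight n₂ (e i).2 = (n : ℝ) / 2 := by
      rw [f1, f2]; linarith
    rw [cgVec, weight₂, if_pos hw, ← pow_two, cgPhi_highest_sq hq (isState_weight _ _)
      (isState_weight _ _) hc.tri hc.tri₁ hc.tri₂ hw, hg, hx, hy, f1, f2]
    congr 1
    · congr 1
      · congr 2
        · congr 1; linarith
        · congr 1; linarith
    · congr 1
      · congr 1
        rw [show (n₁ : ℝ) / 2 - (n₁ / 2 - i) = i by ring]
        congr 1; linarith
      · congr 2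
        · congr 1; linarith
        · congr 1; linarith
        · congr 1; linarith
        · congr 1; linarith
  have r1 := (qfact_pos hq (isNat_natCast g)).ne'
  have r2 := (qfact_pos hq (isNat_natCast x)).ne'
  have r3 := (qfact_pos hq (isNat_natCast y)).ne'
  have r4 := (qfact_pos hq (x := (x : ℝ) + y + 1) ⟨x + y + 1, by push_cast; ring⟩).ne'
  have r5 := (qfact_pos hq (x := (x : ℝ) + y + g + 1) ⟨x + y + g + 1, by push_cast; ring⟩).ne'
  have hpow : q ^ ((g : ℝ) * (x + 1)) * q ^ (-((g : ℝ) * (x + 1))) = 1 := by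
    rw [← Real.rpow_add hq, add_neg_cancel, Real.rpow_zero]
  rw [dotProduct, ← Finset.sum_of_injOn e _ _ _ hterm, ← Finset.mul_sum, key]
  · field_simp
    linear_combination hpow
  · intro i hi k hk hik
    have h1 := he2 i hi
    rw [hik, he2 k hk] at h1
    omega
  · intro i _
    simp
  · rintro ⟨k₁, k₂⟩ - hk
    rw [cgVec, if_neg, mul_zero]
    intro hw
    apply hk
    rw [weight₂, weight, weight] at hw
    dsimp only at hw
    have b1 := Nat.lt_succ_iff.1 k₁.2
    have b2 := Nat.lt_succ_iff.1 k₂.2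
    have hsum : ((k₁ : ℕ) : ℝ) + (k₂ : ℕ) = x + y + g := by linarith
    have hsum' : (k₁ : ℕ) + (k₂ : ℕ) = x + y + g := by exact_mod_cast hsum
    refine ⟨n₁ - k₁, ?_, ?_⟩
    · simp only [Finset.coe_range, Set.mem_Iio]
      omega
    · have hr : n₁ - (k₁ : ℕ) ∈ Finset.range (g + 1) := by
        rw [Finset.mem_range]; omega
      ext
      · rw [he1 _ hr]; dsimp only; omega
      · rw [he2 _ hr]; dsimp only; omega

end

/-! ### Descent from the highest weight by the commutation relation -/

section

variable {n₁ n₂ n : ℕ}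

lemma dotProduct_mulVec_coprodJp (v w : Fin (n₁ + 1) × Fin (n₂ + 1) → ℝ) :
    v ⬝ᵥ (coprodJp q n₁ n₂).mulVec w = (coprodJm q n₁ n₂).mulVec v ⬝ᵥ w := by
  rw [Matrix.dotProduct_mulVec, ← transpose_coprodJm, Matrix.vecMul_transpose]

lemma coprodJp_mulVec_coprodJm_mulVec (hq : 0 < q) (m : ℝ) :
    (coprodJp q n₁ n₂).mulVec ((coprodJm q n₁ n₂).mulVec (cgVec q n₁ n₂ n m)) =
      (coprodJm q n₁ n₂).mulVec ((coprodJp q n₁ n₂).mulVec (cgVec q n₁ n₂ n m)) +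
        qnum q (2 * m) • cgVec q n₁ n₂ n m := by
  rw [Matrix.mulVec_mulVec, Matrix.mulVec_mulVec, coprodJp_mul_coprodJm hq, Matrix.add_mulVec]
  congr 1
  ext x
  rw [Matrix.mulVec_diagonal, Pi.smul_apply, smul_eq_mul, cgVec]
  split_ifs with h
  · rw [h]
  · rw [mul_zero, mul_zero]

/-- The square of the factor by which `J₋` lowers the vector of weight `n / 2 - d` is positive. -/
lemma lowering_factor_pos (hq : 0 < q) {d : ℕ} (hd : d < n) :
    0 < qnum q ((n : ℝ) - d) * qnum q ((d : ℝ) + 1) := by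
  have : (d : ℝ) < n := by exact_mod_cast hd
  exact mul_pos (qnum_pos hq (by linarith)) (qnum_pos hq (by positivity))

lemma coprodJm_mulVec_cgVec_sub (hq : 0 < q) {d : ℕ} (hd : d < n) :
    (coprodJm q n₁ n₂).mulVec (cgVec q n₁ n₂ n ((n : ℝ) / 2 - d)) =
      √(qnum q ((n : ℝ) - d) * qnum q ((d : ℝ) + 1)) •
        cgVec q n₁ n₂ n ((n : ℝ) / 2 - (d + 1 : ℕ)) := by
  rw [coprodJm_mulVec_cgVec hq]
  · push_cast
    rw [show (n : ℝ) / 2 + (n / 2 - d) = n - d by ring,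
      show (n : ℝ) / 2 - (n / 2 - d) + 1 = d + 1 by ring, sub_sub]
  · exact ⟨n - (d + 1), by rw [Nat.cast_sub hd]; push_cast; ring⟩
  · exact ⟨d, by ring⟩

/-- Two statements are carried in one induction on the depth d. The eigenvalue of J₋J₊ and the
commutator give J₊J₋ on the d-th vector, and dividing by the known lowering factor gives J₊ on the
next. Applying J₋ to that yields the next eigenvalue. The factors match by [n - d + 1][d] + [n - 2d]
= [n - d][d + 1]. -/
lemma coprodJm_mulVec_coprodJp_mulVec (hq : 0 < q) (hc : Coupled n₁ n₂ n) :
    ∀ d : ℕ, d ≤ n →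
      (coprodJm q n₁ n₂).mulVec ((coprodJp q n₁ n₂).mulVec
        (cgVec q n₁ n₂ n ((n : ℝ) / 2 - d))) =
      (qnum q ((n : ℝ) - d + 1) * qnum q d) • cgVec q n₁ n₂ n ((n : ℝ) / 2 - d) ∧
      (d < n → (coprodJp q n₁ n₂).mulVec (cgVec q n₁ n₂ n ((n : ℝ) / 2 - (d + 1 : ℕ))) =
        √(qnum q ((n : ℝ) - d) * qnum q ((d : ℝ) + 1)) • cgVec q n₁ n₂ n ((n : ℝ) / 2 - d)) := by
  intro d
  induction d with
  | zero =>
    intro _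
    have h0 := coprodJp_mulVec_cgVec hq hc
    refine ⟨by simp [h0], fun hd => ?_⟩
    have hpos := lowering_factor_pos hq hd
    have hr := Real.sqrt_pos.2 hpos
    have := coprodJp_mulVec_coprodJm_mulVec (n₁ := n₁) (n₂ := n₂) (n := n) hq ((n : ℝ) / 2 - (0 : ℕ))
    rw [coprodJm_mulVec_cgVec_sub hq hd, Matrix.mulVec_smul] at this
    apply smul_right_injective _ hr.ne'
    dsimp only
    rw [this, smul_smul, Real.mul_self_sqrt hpos.le]
    simp [h0, qnum_one hq]
    congr 2
    ring
  | succ d ih =>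
    intro hd
    have hd' : d < n := hd
    have hd2 : (d : ℝ) + 1 ≤ n := by exact_mod_cast hd
    have e1 : (coprodJm q n₁ n₂).mulVec ((coprodJp q n₁ n₂).mulVec
        (cgVec q n₁ n₂ n ((n : ℝ) / 2 - (d + 1 : ℕ)))) =
      (qnum q ((n : ℝ) - (d + 1 : ℕ) + 1) * qnum q (d + 1 : ℕ)) •
        cgVec q n₁ n₂ n ((n : ℝ) / 2 - (d + 1 : ℕ)) := by
      rw [(ih hd'.le).2 hd', Matrix.mulVec_smul, coprodJm_mulVec_cgVec_sub hq hd', smul_smul,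
        Real.mul_self_sqrt (lowering_factor_pos hq hd').le]
      push_cast
      congr 3
      ring
    refine ⟨e1, fun hlt => ?_⟩
    have hpos := lowering_factor_pos hq hlt
    have hr := Real.sqrt_pos.2 hpos
    have := coprodJp_mulVec_coprodJm_mulVec (n₁ := n₁) (n₂ := n₂) (n := n) hq
      ((n : ℝ) / 2 - (d + 1 : ℕ))
    rw [coprodJm_mulVec_cgVec_sub hq hlt, Matrix.mulVec_smul, e1, ← add_smul] at this
    apply smul_right_injective _ hr.ne'
    dsimp only
    rw [this, smul_smul, Real.mul_self_sqrt hpos.le]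
    congr 1
    have := qnum_mul_sub_mul hq (x := (n : ℝ) - (d + 1 : ℕ)) (y := (d + 1 : ℕ) + 1)
      (z := (n : ℝ) - (d + 1 : ℕ) + 1) (w := (d + 1 : ℕ)) (by ring)
    rw [show (n : ℝ) - (d + 1 : ℕ) - ((n : ℝ) - (d + 1 : ℕ) + 1) = -1 by ring,
      show ((d + 1 : ℕ) : ℝ) - ((n : ℝ) - (d + 1 : ℕ)) = -(2 * ((n : ℝ) / 2 - (d + 1 : ℕ))) by ring,
      qnum_neg, qnum_neg, qnum_one hq] at this
    linear_combination -this

lemma coprodJp_mulVec_cgVec_sub (hq : 0 < q) (hc : Coupled n₁ n₂ n) {d : ℕ} (hd : d < n) :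
    (coprodJp q n₁ n₂).mulVec (cgVec q n₁ n₂ n ((n : ℝ) / 2 - (d + 1 : ℕ))) =
      √(qnum q ((n : ℝ) - d) * qnum q ((d : ℝ) + 1)) • cgVec q n₁ n₂ n ((n : ℝ) / 2 - d) :=
  (coprodJm_mulVec_coprodJp_mulVec hq hc d hd.le).2 hd

/-- J₊ and J₋ are mutually transposed and act between neighbours with the same factor, so
neighbouring vectors have equal norm. -/
lemma cgVec_norm (hq : 0 < q) (hc : Coupled n₁ n₂ n) : ∀ d : ℕ, d ≤ n →
    cgVec q n₁ n₂ n ((n : ℝ) / 2 - d) ⬝ᵥ cgVec q n₁ n₂ n ((n : ℝ) / 2 - d) = 1 := by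
  intro d
  induction d with
  | zero => intro _; simpa using cgVec_highest_norm hq hc
  | succ d ih =>
    intro hd
    have hr := (Real.sqrt_pos.2 (lowering_factor_pos hq (Nat.lt_of_succ_le hd))).ne'
    have h := dotProduct_mulVec_coprodJp (q := q) (cgVec q n₁ n₂ n ((n : ℝ) / 2 - d))
      (cgVec q n₁ n₂ n ((n : ℝ) / 2 - (d + 1 : ℕ)))
    rw [coprodJp_mulVec_cgVec_sub hq hc hd, coprodJm_mulVec_cgVec_sub hq hd, dotProduct_smul,
      smul_dotProduct, ih (Nat.le_of_succ_le hd), smul_eq_mul, smul_eq_mul] at h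
    exact (mul_left_cancel₀ hr h).symm

/-- The squared norm of J₋v is ⟨v, J₊J₋v⟩ = ([1][n] + [-n])⟨v, v⟩ = 0, which gives the end of the
ladder without another series identity. -/
lemma coprodJm_mulVec_cgVec_lowest (hq : 0 < q) (hc : Coupled n₁ n₂ n) :
    (coprodJm q n₁ n₂).mulVec (cgVec q n₁ n₂ n ((n : ℝ) / 2 - n)) = 0 := by
  rw [← dotProduct_self_eq_zero, ← dotProduct_mulVec_coprodJp, coprodJp_mulVec_coprodJm_mulVec hq,
    (coprodJm_mulVec_coprodJp_mulVec hq hc n le_rfl).1, ← add_smul, sub_self, zero_add,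
    qnum_one hq, show 2 * ((n : ℝ) / 2 - n) = -n by ring, qnum_neg]
  simp

/-! ### Existence and uniqueness of the intertwining operator -/

/-- The matrix of the coefficients `cgPhi`. -/
noncomputable def cgPhiMatrix (q : ℝ) (n₁ n₂ n : ℕ) :
    Matrix (Fin (n₁ + 1) × Fin (n₂ + 1)) (Fin (n + 1)) ℝ :=
  Matrix.of fun x k => cgVec q n₁ n₂ n (weight n k) x

lemma mul_apply_eq_mulVec {l m p : Type*} [Fintype m] (A : Matrix l m ℝ) (B : Matrix m p ℝ)
    (x : l) (k : p) : (A * B) x k = A.mulVec (fun y => B y k) x := rfl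

lemma weight_eq_half_sub (k : Fin (n + 1)) :
    weight n k = (n : ℝ) / 2 - (n - (k : ℕ) : ℕ) := by
  rw [weight, Nat.cast_sub (Nat.lt_succ_iff.1 k.2)]; ring

lemma weight_injective (n : ℕ) : Function.Injective (weight n) := by
  intro i k h
  rw [weight, weight] at h
  have : ((i : ℕ) : ℝ) = (k : ℕ) := by linarith
  exact Fin.ext (by exact_mod_cast this)

lemma weight_last (n : ℕ) : weight n (Fin.last n) = (n : ℝ) / 2 := by
  rw [weight, Fin.val_last]; ring

/-- The matrix of the coefficients `cgPhi` is the normalized isometric intertwining operator. -/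
lemma isClebschGordan_cgPhiMatrix (hq : 0 < q) (hc : Coupled n₁ n₂ n) :
    IsClebschGordan q n₁ n₂ n (cgPhiMatrix q n₁ n₂ n) where
  zero := by
    rw [coprod_J0, J0]
    ext x k
    rw [Matrix.diagonal_mul, Matrix.mul_diagonal, cgPhiMatrix, Matrix.of_apply, cgVec]
    split_ifs with h
    · rw [h, mul_comm]
    · rw [mul_zero, zero_mul]
  raise := by
    change coprodJp q n₁ n₂ * cgPhiMatrix q n₁ n₂ n = cgPhiMatrix q n₁ n₂ n * Jp q n
    ext x k
    rw [mul_apply_eq_mulVec, Matrix.mul_apply, sum_mul_Jp]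
    change (coprodJp q n₁ n₂).mulVec (cgVec q n₁ n₂ n (weight n k)) x = _
    rcases (Nat.lt_succ_iff.1 k.2).eq_or_lt with h | h
    · have hk : (n : ℝ) / 2 - weight n k = 0 := by rw [half_sub_weight, h, sub_self]
      rw [hk, show weight n k = (n : ℝ) / 2 by linarith, coprodJp_mulVec_cgVec hq hc]
      simp
    · have hd : n - (k : ℕ) - 1 < n := by omega
      have hlt : (k : ℕ) + 1 < n + 1 := by omega
      have e1 : weight n k = (n : ℝ) / 2 - ((n - (k : ℕ) - 1) + 1 : ℕ) := by
        rw [weight_eq_half_sub]; congr 2; omega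
      have e2 : weight n ⟨(k : ℕ) + 1, hlt⟩ = (n : ℝ) / 2 - (n - (k : ℕ) - 1 : ℕ) := by
        rw [weight_eq_half_sub]; congr 2
      rw [extendZero_eq_of_lt _ hlt, cgPhiMatrix, Matrix.of_apply, e2, e1,
        coprodJp_mulVec_cgVec_sub hq hc hd, Pi.smul_apply, smul_eq_mul]
      congr 3
      · congr 1
        push_cast
        ring
      · congr 1
        push_cast
        ring
  lower := by
    change coprodJm q n₁ n₂ * cgPhiMatrix q n₁ n₂ n = cgPhiMatrix q n₁ n₂ n * Jm q n
    ext x k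
    rw [mul_apply_eq_mulVec, Matrix.mul_apply, sum_mul_Jm]
    change (coprodJm q n₁ n₂).mulVec (cgVec q n₁ n₂ n (weight n k)) x = _
    rcases Nat.eq_zero_or_pos (k : ℕ) with h | h
    · have hk : (n : ℝ) / 2 + weight n k = 0 := by rw [half_add_weight, h, Nat.cast_zero]
      rw [hk, show weight n k = (n : ℝ) / 2 - n by linarith, coprodJm_mulVec_cgVec_lowest hq hc]
      simp
    · have hk := k.2
      have hd : n - (k : ℕ) < n := by omega
      have hlt : (k : ℕ) - 1 < n + 1 := by omega
      have e2 : weight n ⟨(k : ℕ) - 1, hlt⟩ = (n : ℝ) / 2 - ((n - (k : ℕ)) + 1 : ℕ) := by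
        rw [weight_eq_half_sub]; congr 2; dsimp only; omega
      rw [extendZero_eq_of_lt _ hlt, cgPhiMatrix, Matrix.of_apply, e2, weight_eq_half_sub k,
        coprodJm_mulVec_cgVec_sub hq hd, Pi.smul_apply, smul_eq_mul, mul_comm (qnum q _)]
      congr 3
      · congr 1
        ring
      · congr 1
        ring
  isometry := by
    ext k l
    rw [Matrix.mul_apply]
    simp only [Matrix.transpose_apply, cgPhiMatrix, Matrix.of_apply]
    by_cases h : k = l
    · subst h
      rw [Matrix.one_apply_eq, weight_eq_half_sub]
      exact cgVec_norm hq hc _ (Nat.sub_le _ _)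
    · rw [Matrix.one_apply_ne h]
      apply Finset.sum_eq_zero
      intro x _
      rw [cgVec, cgVec]
      by_cases hk : weight₂ x = weight n k
      · rw [if_neg (c := weight₂ x = weight n l), mul_zero]
        intro hl
        exact h (weight_injective n (hk.symm.trans hl))
      · rw [if_neg hk, zero_mul]
  pos := by
    intro k₂ hk
    have hk' : (n₁ : ℝ) + 2 * (k₂ : ℕ) = n₂ + n := by exact_mod_cast hk
    have hw : weight n₂ k₂ = (n : ℝ) / 2 - (n₁ : ℝ) / 2 := by rw [weight]; linarith
    rw [cgPhiMatrix, Matrix.of_apply, cgVec, weight₂, if_pos, weight_last, hw]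
    · exact cgPhi_highest_pos hq hc.tri hc.tri₁ hc.tri₂
    · dsimp only
      rw [weight_last, weight_last, hw]; ring

/-- A highest weight vector is determined by its coordinate with `m₁ = j₁`. -/
lemma eq_zero_of_highest (hq : 0 < q) {v : Fin (n₁ + 1) × Fin (n₂ + 1) → ℝ}
    (hv : (coprodJp q n₁ n₂).mulVec v = 0) (h : ∀ k₂, v (Fin.last n₁, k₂) = 0) : v = 0 := by
  have key : ∀ i : ℕ, ∀ k₁ : Fin (n₁ + 1), (k₁ : ℕ) + i = n₁ → ∀ k₂, v (k₁, k₂) = 0 := by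
    intro i
    induction i with
    | zero =>
      intro k₁ hk k₂
      rw [show k₁ = Fin.last n₁ from Fin.ext (by simpa using hk)]
      exact h k₂
    | succ i ih =>
      intro k₁ hk k₂
      have hlt : (k₁ : ℕ) + 1 < n₁ + 1 := by omega
      have hlt' : (k₁ : ℕ) + 1 - 1 < n₁ + 1 := by omega
      -- The coordinate of J₊v at (m₁ + 1, m₂) involves only v at (m₁, m₂) and at (m₁ + 1, m₂ - 1).
      -- The latter is already zero, so the induction moves down in m₁.
      have e := congrFun hv (⟨k₁ + 1, hlt⟩, k₂)
      have e2 : extendZero (fun i => v (⟨(k₁ : ℕ) + 1, hlt⟩, i)) (k₂ - 1) = 0 := by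
        unfold extendZero
        split_ifs
        · exact ih _ (by dsimp only; omega) _
        · rfl
      rw [coprodJp_mulVec, e2, mul_zero, add_zero, Pi.zero_apply,
        extendZero_eq_of_lt _ (by dsimp only; omega)] at e
      have hne : √(qnum q ((n₁ : ℝ) / 2 - weight n₁ ⟨(k₁ : ℕ) + 1, hlt⟩ + 1) *
          qnum q ((n₁ : ℝ) / 2 + weight n₁ ⟨(k₁ : ℕ) + 1, hlt⟩)) * q ^ weight n₂ k₂ ≠ 0 := by
        apply mul_ne_zero _ (Real.rpow_pos_of_pos hq _).ne'
        apply (Real.sqrt_pos.2 (mul_pos (qnum_pos hq _) (qnum_pos hq _))).ne'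
        · have := (isState_weight n₁ ⟨(k₁ : ℕ) + 1, hlt⟩).2.nonneg
          linarith
        · rw [half_add_weight]
          dsimp only
          positivity
      rcases mul_eq_zero.1 e with h' | h'
      · exact absurd h' hne
      · exact h'
  ext ⟨k₁, k₂⟩
  exact key (n₁ - k₁) k₁ (by have := k₁.2; omega) k₂

/-- The normalized isometric intertwining operator is unique. -/
lemma IsClebschGordan.eq_cgPhiMatrix (hq : 0 < q) (hc : Coupled n₁ n₂ n)
    {C : Matrix (Fin (n₁ + 1) × Fin (n₂ + 1)) (Fin (n + 1)) ℝ} (hC : IsClebschGordan q n₁ n₂ n C) :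
    C = cgPhiMatrix q n₁ n₂ n := by
  have hP := isClebschGordan_cgPhiMatrix hq hc
  have raise_last : ∀ {D : Matrix (Fin (n₁ + 1) × Fin (n₂ + 1)) (Fin (n + 1)) ℝ},
      IsClebschGordan q n₁ n₂ n D →
      (coprodJp q n₁ n₂).mulVec (fun x => D x (Fin.last n)) = 0 := by
    intro D hD
    ext x
    have h : (coprodJp q n₁ n₂ * D) x (Fin.last n) = (D * Jp q n) x (Fin.last n) := by
      rw [← hD.raise]; rfl
    rw [mul_apply_eq_mulVec, Matrix.mul_apply, sum_mul_Jp, half_sub_weight] at h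
    rw [h]
    simp
  have zero_of_ne : ∀ {D : Matrix (Fin (n₁ + 1) × Fin (n₂ + 1)) (Fin (n + 1)) ℝ},
      IsClebschGordan q n₁ n₂ n D → ∀ x k, weight₂ x ≠ weight n k → D x k = 0 := by
    intro D hD x k hx
    have h := congrFun (congrFun hD.zero x) k
    rw [coprod_J0, J0, Matrix.diagonal_mul, Matrix.mul_diagonal] at h
    have : (weight₂ x - weight n k) * D x k = 0 := by linear_combination h
    exact (mul_eq_zero.1 this).resolve_left (sub_ne_zero.2 hx)
  have norm_last : ∀ {D : Matrix (Fin (n₁ + 1) × Fin (n₂ + 1)) (Fin (n + 1)) ℝ},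
      IsClebschGordan q n₁ n₂ n D → ∑ x, D x (Fin.last n) * D x (Fin.last n) = 1 := by
    intro D hD
    have h := congrFun (congrFun hD.isometry (Fin.last n)) (Fin.last n)
    rwa [Matrix.one_apply_eq, Matrix.mul_apply] at h
  -- x is the index of the weight m₂ = j - j₁, the only one that pairs with m₁ = j₁ in the highest
  -- column.
  obtain ⟨x, hx⟩ := hc.tri₂
  have hx' : (n₁ : ℝ) + 2 * x = n₂ + n := by linarith
  have hxN : n₁ + 2 * x = n₂ + n := by exact_mod_cast hx'
  have hxlt : x < n₂ + 1 := by
    have := hc.tri.nonneg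
    have : (x : ℝ) ≤ n₂ := by linarith
    have : x ≤ n₂ := by exact_mod_cast this
    omega
  have pC := hC.pos ⟨x, hxlt⟩ hxN
  have pP := hP.pos ⟨x, hxlt⟩ hxN
  -- The ratio of the two positive entries. The difference C - s·P of the highest columns is a
  -- highest weight vector without coordinates at m₁ = j₁, hence zero; equal norms and s > 0 then
  -- give s = 1.
  set s := C (Fin.last n₁, ⟨x, hxlt⟩) (Fin.last n) /
    cgPhiMatrix q n₁ n₂ n (Fin.last n₁, ⟨x, hxlt⟩) (Fin.last n) with hs
  have hs0 : 0 < s := div_pos pC pP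
  have hlast : ∀ y, C y (Fin.last n) = s * cgPhiMatrix q n₁ n₂ n y (Fin.last n) := by
    have := eq_zero_of_highest hq
      (v := (fun y => C y (Fin.last n)) - s • fun y => cgPhiMatrix q n₁ n₂ n y (Fin.last n))
      (by rw [Matrix.mulVec_sub, Matrix.mulVec_smul, raise_last hC, raise_last hP]; simp)
      (by
        intro k₂
        rw [Pi.sub_apply, Pi.smul_apply, smul_eq_mul]
        by_cases hk : k₂ = ⟨x, hxlt⟩
        · rw [hk, hs, div_mul_cancel₀ _ pP.ne', sub_self]
        · have hne : weight₂ (Fin.last n₁, k₂) ≠ weight n (Fin.last n) := by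
            intro h
            apply hk
            rw [weight₂, weight_last, weight_last, weight] at h
            dsimp only at h
            have : ((k₂ : ℕ) : ℝ) = x := by linarith
            exact Fin.ext (by exact_mod_cast this)
          rw [zero_of_ne hC _ _ hne, zero_of_ne hP _ _ hne, mul_zero, sub_zero])
    intro y
    have h := congrFun this y
    rw [Pi.sub_apply, Pi.smul_apply, smul_eq_mul, Pi.zero_apply] at h
    linarith
  have hs1 : s = 1 := by
    have h1 := norm_last hC
    have h2 := norm_last hP
    simp only [hlast] at h1
    have h3 : ∑ y, s * cgPhiMatrix q n₁ n₂ n y (Fin.last n) *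
        (s * cgPhiMatrix q n₁ n₂ n y (Fin.last n)) = s ^ 2 *
        ∑ y, cgPhiMatrix q n₁ n₂ n y (Fin.last n) * cgPhiMatrix q n₁ n₂ n y (Fin.last n) := by
      rw [Finset.mul_sum]
      apply Finset.sum_congr rfl
      intro y _
      ring
    rw [h1, h2] at h3
    nlinarith
  have key : ∀ d : ℕ, ∀ k : Fin (n + 1), (k : ℕ) + d = n →
      ∀ y, C y k = cgPhiMatrix q n₁ n₂ n y k := by
    intro d
    induction d with
    | zero =>
      intro k hk y
      rw [show k = Fin.last n from Fin.ext (by simpa using hk), hlast, hs1, one_mul]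
    | succ d ih =>
      intro k hk y
      have hlt : (k : ℕ) + 1 < n + 1 := by omega
      have lower : ∀ {D : Matrix (Fin (n₁ + 1) × Fin (n₂ + 1)) (Fin (n + 1)) ℝ},
          IsClebschGordan q n₁ n₂ n D →
          (coprodJm q n₁ n₂).mulVec (fun x => D x ⟨(k : ℕ) + 1, hlt⟩) y =
            √(qnum q ((n : ℝ) / 2 - weight n ⟨(k : ℕ) + 1, hlt⟩ + 1) *
              qnum q ((n : ℝ) / 2 + weight n ⟨(k : ℕ) + 1, hlt⟩)) * D y k := by
        intro D hD
        have h : (coprodJm q n₁ n₂ * D) y ⟨(k : ℕ) + 1, hlt⟩ =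
            (D * Jm q n) y ⟨(k : ℕ) + 1, hlt⟩ := by
          rw [← hD.lower]; rfl
        rw [mul_apply_eq_mulVec, Matrix.mul_apply, sum_mul_Jm,
          extendZero_eq_of_lt _ (by dsimp only; omega)] at h
        exact h
      have hcol : (fun x => C x ⟨(k : ℕ) + 1, hlt⟩) =
          fun x => cgPhiMatrix q n₁ n₂ n x ⟨(k : ℕ) + 1, hlt⟩ :=
        funext fun x => ih _ (by dsimp only; omega) x
      have h := lower hC
      rw [hcol, lower hP] at h
      refine (mul_left_cancel₀ ?_ h).symm
      apply (Real.sqrt_pos.2 (mul_pos (qnum_pos hq _) (qnum_pos hq _))).ne'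
      · have := (isState_weight n ⟨(k : ℕ) + 1, hlt⟩).2.nonneg
        linarith
      · rw [half_add_weight]
        dsimp only
        positivity
  ext y k
  exact key (n - k) k (by have := k.2; omega) y

theorem existsUnique_isClebschGordan (hq : 0 < q) (hc : Coupled n₁ n₂ n) :
    ∃! C, IsClebschGordan q n₁ n₂ n C :=
  ⟨_, isClebschGordan_cgPhiMatrix hq hc, fun _ hC => hC.eq_cgPhiMatrix hq hc⟩

lemma cgMatrix_eq (hq : 0 < q) (hc : Coupled n₁ n₂ n) :
    cgMatrix q n₁ n₂ n = cgPhiMatrix q n₁ n₂ n := by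
  have h : ∃ C, IsClebschGordan q n₁ n₂ n C := ⟨_, isClebschGordan_cgPhiMatrix hq hc⟩
  rw [cgMatrix, dif_pos h]
  exact h.choose_spec.eq_cgPhiMatrix hq hc

lemma coupled_of_even (he : Even (n₁ + n₂ + n)) (h : n ≤ n₁ + n₂) (h₁ : n₁ ≤ n₂ + n)
    (h₂ : n₂ ≤ n₁ + n) : Coupled n₁ n₂ n := by
  obtain ⟨r, hr⟩ := he
  have hr' : (n₁ : ℝ) + n₂ + n = r + r := by exact_mod_cast hr
  refine ⟨⟨r - n, ?_⟩, ⟨r - n₂, ?_⟩, ⟨r - n₁, ?_⟩⟩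
  all_goals
    rw [Nat.cast_sub (by omega)]
    linarith

end

/-! ### From real spins and weights to matrix indices -/

lemma floor_two_mul {j m : ℝ} (h : IsState j m) : ((⌊2 * j⌋₊ : ℕ) : ℝ) / 2 = j := by
  have : IsNat (2 * j) := by convert h.1.add h.2 using 1; ring
  obtain ⟨k, hk⟩ := this
  rw [hk, Nat.floor_natCast, ← hk]; ring

/-- For a genuine state the floors are exact and the index j + m is at most 2j, so the reduction
modulo 2j + 1 in `Fin.ofNat` does nothing. -/
lemma weight_ofNat_floor {j m : ℝ} (h : IsState j m) :
    weight ⌊2 * j⌋₊ (Fin.ofNat _ ⌊j + m⌋₊) = m := by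
  have h2 := floor_two_mul h
  obtain ⟨⟨k, hk⟩, ⟨l, hl⟩⟩ := h
  have hn : ⌊2 * j⌋₊ = k + l := by
    rw [show 2 * j = ((k + l : ℕ) : ℝ) by push_cast; linarith, Nat.floor_natCast]
  rw [weight, h2, hk, Nat.floor_natCast, Fin.val_ofNat, Nat.mod_eq_of_lt (by omega), ← hk]
  ring

lemma CG_eq_cgPhi (hq : 0 < q) {j₁ m₁ j₂ m₂ j m : ℝ}
    (hL : (Labels.mk j₁ m₁ j₂ m₂ j m).Admissible) :
    CG q j₁ m₁ j₂ m₂ j m = cgPhi q j₁ m₁ j₂ m₂ j := by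
  obtain ⟨s1, s2, s, t, t1, t2, hm⟩ := hL
  dsimp only at *
  have hc : Coupled ⌊2 * j₁⌋₊ ⌊2 * j₂⌋₊ ⌊2 * j⌋₊ := by
    refine ⟨?_, ?_, ?_⟩
    all_goals rw [floor_two_mul s1, floor_two_mul s2, floor_two_mul s]
    · exact t
    · convert t1 using 1; ring
    · exact t2
  rw [CG, if_pos ⟨s1, s2, s⟩, cgMatrix_eq hq hc, cgPhiMatrix, Matrix.of_apply, cgVec, weight₂]
  dsimp only
  rw [weight_ofNat_floor s1, weight_ofNat_floor s2, weight_ofNat_floor s, if_pos hm.symm,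
    floor_two_mul s1, floor_two_mul s2, floor_two_mul s]

/-- The very-well-poised expression of the Clebsch–Gordan coefficients. -/
theorem CG_eq_cgPoised (hq : 0 < q) {j₁ m₁ j₂ m₂ j m : ℝ}
    (hL : (Labels.mk j₁ m₁ j₂ m₂ j m).Admissible) :
    CG q j₁ m₁ j₂ m₂ j m = cgPoised q j₁ m₁ j₂ m₂ j m := by
  rw [CG_eq_cgPhi hq hL]
  exact (cgPoised_eq_cgPhi hq hL).symm

/-! ### The recoupling relation -/

section

variable {j₁ m₁ j₂ m₂ j m : ℝ}

lemma nabla_pos (hq : 0 < q) {a b c : ℝ} (h1 : IsNat (a + b - c)) (h2 : IsNat (a - b + c))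
    (h3 : IsNat (b + c - a)) : 0 < nabla q a b c := by
  have h4 : IsNat (a + b + c + 1) := by
    have : IsNat (1 : ℝ) := ⟨1, by simp⟩
    convert ((h1.add h2).add h3).add this using 1; ring
  have r1 := qfact_pos hq h1
  have r2 := qfact_pos hq h2
  have r3 := qfact_pos hq h3
  have r4 := qfact_pos hq h4
  exact Real.sqrt_pos.2 (by positivity)

lemma nabla_swap (a b c : ℝ) : nabla q a c b = nabla q a b c := by
  rw [nabla, nabla, show a + c - b = a - b + c by ring, show a - c + b = a + b - c by ring,
    show a + c + b + 1 = a + b + c + 1 by ring, show c + b - a = b + c - a by ring,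
    mul_comm (qfact q (a - b + c))]

/-- Δ and ∇ contain the same four factorials, two of them inverted, so their product is rational.
This expresses the 6j prefactors through the ∇ of the very-well-poised sum. -/
lemma triangle_eq_nabla (hq : 0 < q) {a b c : ℝ} (h1 : IsNat (a + b - c))
    (h2 : IsNat (a - b + c)) (h3 : IsNat (b + c - a)) :
    triangle q a b c = qfact q (a + b - c) * qfact q (a - b + c) / nabla q a b c := by
  have h4 : IsNat (a + b + c + 1) := by
    have : IsNat (1 : ℝ) := ⟨1, by simp⟩
    convert ((h1.add h2).add h3).add this using 1; ring
  have r1 := qfact_pos hq h1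
  have r2 := qfact_pos hq h2
  have r3 := qfact_pos hq h3
  have r4 := qfact_pos hq h4
  rw [eq_div_iff (nabla_pos hq h1 h2 h3).ne', triangle, nabla, ← Real.sqrt_mul (by positivity)]
  rw [Real.sqrt_eq_iff_mul_self_eq (by positivity) (by positivity)]
  field_simp

lemma triangle_comm (a b c : ℝ) : triangle q b a c = triangle q a b c := by
  rw [triangle, triangle, show b + a - c = a + b - c by ring, show b - a + c = b + c - a by ring,
    show a + c - b = a - b + c by ring, show b + a + c + 1 = a + b + c + 1 by ring]
  congr 2
  ring

lemma triangle_rotate (a b c : ℝ) : triangle q c b a = triangle q a b c := by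
  rw [triangle, triangle, show c + b - a = b + c - a by ring, show c - b + a = a - b + c by ring,
    show b + a - c = a + b - c by ring, show c + b + a + 1 = a + b + c + 1 by ring]
  congr 2
  ring

lemma triangle_eq_zero {a b c : ℝ}
    (h : ¬ (IsNat (a + b - c) ∧ IsNat (a - b + c) ∧ IsNat (b + c - a))) :
    triangle q a b c = 0 := by
  simp only [not_and_or] at h
  rcases h with h | h | h <;> simp [triangle, qfact_of_not_isNat h]

lemma nabla_zero_sq (hq : 0 < q) (hj : IsNat (2 * j)) : nabla q 0 j j ^ 2 = qnum q (2 * j + 1) := by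
  have r := (qfact_pos hq hj).ne'
  have hj' := hj.nonneg
  rw [nabla_sq hq, show (0 : ℝ) + j - j = 0 by ring, show (0 : ℝ) - j + j = 0 by ring,
    show (0 : ℝ) + j + j + 1 = 2 * j + 1 by ring, show j + j - 0 = 2 * j by ring, qfact_zero,
    qfact_succ hj']
  field_simp

/-- A zero of ∇² in a denominator kills the term, division by zero being zero. Thus a = 0 or b = 0
reduces the very-well-poised sum to one spin. -/
lemma nabla_zero_sq_of_ne (hq : 0 < q) {x : ℝ} (hx : x ≠ j) : nabla q 0 j x ^ 2 = 0 := by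
  rw [nabla_sq hq, zero_add, zero_sub]
  rcases lt_or_gt_of_ne hx with h | h
  · rw [qfact_of_neg (by linarith : -j + x < 0)]; simp
  · rw [qfact_of_neg (by linarith : j - x < 0)]; simp

lemma IsState.isNat_two_mul (h : IsState j m) : IsNat (2 * j) := by
  convert h.1.add h.2 using 1; ring

/-- The Clebsch–Gordan coefficients with `m₂ = j₂`. -/
lemma CG_of_eq_spin (hq : 0 < q) (hL : (Labels.mk j₁ m₁ j₂ j₂ j m).Admissible) :
    CG q j₁ m₁ j₂ j₂ j m = sgn (j₁ + j₂ - j) *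
      q ^ ((j₂ * (j₂ + 1) - j₁ * (j₁ + 1) - j * (j + 1)) / 2 - m₁ * j₂ - j₂ * (j₂ + 1) +
        j * (j + 1)) *
      (√(qnum q (2 * j + 1) * qfact q (2 * j₂) * qfact q (j₁ - m₁) * qfact q (j + m) /
        (qfact q (j₁ + m₁) * qfact q (j - m))) / nabla q j₂ j₁ j) := by
  rw [CG_eq_cgPoised hq hL, cgPoised]
  obtain ⟨s1, s2, s, t, t1, t2, hm⟩ := hL
  dsimp only at *
  obtain ⟨N, hN⟩ := s.isNat_two_mul
  have hN' : (N : ℝ) / 2 = j := by linarith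
  have hnab := (nabla_pos hq (a := j₂) (b := j₁) (c := j) (by rwa [add_comm j₂]) t2
    (by convert t1 using 1; ring)).ne'
  have h0 := s.isNat_two_mul.nonneg
  have r1 := qfact_pos hq s1.1
  have r2 := qfact_pos hq s1.2
  have r3 := qfact_pos hq s.1
  have r4 := qfact_pos hq s.2
  have r5 := qfact_pos hq s2.isNat_two_mul
  have r6 := qnum_pos hq (by linarith : 0 < 2 * j + 1)
  -- Here b = 0, so the factor 1/∇²[0, j, x] leaves only x = j.
  rw [sub_self, zero_div, halfSum_eq_single N]
  · rw [hN', show (j₂ + j₂) / 2 = j₂ by ring, nabla_zero_sq hq s.isNat_two_mul, ← hm, ← two_mul,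
      qfact_zero, show 2 * j₂ * (2 * j₂ + 2) / 4 = j₂ * (j₂ + 1) by ring, Real.rpow_add hq]
    have hs : √(qnum q (2 * j + 1) * qfact q (2 * j₂) * 1 * qfact q (j₁ - m₁) * qfact q (j - m) /
        (qfact q (j₁ + m₁) * qfact q (j + m))) * (qfact q (j + m) / qfact q (j - m)) =
        √(qnum q (2 * j + 1) * qfact q (2 * j₂) * qfact q (j₁ - m₁) * qfact q (j + m) /
        (qfact q (j₁ + m₁) * qfact q (j - m))) := by
      rw [mul_comm, mul_sqrt_eq_sqrt (by positivity)]
      congr 1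
      field_simp
    rw [← hs]
    field_simp
  · intro n hn
    rw [nabla_zero_sq_of_ne hq]
    · simp
    · intro h
      apply hn
      have : (n : ℝ) = N := by linarith
      exact_mod_cast this

/-- The Clebsch–Gordan coefficients with `m₂ = -j₂`. -/
lemma CG_of_eq_neg_spin (hq : 0 < q) (hL : (Labels.mk j₁ m₁ j₂ (-j₂) j m).Admissible) :
    CG q j₁ m₁ j₂ (-j₂) j m =
      q ^ ((j₂ * (j₂ + 1) - j₁ * (j₁ + 1) - j * (j + 1)) / 2 - m₁ * j₂ + j₁ * (j₁ + 1)) *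
      (√(qnum q (2 * j + 1) * qfact q (2 * j₂) * qfact q (j₁ + m₁) * qfact q (j - m) /
        (qfact q (j₁ - m₁) * qfact q (j + m))) / nabla q j₂ j₁ j) := by
  rw [CG_eq_cgPoised hq hL, cgPoised]
  obtain ⟨s1, s2, s, t, t1, t2, hm⟩ := hL
  dsimp only at *
  obtain ⟨N, hN⟩ := s1.isNat_two_mul
  have hN' : (N : ℝ) / 2 = j₁ := by linarith
  have hnab := (nabla_pos hq (a := j₂) (b := j₁) (c := j) (by rwa [add_comm j₂]) t2
    (by convert t1 using 1; ring)).ne'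
  have h0 := s.isNat_two_mul.nonneg
  have h1 := s1.isNat_two_mul.nonneg
  have r1 := qfact_pos hq s1.1
  have r2 := qfact_pos hq s1.2
  have r3 := qfact_pos hq s.1
  have r4 := qfact_pos hq s.2
  have r5 := qfact_pos hq s2.isNat_two_mul
  have r6 := qnum_pos hq (by linarith : 0 < 2 * j + 1)
  have r7 := qnum_pos hq (by linarith : 0 < 2 * j₁ + 1)
  -- Here a = 0, so the factor 1/∇²[0, j₁, x] leaves only x = j₁.
  rw [add_neg_cancel, zero_div, halfSum_eq_single N]
  · rw [hN', show (j₂ - -j₂) / 2 = j₂ by ring, nabla_zero_sq hq s1.isNat_two_mul,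
      show j₂ - -j₂ = 2 * j₂ by ring, qfact_zero, add_zero, add_zero, sub_self, sgn_zero,
      nabla_swap j₂ j₁ j, zero_mul, zero_div, sub_zero, Real.rpow_add hq]
    have hs : √(qnum q (2 * j + 1) * 1 * qfact q (2 * j₂) * qfact q (j₁ - m₁) * qfact q (j - m) /
        (qfact q (j₁ + m₁) * qfact q (j + m))) * (qfact q (j₁ + m₁) / qfact q (j₁ - m₁)) =
        √(qnum q (2 * j + 1) * qfact q (2 * j₂) * qfact q (j₁ + m₁) * qfact q (j - m) /
        (qfact q (j₁ - m₁) * qfact q (j + m))) := by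
      rw [mul_comm, mul_sqrt_eq_sqrt (by positivity)]
      congr 1
      field_simp
    rw [← hs]
    field_simp
  · intro n hn
    rw [nabla_zero_sq_of_ne hq]
    · simp
    · intro h
      apply hn
      have : (n : ℝ) = N := by linarith
      exact_mod_cast this

/-- The `q`-`6j` coefficients with a stretched triangle. -/
lemma sixJ_stretched (hq : 0 < q) {a b x : ℝ}
    (t : IsNat (j₁ + (a + b) - j)) (t1 : IsNat (j₁ - (a + b) + j)) (t2 : IsNat (a + b - j₁ + j))
    (u : IsNat (a + j₁ - x)) (u1 : IsNat (a - j₁ + x)) (u2 : IsNat (j₁ + x - a))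
    (v : IsNat (b + j - x)) (v1 : IsNat (b - j + x)) (v2 : IsNat (j + x - b)) :
    sixJ q a b (a + b) j j₁ x = sgn (j₁ + (a + b) + j) *
      √(qfact q (2 * a) * qfact q (2 * b) / qfact q (2 * (a + b) + 1)) * nabla q (a + b) j₁ j /
        (nabla q a j₁ x * nabla q b j x) := by
  have hJ : IsNat (j₁ + (a + b) + j) := by convert (t.add t1).add t2 using 1; ring
  obtain ⟨N, hN⟩ := hJ
  have hJ1 : IsNat (j₁ + (a + b) + j + 1) := ⟨N + 1, by rw [hN]; push_cast; ring⟩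
  have d1 : triangle q a b (a + b) =
      √(qfact q (2 * a) * qfact q (2 * b) / qfact q (2 * (a + b) + 1)) := by
    rw [triangle, sub_self, qfact_zero, one_mul, show a - b + (a + b) = 2 * a by ring,
      show b + (a + b) - a = 2 * b by ring, show a + b + (a + b) + 1 = 2 * (a + b) + 1 by ring]
  have d2 := triangle_eq_nabla hq u u1 u2
  have d3 := triangle_eq_nabla hq v v1 v2
  have d4 := triangle_eq_nabla hq (a := a + b) (b := j₁) (c := j) (by convert t using 1; ring) t2
    (by convert t1 using 1; ring)
  have n2 := nabla_pos hq u u1 u2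
  have n3 := nabla_pos hq v v1 v2
  have n4 := nabla_pos hq (a := a + b) (b := j₁) (c := j) (by convert t using 1; ring) t2
    (by convert t1 using 1; ring)
  have n4s := nabla_sq hq (a + b) j₁ j
  have r1 := qfact_pos hq t
  have r2 := qfact_pos hq t1
  have r3 := qfact_pos hq t2
  have r4 := qfact_pos hq u
  have r5 := qfact_pos hq u1
  have r6 := qfact_pos hq v
  have r7 := qfact_pos hq v1
  have r8 := qfact_pos hq hJ1
  -- Because e = a + b, the factors 1/[z - d - c - e]! and 1/[a + b + c + d - z]! force z = j₁ + j₂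
  -- + j = N.
  rw [sixJ, d1, d2, triangle_comm b j x, d3, triangle_rotate (a + b) j₁ j, d4,
    finsum_eq_single _ N]
  · rw [← hN, show j₁ + (a + b) + j - a - b - (a + b) = j₁ - (a + b) + j by ring,
      show j₁ + (a + b) + j - a - j₁ - x = b + j - x by ring,
      show j₁ + (a + b) + j - j - b - x = a + j₁ - x by ring,
      show j₁ + (a + b) + j - j - j₁ - (a + b) = 0 by ring,
      show a + b + j₁ + j - (j₁ + (a + b) + j) = 0 by ring,
      show a + j + (a + b) + x - (j₁ + (a + b) + j) = a - j₁ + x by ring,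
      show b + j₁ + (a + b) + x - (j₁ + (a + b) + j) = b - j + x by ring, qfact_zero]
    rw [show a + b + j₁ - j = j₁ + (a + b) - j by ring, show a + b + j₁ + j + 1 =
      j₁ + (a + b) + j + 1 by ring, show j₁ + j - (a + b) = j₁ - (a + b) + j by ring] at n4s
    rw [show a + b + j₁ - j = j₁ + (a + b) - j by ring]
    generalize nabla q (a + b) j₁ j = y4 at *
    generalize nabla q a j₁ x = y2 at *
    generalize nabla q b j x = y3 at *
    field_simp
    rw [n4s]
    field_simp
  · intro n hn
    rcases lt_or_gt_of_ne hn with h | h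
    · have : (n : ℝ) < N := by exact_mod_cast h
      rw [qfact_of_neg (x := (n : ℝ) - j - j₁ - (a + b)) (by linarith)]
      simp
    · have : (N : ℝ) < n := by exact_mod_cast h
      rw [qfact_of_neg (x := a + b + j₁ + j - (n : ℝ)) (by linarith)]
      simp

end

/-! ### Termwise comparison in the recoupling relation -/

section

variable {a b j₁ m₁ j x : ℝ}

/-- The recoupling relation for the summands of the very-well-poised series. -/
lemma recoupling_term (hq : 0 < q)
    (hL : (Labels.mk j₁ m₁ (a + b) (a - b) j (m₁ + (a - b))).Admissible)
    (u : IsNat (a + j₁ - x)) (u1 : IsNat (a - j₁ + x)) (u2 : IsNat (j₁ + x - a))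
    (v : IsNat (b + j - x)) (v1 : IsNat (b - j + x)) (v2 : IsNat (j + x - b))
    (w : IsNat (x + (m₁ + a))) (w1 : IsNat (x - (m₁ + a))) :
    CG q a a b (-b) (a + b) (a - b) *
        (nabla q (a + b) j₁ j *
          √(qnum q (2 * j + 1) * qfact q (2 * a) * qfact q (2 * b) * qfact q (j₁ - m₁) *
              qfact q (j - (m₁ + (a - b))) /
            (qfact q (j₁ + m₁) * qfact q (j + (m₁ + (a - b))))) *
          q ^ (((a + b) * (a + b + 1) - j₁ * (j₁ + 1) - j * (j + 1)) / 2 - m₁ * (a + b) -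
            a * (a + 1)) *
          (sgn (j₁ + a - x) * q ^ (x * (x + 1)) * qnum q (2 * x + 1) * qfact q (x + (m₁ + a)) /
            (nabla q a j₁ x ^ 2 * nabla q b j x ^ 2 * qfact q (x - (m₁ + a))))) =
      sgn (j₁ + (a + b) + j) * √(qnum q (2 * x + 1) * qnum q (2 * (a + b) + 1)) *
        sixJ q a b (a + b) j j₁ x * CG q j₁ m₁ a a x (m₁ + a) *
          CG q x (m₁ + a) b (-b) j (m₁ + (a - b)) := by
  obtain ⟨s1, s2, s, t, t1, t2, -⟩ := hL
  dsimp only at *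
  have h2a : IsNat (2 * a) := by convert s2.1 using 1; ring
  have h2b : IsNat (2 * b) := by convert s2.2 using 1; ring
  have h2ab : IsNat (2 * (a + b)) := by convert h2a.add h2b using 1; ring
  have h1 : IsNat (1 : ℝ) := ⟨1, by simp⟩
  have h0 : IsNat (0 : ℝ) := ⟨0, by simp⟩
  have hJ : IsNat (j₁ + (a + b) + j) := by convert (t.add t1).add t2 using 1; ring
  have sa : IsState a a := ⟨by rwa [← two_mul], by rwa [sub_self]⟩
  have sb : IsState b (-b) := ⟨by rwa [add_neg_cancel], by rwa [sub_neg_eq_add, ← two_mul]⟩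
  have sx : IsState x (m₁ + a) := ⟨w, w1⟩
  rw [CG_of_eq_neg_spin hq (j₁ := a) (m₁ := a) (j₂ := b) (j := a + b) (m := a - b)
      ⟨sa, sb, s2, by simpa using h0, by dsimp only; convert h2a using 1; ring,
        by dsimp only; convert h2b using 1; ring, by dsimp only; ring⟩,
    CG_of_eq_spin hq (j₁ := j₁) (m₁ := m₁) (j₂ := a) (j := x) (m := m₁ + a)
      ⟨s1, sa, sx, by dsimp only; convert u using 1; ring, by dsimp only; convert u2 using 1; ring,
        by dsimp only; convert u1 using 1, rfl⟩,
    CG_of_eq_neg_spin hq (j₁ := x) (m₁ := m₁ + a) (j₂ := b) (j := j) (m := m₁ + (a - b))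
      ⟨sx, sb, s, by dsimp only; convert v1 using 1; ring, by dsimp only; convert v2 using 1; ring,
        by dsimp only; convert v using 1; ring, by dsimp only; ring⟩,
    sixJ_stretched hq t t1 t2 u u1 u2 v v1 v2, nabla_swap b j x]
  have n2 := nabla_pos hq u u1 u2
  have n3 := nabla_pos hq v v1 v2
  have n4 := nabla_pos hq (a := b) (b := a) (c := a + b) (by convert h0 using 1; ring)
    (by convert h2b using 1; ring) (by convert h2a using 1; ring)
  have n4s : nabla q b a (a + b) =
      √(qfact q (2 * b) * (qnum q (2 * (a + b) + 1) * qfact q (2 * (a + b))) / qfact q (2 * a)) := by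
    rw [nabla, show b + a - (a + b) = 0 by ring, show b - a + (a + b) = 2 * b by ring,
      show b + a + (a + b) + 1 = 2 * (a + b) + 1 by ring, show a + (a + b) - b = 2 * a by ring,
      qfact_zero, one_mul, qfact_succ h2ab.nonneg]
  rw [n4s, qfact_succ h2ab.nonneg, ← two_mul a, sub_self, qfact_zero,
    show a + b - (a - b) = 2 * b by ring, show a + b + (a - b) = 2 * a by ring, one_mul]
  have r1 := qfact_pos hq s1.1
  have r2 := qfact_pos hq s1.2
  have r3 := qfact_pos hq s.1
  have r4 := qfact_pos hq s.2
  have r5 := qfact_pos hq w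
  have r6 := qfact_pos hq w1
  have r7 := qfact_pos hq h2a
  have r8 := qfact_pos hq h2b
  have r9 := qfact_pos hq h2ab
  have r10 := qnum_pos hq (by have := h2ab.nonneg; linarith : 0 < 2 * (a + b) + 1)
  have r11 := qnum_pos hq (by have := sx.isNat_two_mul.nonneg; linarith : 0 < 2 * x + 1)
  have r12 := qnum_pos hq (by have := s.isNat_two_mul.nonneg; linarith : 0 < 2 * j + 1)
  have hexp : q ^ ((b * (b + 1) - a * (a + 1) - (a + b) * (a + b + 1)) / 2 - a * b + a * (a + 1)) *
      q ^ (((a + b) * (a + b + 1) - j₁ * (j₁ + 1) - j * (j + 1)) / 2 - m₁ * (a + b) -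
            a * (a + 1)) * q ^ (x * (x + 1)) =
      q ^ ((a * (a + 1) - j₁ * (j₁ + 1) - x * (x + 1)) / 2 - m₁ * a - a * (a + 1) + x * (x + 1)) *
      q ^ ((b * (b + 1) - x * (x + 1) - j * (j + 1)) / 2 - (m₁ + a) * b + x * (x + 1)) := by
    rw [← Real.rpow_add hq, ← Real.rpow_add hq, ← Real.rpow_add hq]
    congr 1
    ring
  have hsgn : sgn (j₁ + (a + b) + j) * sgn (j₁ + (a + b) + j) = 1 := sgn_mul_self _
  generalize q ^ ((b * (b + 1) - a * (a + 1) - (a + b) * (a + b + 1)) / 2 - a * b + a * (a + 1)) =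
    e1 at *
  generalize q ^ (((a + b) * (a + b + 1) - j₁ * (j₁ + 1) - j * (j + 1)) / 2 - m₁ * (a + b) -
            a * (a + 1)) = e2 at *
  generalize q ^ ((a * (a + 1) - j₁ * (j₁ + 1) - x * (x + 1)) / 2 - m₁ * a - a * (a + 1) +
    x * (x + 1)) = e3 at *
  generalize q ^ ((b * (b + 1) - x * (x + 1) - j * (j + 1)) / 2 - (m₁ + a) * b + x * (x + 1)) =
    e4 at *
  generalize q ^ (x * (x + 1)) = e5 at *
  generalize sgn (j₁ + (a + b) + j) = z at *
  generalize nabla q a j₁ x = y1 at *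
  generalize nabla q b j x = y2 at *
  generalize nabla q (a + b) j₁ j = y3 at *
  -- Writing every positive factorial and q-number as a square removes all radicals and leaves an
  -- identity between monomials, settled by the exponent identity and by the square of the sign
  -- being 1.
  have root : ∀ {y : ℝ}, 0 < y → ∃ r, 0 < r ∧ y = r ^ 2 := fun {y} hy =>
    ⟨√y, Real.sqrt_pos.2 hy, (Real.sq_sqrt hy.le).symm⟩
  obtain ⟨f1, p1, g1⟩ := root r1
  obtain ⟨f2, p2, g2⟩ := root r2
  obtain ⟨f3, p3, g3⟩ := root r3
  obtain ⟨f4, p4, g4⟩ := root r4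
  obtain ⟨f5, p5, g5⟩ := root r5
  obtain ⟨f6, p6, g6⟩ := root r6
  obtain ⟨f7, p7, g7⟩ := root r7
  obtain ⟨f8, p8, g8⟩ := root r8
  obtain ⟨f9, p9, g9⟩ := root r9
  obtain ⟨f10, p10, g10⟩ := root r10
  obtain ⟨f11, p11, g11⟩ := root r11
  obtain ⟨f12, p12, g12⟩ := root r12
  rw [g1, g2, g3, g4, g5, g6, g7, g8, g9, g10, g11, g12]
  simp only [← mul_pow, ← div_pow]
  repeat rw [Real.sqrt_sq (by positivity)]
  field_simp
  linear_combination (y3 * sgn (j₁ + a - x)) * hexp - y3 * sgn (j₁ + a - x) * e3 * e4 * hsgn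

lemma CG_eq_zero_of_not_isState {j₁ m₁ j₂ m₂ j m : ℝ}
    (h : ¬ (IsState j₁ m₁ ∧ IsState j m)) : CG q j₁ m₁ j₂ m₂ j m = 0 := by
  rw [CG, if_neg]
  tauto

lemma sixJ_eq_zero {a b e d c f : ℝ}
    (h : ¬ ((IsNat (a + c - f) ∧ IsNat (a - c + f) ∧ IsNat (c + f - a)) ∧
      (IsNat (b + d - f) ∧ IsNat (b - d + f) ∧ IsNat (d + f - b)))) :
    sixJ q a b e d c f = 0 := by
  rw [not_and_or] at h
  rcases h with h | h
  · rw [sixJ, triangle_eq_zero h]; simp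
  · rw [sixJ, triangle_comm b d f, triangle_eq_zero h]; simp

lemma nabla_sq_eq_zero (hq : 0 < q) {a b c : ℝ}
    (h : ¬ (IsNat (a + b - c) ∧ IsNat (a - b + c) ∧ IsNat (b + c - a))) :
    nabla q a b c ^ 2 = 0 := by
  rw [nabla_sq hq]
  simp only [not_and_or] at h
  rcases h with h | h | h <;> simp [qfact_of_not_isNat h]

/-- The recoupling relation. -/
theorem recoupling (hq : 0 < q) {L : Labels} (hL : L.Admissible) :
    CG q L.a L.a L.b (-L.b) L.j₂ L.m₂ * L.cg q =
      halfSum fun x =>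
        sgn (L.j₁ + L.j₂ + L.j) * √(qnum q (2 * x + 1) * qnum q (2 * L.j₂ + 1)) *
          sixJ q L.a L.b L.j₂ L.j L.j₁ x *
          CG q L.j₁ L.m₁ L.a L.a x L.m' * CG q x L.m' L.b (-L.b) L.j L.m := by
  obtain ⟨j₁, m₁, j₂, m₂, j, m⟩ := L
  obtain rfl : m = m₁ + m₂ := hL.weight_add
  obtain ⟨a, b, rfl, rfl⟩ : ∃ a b, j₂ = a + b ∧ m₂ = a - b :=
    ⟨(j₂ + m₂) / 2, (j₂ - m₂) / 2, by ring, by ring⟩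
  have ea : (a + b + (a - b)) / 2 = a := by ring
  have eb : (a + b - (a - b)) / 2 = b := by ring
  simp only [Labels.a, Labels.b, Labels.m', Labels.cg, ea, eb]
  rw [CG_eq_cgPoised hq hL, cgPoised, ea, eb, mul_halfSum, mul_halfSum]
  apply halfSum_congr
  intro n
  generalize (n : ℝ) / 2 = x
  rw [show a + b + (a - b) = 2 * a by ring, show a + b - (a - b) = 2 * b by ring,
    show 2 * a * (2 * a + 2) / 4 = a * (a + 1) by ring]
  -- Outside the triangle and weight conditions both summands are 0: on one side through a Δ or a
  -- Clebsch–Gordan coefficient, on the other through a vanishing ∇² or factorial.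
  by_cases h1 : IsNat (a + j₁ - x) ∧ IsNat (a - j₁ + x) ∧ IsNat (j₁ + x - a)
  swap
  · rw [sixJ_eq_zero fun h => h1 h.1, nabla_sq_eq_zero hq h1]
    simp
  by_cases h2 : IsNat (b + j - x) ∧ IsNat (b - j + x) ∧ IsNat (j + x - b)
  swap
  · rw [sixJ_eq_zero fun h => h2 h.2, nabla_sq_eq_zero hq h2]
    simp
  by_cases h3 : IsState x (m₁ + a)
  swap
  · rw [CG_eq_zero_of_not_isState fun h => h3 h.2, mul_zero, zero_mul]
    rw [IsState, not_and_or] at h3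
    rcases h3 with h | h
    · rw [qfact_of_not_isNat h]; simp
    · rw [qfact_of_not_isNat h]; simp
  exact recoupling_term hq hL h1.1 h1.2.1 h1.2.2 h2.1 h2.2.1 h2.2.2 h3.1 h3.2

end

/-! ### The Regge symmetries -/

/-- The labels with given parameters `p₁, p₂, p₃` and `p₄, p₅`. -/
noncomputable def Labels.ofParam (p : Fin 3 → ℝ) (r : Fin 2 → ℝ) : Labels where
  j₁ := (r 1 - p 2 - 1) / 2
  m₁ := -p 1 - 1 - (p 2 + r 1 + 1) / 2
  j₂ := (p 2 + r 1 + 1) / 2 + (p 0 + r 0 + 1) / 2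
  m₂ := (p 2 + r 1 + 1) / 2 - (p 0 + r 0 + 1) / 2
  j := (r 0 - p 0 - 1) / 2
  m := -p 1 - 1 - (p 0 + r 0 + 1) / 2

lemma Labels.lowerParam_ofParam (p : Fin 3 → ℝ) (r : Fin 2 → ℝ) :
    (ofParam p r).lowerParam = p := by
  ext i
  fin_cases i <;> simp [lowerParam, ofParam, a, b, m'] <;> ring

lemma Labels.upperParam_ofParam (p : Fin 3 → ℝ) (r : Fin 2 → ℝ) :
    (ofParam p r).upperParam = r := by
  ext i
  fin_cases i <;> simp [upperParam, ofParam, a, b] <;> ring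

lemma Labels.ofParam_lowerParam_upperParam {L : Labels} (hL : L.m = L.m₁ + L.m₂) :
    ofParam L.lowerParam L.upperParam = L := by
  ext <;> simp [lowerParam, upperParam, ofParam, a, b, m', hL] <;> ring

/-- The conditions on the parameters of admissible labels. -/
structure IsAdmissibleParam (p : Fin 3 → ℝ) (r : Fin 2 → ℝ) : Prop where
  add : ∀ i k, IsNat (p i + r k + 1)
  neg : ∀ i k, i ≠ k → IsNat (-p i - p k - 2)

/-- The nine integers that must be non-negative (j ± m for the three states, and the three triangle
defects) are exactly the six pᵢ + r_k + 1 and the three -pᵢ - p_k - 2. Admissibility is therefore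
symmetric in the parameters. -/
lemma Labels.admissible_ofParam_iff {p : Fin 3 → ℝ} {r : Fin 2 → ℝ} :
    (ofParam p r).Admissible ↔ IsAdmissibleParam p r := by
  have e : ∀ {x y : ℝ}, x = y → IsNat x → IsNat y := fun h => h ▸ id
  constructor
  · rintro ⟨⟨a1, a2⟩, ⟨b1, b2⟩, ⟨c1, c2⟩, t, t1, t2, -⟩
    simp only [ofParam] at *
    constructor
    · intro i k
      fin_cases i <;> fin_cases k <;> simp only [Fin.zero_eta, Fin.mk_one, Fin.reduceFinMk]
      · exact e (by ring) b2
      · exact e (by ring) t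
      · exact e (by ring) c2
      · exact e (by ring) a2
      · exact e (by ring) t2
      · exact e (by ring) b1
    · intro i k hik
      fin_cases i <;> fin_cases k <;>
        simp only [Fin.zero_eta, Fin.mk_one, Fin.reduceFinMk, ne_eq, not_true_eq_false] at hik ⊢
      · exact e (by ring) c1
      · exact e (by ring) t1
      · exact e (by ring) c1
      · exact e (by ring) a1
      · exact e (by ring) t1
      · exact e (by ring) a1
  · rintro ⟨h, h'⟩
    refine ⟨⟨?_, ?_⟩, ⟨?_, ?_⟩, ⟨?_, ?_⟩, ?_, ?_, ?_, ?_⟩ <;> simp only [ofParam]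
    · exact e (by ring) (h' 2 1 (by decide))
    · exact e (by ring) (h 1 1)
    · exact e (by ring) (h 2 1)
    · exact e (by ring) (h 0 0)
    · exact e (by ring) (h' 0 1 (by decide))
    · exact e (by ring) (h 1 0)
    · exact e (by ring) (h 0 1)
    · exact e (by ring) (h' 0 2 (by decide))
    · exact e (by ring) (h 2 0)
    · ring

/-- The summand of the very-well-poised series in symmetric form. -/
noncomputable def symTerm (q : ℝ) (p : Fin 3 → ℝ) (r : Fin 2 → ℝ) (j : ℝ) : ℝ :=
  sgn (r 1 - j) * q ^ (j * (j + 1)) * qnum q (2 * j + 1) *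
    (∏ i, qfact q (j - p i - 1) / qfact q (p i + j + 1)) *
      ∏ k, (qfact q (r k - j) * qfact q (r k + j + 1))⁻¹

/-- The normalized Clebsch–Gordan coefficient as a function of the parameters. -/
noncomputable def symCG (q : ℝ) (p : Fin 3 → ℝ) (r : Fin 2 → ℝ) : ℝ :=
  √((∏ i, ∏ k, qfact q (p i + r k + 1)) * qfact q (∑ k, r k + 1) /
      ∏ i, qfact q (p i - ∑ l, p l - 2)) *
    q ^ (((∑ i, p i + ∑ k, r k) ^ 2 - ∑ i, p i ^ 2 - ∑ k, r k ^ 2) / 4 +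
      4 / 3 * (∑ i, p i + ∑ k, r k) + 5 / 2) *
    halfSum (symTerm q p r)

/-- Only the sign singles out a parameter. On the support r₁ - j is an integer, so replacing r₁ by
r(τ 1) costs a factor independent of j. -/
lemma symTerm_comp (p : Fin 3 → ℝ) (r : Fin 2 → ℝ) (σ : Equiv.Perm (Fin 3))
    (τ : Equiv.Perm (Fin 2)) (j : ℝ) :
    symTerm q (p ∘ σ) (r ∘ τ) j = sgn (r (τ 1) - r 1) * symTerm q p r j := by
  have e1 : ∏ i, qfact q (j - (p ∘ σ) i - 1) / qfact q ((p ∘ σ) i + j + 1) =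
      ∏ i, qfact q (j - p i - 1) / qfact q (p i + j + 1) :=
    Equiv.prod_comp σ fun i => qfact q (j - p i - 1) / qfact q (p i + j + 1)
  have e2 : ∏ k, (qfact q ((r ∘ τ) k - j) * qfact q ((r ∘ τ) k + j + 1))⁻¹ =
      ∏ k, (qfact q (r k - j) * qfact q (r k + j + 1))⁻¹ :=
    Equiv.prod_comp τ fun k => (qfact q (r k - j) * qfact q (r k + j + 1))⁻¹
  rw [symTerm, symTerm, e1, e2]
  by_cases h : IsNat (r 1 - j)
  · rw [Function.comp_apply, show r (τ 1) - j = r (τ 1) - r 1 + (r 1 - j) by ring,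
      sgn_add _ h.int]
    ring
  · rw [Finset.prod_eq_zero (s := (Finset.univ : Finset (Fin 2))) (Finset.mem_univ 1) (by rw [qfact_of_not_isNat h]; simp)]
    ring

/-- The Regge symmetries in terms of the parameters. -/
lemma symCG_comp (p : Fin 3 → ℝ) (r : Fin 2 → ℝ) (σ : Equiv.Perm (Fin 3))
    (τ : Equiv.Perm (Fin 2)) :
    symCG q (p ∘ σ) (r ∘ τ) = sgn (r (τ 1) - r 1) * symCG q p r := by
  have e1 : ∏ i, ∏ k, qfact q ((p ∘ σ) i + (r ∘ τ) k + 1) =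
      ∏ i, ∏ k, qfact q (p i + r k + 1) := by
    rw [← Equiv.prod_comp σ fun i => ∏ k, qfact q (p i + r k + 1)]
    exact Finset.prod_congr rfl fun i _ =>
      Equiv.prod_comp τ fun k => qfact q (p (σ i) + r k + 1)
  have e2 : ∑ i, (p ∘ σ) i = ∑ i, p i := Equiv.sum_comp σ p
  have e3 : ∑ k, (r ∘ τ) k = ∑ k, r k := Equiv.sum_comp τ r
  have e4 : ∑ i, (p ∘ σ) i ^ 2 = ∑ i, p i ^ 2 := Equiv.sum_comp σ fun i => p i ^ 2
  have e5 : ∑ k, (r ∘ τ) k ^ 2 = ∑ k, r k ^ 2 := Equiv.sum_comp τ fun k => r k ^ 2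
  have e6 : ∏ i, qfact q ((p ∘ σ) i - ∑ l, p l - 2) = ∏ i, qfact q (p i - ∑ l, p l - 2) :=
    Equiv.prod_comp σ fun i => qfact q (p i - ∑ l, p l - 2)
  have e7 : symTerm q (p ∘ σ) (r ∘ τ) = fun j => sgn (r (τ 1) - r 1) * symTerm q p r j :=
    funext (symTerm_comp p r σ τ)
  rw [symCG, symCG, e2, e3, e4, e5, e1, e6, e7, ← mul_halfSum]
  ring

/-- The very-well-poised expression becomes symmetric once [2j + 1]^(1/2) is divided out: the
factorials under the root are then the nine admissibility integers together with j₁ + j₂ + j + 1. -/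
lemma Labels.reduced_eq_symCG (hq : 0 < q) {L : Labels} (hL : L.Admissible) :
    L.reduced q = symCG q L.lowerParam L.upperParam := by
  obtain ⟨j₁, m₁, j₂, m₂, j, m⟩ := L
  obtain rfl : m = m₁ + m₂ := hL.weight_add
  obtain ⟨a, b, rfl, rfl⟩ : ∃ a b, j₂ = a + b ∧ m₂ = a - b :=
    ⟨(j₂ + m₂) / 2, (j₂ - m₂) / 2, by ring, by ring⟩
  have ea : (a + b + (a - b)) / 2 = a := by ring
  have eb : (a + b - (a - b)) / 2 = b := by ring
  have hj := hL.state.isNat_two_mul.nonneg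
  dsimp only at hj
  have hj0 := qnum_pos hq (by linarith : 0 < 2 * j + 1)
  have hF := qfact_nonneg (q := q) hq
  simp only [Labels.reduced, Labels.lowerParam, Labels.upperParam, Labels.a, Labels.b,
    Labels.m', Labels.cg, ea, eb]
  rw [CG_eq_cgPoised hq hL, cgPoised, ea, eb]
  have hterm : (fun x => sgn (j₁ + a - x) * q ^ (x * (x + 1)) * qnum q (2 * x + 1) *
        qfact q (x + (m₁ + a)) /
        (nabla q a j₁ x ^ 2 * nabla q b j x ^ 2 * qfact q (x - (m₁ + a)))) =
      symTerm q ![b - j - 1, -(m₁ + a) - 1, a - j₁ - 1] ![b + j, a + j₁] := by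
    ext x
    rw [nabla_sq hq, nabla_sq hq, symTerm, Fin.prod_univ_three, Fin.prod_univ_two]
    simp only [Matrix.cons_val]
    rw [show x - (b - j - 1) - 1 = j + x - b by ring, show b - j - 1 + x + 1 = b - j + x by ring,
      show x - (-(m₁ + a) - 1) - 1 = x + (m₁ + a) by ring,
      show -(m₁ + a) - 1 + x + 1 = x - (m₁ + a) by ring,
      show x - (a - j₁ - 1) - 1 = j₁ + x - a by ring,
      show a - j₁ - 1 + x + 1 = a - j₁ + x by ring, add_comm j₁ a]
    simp only [div_eq_mul_inv, mul_inv, inv_inv]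
    ring
  rw [hterm, symCG]
  simp only [Fin.prod_univ_three, Fin.prod_univ_two, Fin.sum_univ_three, Fin.sum_univ_two,
    Matrix.cons_val]
  generalize halfSum _ = S
  have hroot : nabla q (a + b) j₁ j * √(qnum q (2 * j + 1) * qfact q (a + b + (a - b)) *
      qfact q (a + b - (a - b)) * qfact q (j₁ - m₁) * qfact q (j - (m₁ + (a - b))) /
      (qfact q (j₁ + m₁) * qfact q (j + (m₁ + (a - b))))) =
      √(qnum q (2 * j + 1)) *
      √((qfact q (b - j - 1 + (b + j) + 1) * qfact q (b - j - 1 + (a + j₁) + 1) *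
        (qfact q (-(m₁ + a) - 1 + (b + j) + 1) * qfact q (-(m₁ + a) - 1 + (a + j₁) + 1)) *
        (qfact q (a - j₁ - 1 + (b + j) + 1) * qfact q (a - j₁ - 1 + (a + j₁) + 1))) *
        qfact q (b + j + (a + j₁) + 1) /
        (qfact q (b - j - 1 - (b - j - 1 + (-(m₁ + a) - 1) + (a - j₁ - 1)) - 2) *
          qfact q (-(m₁ + a) - 1 - (b - j - 1 + (-(m₁ + a) - 1) + (a - j₁ - 1)) - 2) *
          qfact q (a - j₁ - 1 - (b - j - 1 + (-(m₁ + a) - 1) + (a - j₁ - 1)) - 2))) := by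
    rw [nabla, ← Real.sqrt_mul hj0.le, ← Real.sqrt_mul (by
      exact div_nonneg (mul_nonneg (mul_nonneg (hF _) (hF _)) (hF _)) (hF _))]
    congr 1
    rw [show b - j - 1 + (b + j) + 1 = a + b - (a - b) by ring,
      show b - j - 1 + (a + j₁) + 1 = a + b + j₁ - j by ring,
      show -(m₁ + a) - 1 + (b + j) + 1 = j - (m₁ + (a - b)) by ring,
      show -(m₁ + a) - 1 + (a + j₁) + 1 = j₁ - m₁ by ring,
      show a - j₁ - 1 + (b + j) + 1 = a + b - j₁ + j by ring,
      show a - j₁ - 1 + (a + j₁) + 1 = a + b + (a - b) by ring,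
      show b + j + (a + j₁) + 1 = a + b + j₁ + j + 1 by ring,
      show b - j - 1 - (b - j - 1 + (-(m₁ + a) - 1) + (a - j₁ - 1)) - 2 = j₁ + m₁ by ring,
      show -(m₁ + a) - 1 - (b - j - 1 + (-(m₁ + a) - 1) + (a - j₁ - 1)) - 2 =
        j₁ + j - (a + b) by ring,
      show a - j₁ - 1 - (b - j - 1 + (-(m₁ + a) - 1) + (a - j₁ - 1)) - 2 =
        j + (m₁ + (a - b)) by ring]
    simp only [div_eq_mul_inv, mul_inv]
    ring
  have hr := (Real.sqrt_pos.2 hj0).ne'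
  rw [hroot, div_eq_iff hr]
  -- The factor q^((m₂ - m₁)/3) is what completes the exponent to a symmetric function of the
  -- parameters.
  have hexp : q ^ ((a - b - m₁) / 3) * q ^ (((a + b) * (a + b + 1) - j₁ * (j₁ + 1) -
        j * (j + 1)) / 2 - m₁ * (a + b) - (a + b + (a - b)) * (a + b + (a - b) + 2) / 4) =
      q ^ (((b - j - 1 + (-(m₁ + a) - 1) + (a - j₁ - 1) + (b + j + (a + j₁))) ^ 2 -
        ((b - j - 1) ^ 2 + (-(m₁ + a) - 1) ^ 2 + (a - j₁ - 1) ^ 2) -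
        ((b + j) ^ 2 + (a + j₁) ^ 2)) / 4 +
        4 / 3 * (b - j - 1 + (-(m₁ + a) - 1) + (a - j₁ - 1) + (b + j + (a + j₁))) + 5 / 2) := by
    rw [← Real.rpow_add hq]
    congr 1
    ring
  rw [← hexp]
  ring

/-- The Regge symmetries of the Clebsch–Gordan coefficients. -/
theorem regge_symmetry (hq : 0 < q) {L : Labels} (hL : L.Admissible) (σ : Equiv.Perm (Fin 3))
    (τ : Equiv.Perm (Fin 2)) :
    ∃ L' : Labels, L'.Admissible ∧ L'.lowerParam = L.lowerParam ∘ σ ∧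
      L'.upperParam = L.upperParam ∘ τ ∧
      L'.reduced q = sgn (L'.upperParam 1 - L.upperParam 1) * L.reduced q := by
  have e := Labels.ofParam_lowerParam_upperParam hL.weight_add
  have h : IsAdmissibleParam L.lowerParam L.upperParam := by
    rw [← Labels.admissible_ofParam_iff, e]; exact hL
  have h' : IsAdmissibleParam (L.lowerParam ∘ σ) (L.upperParam ∘ τ) :=
    ⟨fun i k => h.add (σ i) (τ k), fun i k hik => h.neg (σ i) (σ k) fun h => hik (σ.injective h)⟩
  refine ⟨Labels.ofParam (L.lowerParam ∘ σ) (L.upperParam ∘ τ),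
    Labels.admissible_ofParam_iff.2 h', Labels.lowerParam_ofParam _ _,
    Labels.upperParam_ofParam _ _, ?_⟩
  rw [Labels.reduced_eq_symCG hq (Labels.admissible_ofParam_iff.2 h'),
    Labels.reduced_eq_symCG hq hL, Labels.lowerParam_ofParam, Labels.upperParam_ofParam, symCG_comp,
    Function.comp_apply]

end QuantumSU2

open QuantumSU2 in
theorem mainTheorem11 (q : ℝ) (hq : 0 < q) :
    -- the Clebsch–Gordan coefficients are well defined
    (∀ n₁ n₂ n : ℕ, Even (n₁ + n₂ + n) → n ≤ n₁ + n₂ → n₁ ≤ n₂ + n → n₂ ≤ n₁ + n →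
      ∃! C, IsClebschGordan q n₁ n₂ n C) ∧
    -- the recoupling relation
    (∀ L : Labels, L.Admissible →
      CG q L.a L.a L.b (-L.b) L.j₂ L.m₂ * L.cg q =
        halfSum fun x =>
          sgn (L.j₁ + L.j₂ + L.j) * √(qnum q (2 * x + 1) * qnum q (2 * L.j₂ + 1)) *
            sixJ q L.a L.b L.j₂ L.j L.j₁ x *
            CG q L.j₁ L.m₁ L.a L.a x L.m' * CG q x L.m' L.b (-L.b) L.j L.m) ∧
    -- the very well-poised expression
    (∀ L : Labels, L.Admissible →
      L.cg q =
        nabla q L.j₂ L.j₁ L.j *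
          √(qnum q (2 * L.j + 1) * qfact q (L.j₂ + L.m₂) * qfact q (L.j₂ - L.m₂) *
              qfact q (L.j₁ - L.m₁) * qfact q (L.j - L.m) /
            (qfact q (L.j₁ + L.m₁) * qfact q (L.j + L.m))) *
          q ^ ((L.j₂ * (L.j₂ + 1) - L.j₁ * (L.j₁ + 1) - L.j * (L.j + 1)) / 2 - L.m₁ * L.j₂ -
            (L.j₂ + L.m₂) * (L.j₂ + L.m₂ + 2) / 4) *
          halfSum fun x =>
            sgn (L.j₁ + (L.j₂ + L.m₂) / 2 - x) * q ^ (x * (x + 1)) * qnum q (2 * x + 1) *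
                qfact q (x + L.m') /
              (nabla q ((L.j₂ + L.m₂) / 2) L.j₁ x ^ 2 * nabla q ((L.j₂ - L.m₂) / 2) L.j x ^ 2 *
                qfact q (x - L.m'))) ∧
    -- the 12 Regge symmetries
    (∀ L : Labels, L.Admissible → ∀ (σ : Equiv.Perm (Fin 3)) (τ : Equiv.Perm (Fin 2)),
      ∃ L' : Labels, L'.Admissible ∧ L'.lowerParam = L.lowerParam ∘ σ ∧
        L'.upperParam = L.upperParam ∘ τ ∧
        L'.reduced q = sgn (L'.upperParam 1 - L.upperParam 1) * L.reduced q) ∧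
    -- the transformation formula
    (∀ p₁ p₂ p₃ p₄ p₅ : ℝ,
      (∃ k : ℤ, 2 * p₁ = k) → (∃ k : ℤ, p₂ - p₁ = k) → (∃ k : ℤ, p₃ - p₁ = k) →
      (∃ k : ℤ, p₄ - p₁ = k) → (∃ k : ℤ, p₅ - p₁ = k) →
      p₁ + p₂ ≤ -2 → p₁ + p₃ ≤ -2 → p₂ + p₃ ≤ -2 →
      (halfSum fun j =>
        sgn (p₂ + j + 1) * q ^ (j * (j + 1)) * qnum q (2 * j + 1) *
            qfact q (j - p₁ - 1) * qfact q (j - p₂ - 1) * qfact q (j - p₃ - 1) /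
          (qfact q (p₁ + j + 1) * qfact q (p₂ + j + 1) * qfact q (p₃ + j + 1) *
            qfact q (p₄ - j) * qfact q (p₄ + j + 1) * qfact q (p₅ - j) *
            qfact q (p₅ + j + 1))) =
        q ^ (-(p₄ + 1) * (p₅ + 1) - p₂ * (p₄ + p₅ + 1)) * qfact q (-p₁ - p₃ - 2) /
            (qfact q (p₁ + p₄ + 1) * qfact q (p₂ + p₅ + 1) * qfact q (p₃ + p₄ + 1)) *
          ∑ᶠ u : ℕ, (-1) ^ u * q ^ ((u : ℝ) * (p₂ + p₅ + 1)) *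
              qfact q (p₄ - p₃ - 1 - u) * qfact q (p₄ - p₁ - 1 - u) /
            (qfact q u * qfact q (-p₁ - p₃ - 2 - u) * qfact q (p₂ + p₄ + 1 - u) *
              qfact q (p₄ + p₅ + 1 - u))) := by
  refine ⟨fun n₁ n₂ n he h h₁ h₂ => existsUnique_isClebschGordan hq (coupled_of_even he h h₁ h₂),
    fun L hL => recoupling hq hL, fun L hL => CG_eq_cgPoised hq hL,
    fun L hL σ τ => regge_symmetry hq hL σ τ, ?_⟩
  rintro p₁ p₂ p₃ p₄ p₅ ⟨k₁, h₁⟩ ⟨k₂, h₂⟩ ⟨k₃, h₃⟩ ⟨k₄, h₄⟩ - h12 h13 h23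
  -- Integrality of -p₁ - p₃ - 2, 2p₄ and p₂ + p₄ + 1 follows on writing each as a multiple of 2p₁
  -- plus integer differences.
  exact halfSum_poisedTerm hq
    (isNat_of_int ⟨-k₁ - k₃ - 2, by push_cast; linarith⟩ (by linarith))
    ⟨k₁ + 2 * k₄, by push_cast; linarith⟩ ⟨k₁ + k₂ + k₄ + 1, by push_cast; linarith⟩ h12 h23
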